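/- Let $E/\mathbb{Q}$ be an elliptic curve $y^2=x^3+a_4x+a_6$ with $a_4,a_6\in\mathbb{Z}$ such that $E(\mathbb{Q})$ has positive rank, and let $E_{\mathrm{tor}}(\mathbb{Q})$ be the torsion subgroup of $E(\mathbb{Q})$. For $P=(A/C^2,B/C^3)\in E(\mathbb{Q})$ with integers $A,B,C$ and $\gcd(A,C)=\gcd(B,C)=1$, let $h_W(P)=\log\max(|A|,C^2)$, and let $h_W(O)=0$ for the point at infinity $O$. Put $$\widehat h(P)=\tfrac12\lim_{n\to\infty}\frac{h_W(nP)}{n^2},\qquad \delta(E)=\sup_{P\in E(\mathbb{Q})}\left(\tfrac12h_W(P)-\widehat h(P)\right).$$ For $D>0$ let $H(-D)$ be the Hurwitz–Kronecker class number: the number of $\mathrm{SL}_2(\mathbb{Z})$-equivalence classes of positive definite integral binary quadratic forms (primitive or not) of discriminant $-D$, where the class of $F$ is counted with multiplicity $1/|\mathrm{Aut}(F)|$, $\mathrm{Aut}(F)$ being the stabilizer of $F$ in $\mathrm{SL}_2(\mathbb{Z})/\{\pm1\}$. Let $P\in E(\mathbb{Q})$ be a point of infinite order, and let $t$ be a positive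 integer for which $D=4(t^3+a_4t-a_6)$ satisfies $$4(t+1)^2\exp(4\delta(E))<D<(t+1)^2t^2 .$$ Then $$\widehat h(P)\ \ge\ \frac{|E_{\mathrm{tor}}(\mathbb{Q})|^2}{\left(H(-D)+|E_{\mathrm{tor}}(\mathbb{Q})|\right)^2}\cdot T_E(-D,t),\qquad T_E(-D,t)=\log\left(\frac{D}{4(t+1)^2}\right)-4\,\delta(E).$$ -/

import Mathlib

open Filter Topology MatrixGroups

/-! ### Heights on `y² = x³ + a₄ x + a₆` -/

/-- The Weierstrass curve `y² = x³ + a₄ x + a₆` over `ℚ`, with integers `a₄`, `a₆`. -/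
def shortCurve (a₄ a₆ : ℤ) : WeierstrassCurve ℚ where
  a₁ := 0
  a₂ := 0
  a₃ := 0
  a₄ := a₄
  a₆ := a₆

/-- The group `E(ℚ)` of rational points (including the point at infinity). -/
abbrev RatPoint (a₄ a₆ : ℤ) : Type := (shortCurve a₄ a₆).toAffine.Point

/-- The logarithmic (Weil) height `h_W(P) = log max(|A|, C²)` of a point with `x`-coordinate
`A / C²` in lowest terms; the point at infinity (`A = 1`, `C = 0`) has height `0`. -/
noncomputable def weilHeight {a₄ a₆ : ℤ} : RatPoint a₄ a₆ → ℝ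
  | .zero => 0
  | .some x _ _ => Real.log (max |(x.num : ℝ)| (x.den : ℝ))

/-- `h_W(P)` is the logarithmic height of the rational number `x(P)`. -/
theorem weilHeight_some {a₄ a₆ : ℤ} (x y : ℚ) (h : (shortCurve a₄ a₆).toAffine.Nonsingular x y) :
    weilHeight (a₄ := a₄) (a₆ := a₆) (.some x y h) = Height.logHeight₁ x := by
  rw [Rat.logHeight₁_eq_log_max]
  simp [weilHeight]

/-- The canonical height `ĥ(P) = ½ lim h_W(nP) / n²`. -/
noncomputable def canonHeight {a₄ a₆ : ℤ} (P : RatPoint a₄ a₆) : ℝ :=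
  (1 / 2) * limUnder atTop (fun n : ℕ => weilHeight (n • P) / (n : ℝ) ^ 2)

/-- `δ(E)`, the supremum over `P ∈ E(ℚ)` of `½ h_W(P) - ĥ(P)`. -/
noncomputable def heightDelta (a₄ a₆ : ℤ) : ℝ :=
  ⨆ P : RatPoint a₄ a₆, ((1 / 2) * weilHeight P - canonHeight P)

/-- The order of the torsion subgroup of `E(ℚ)`. -/
noncomputable def torsionOrder (a₄ a₆ : ℤ) : ℕ :=
  Nat.card (AddCommGroup.torsion (RatPoint a₄ a₆))

/-- `T_E(-D, t) = log (D / (4 (t + 1)²)) - 4 δ(E)`. -/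
noncomputable def heightT (a₄ a₆ D t : ℤ) : ℝ :=
  Real.log ((D : ℝ) / (4 * ((t : ℝ) + 1) ^ 2)) - 4 * heightDelta a₄ a₆

/-! ### Binary quadratic forms and Hurwitz class numbers -/

/-- The integral binary quadratic form `a X² + b X Y + c Y²`. -/
@[ext]
structure BinForm where
  a : ℤ
  b : ℤ
  c : ℤ

namespace BinForm

/-- The value `f(x, y)`. -/
def eval (f : BinForm) (x y : ℤ) : ℤ := f.a * x ^ 2 + f.b * x * y + f.c * y ^ 2

/-- The discriminant `b² - 4ac`. -/
def disc (f : BinForm) : ℤ := f.b ^ 2 - 4 * f.a * f.c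

/-- `f` is positive definite. -/
def PosDef (f : BinForm) : Prop := ∀ x y : ℤ, (x ≠ 0 ∨ y ≠ 0) → 0 < f.eval x y

/-- `SL₂(ℤ)` acts by linear substitution: `(γ • f)(X, Y) = f((X, Y) γ)`, where `(X, Y)` is
multiplied by `γ` as a row vector. -/
instance : MulAction SL(2, ℤ) BinForm where
  smul γ f :=
    { a := f.a * γ 0 0 ^ 2 + f.b * γ 0 0 * γ 0 1 + f.c * γ 0 1 ^ 2
      b := 2 * f.a * γ 0 0 * γ 1 0 + f.b * (γ 0 0 * γ 1 1 + γ 1 0 * γ 0 1)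
        + 2 * f.c * γ 0 1 * γ 1 1
      c := f.a * γ 1 0 ^ 2 + f.b * γ 1 0 * γ 1 1 + f.c * γ 1 1 ^ 2 }
  one_smul f := by
    ext <;> simp [HSMul.hSMul]
  mul_smul γ γ' f := by
    ext <;> simp [HSMul.hSMul, Matrix.mul_apply, Fin.sum_univ_two] <;> ring

/-- The action is substitution into the polynomial. -/
theorem eval_smul (γ : SL(2, ℤ)) (f : BinForm) (x y : ℤ) :
    (γ • f).eval x y = f.eval (x * γ 0 0 + y * γ 1 0) (x * γ 0 1 + y * γ 1 1) := by
  simp only [eval, HSMul.hSMul, SMul.smul]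
  ring

end BinForm

/-- The positive definite integral binary quadratic forms (primitive or not) of discriminant
`Δ`. -/
def PosDefForm (Δ : ℤ) : Type := {f : BinForm // f.PosDef ∧ f.disc = Δ}

/-- `SL₂(ℤ)`-equivalence of forms of discriminant `Δ`. -/
def PosDefForm.setoid (Δ : ℤ) : Setoid (PosDefForm Δ) :=
  (MulAction.orbitRel SL(2, ℤ) BinForm).comap Subtype.val

/-- The Hurwitz–Kronecker class number `H(Δ)` of a negative discriminant `Δ`: the number of
`SL₂(ℤ)`-classes of positive definite integral forms of discriminant `Δ`, primitive or not, the
class of `f` being counted with multiplicity `1 / |Aut(f)|`. Here `Aut(f)` is the stabilizer of `f`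
in `SL₂(ℤ) / {± 1}`, which has half as many elements as the stabilizer in `SL₂(ℤ)`. -/
noncomputable def hurwitzH (Δ : ℤ) : ℝ :=
  ∑ᶠ C : Quotient (PosDefForm.setoid Δ),
    2 / (Nat.card (MulAction.stabilizer SL(2, ℤ) (Quotient.out C).val) : ℝ)

/-!
The points of small height on the curve are counted by binary quadratic forms. Put `D = 4n` and
`f(x) = x³ + a₄ x + a₆`, so that `f(-t) = -n`. For a point `R = (A / C², B / C³)` with
`α = A + t C²` the identity `B² + n C⁶ = α G` shows that `-n` is a square modulo `α`, and `R` gives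
the form `pointForm` with first coefficient `α` and discriminant `-4n = -D`. If the height of `R` is
so small that `0 < α < √n`, then this form has no automorphs but `± 1` and its class determines `α`
and hence `R` up to sign (`Box.eq_or_of_smul_pointForm`). If `P` had smaller canonical height than
claimed, then the points `k P + τ` with `τ` torsion and `|k| ≤ m`, for a suitable `m`, would all
have small height (`box_smallPoints`), and there would be more than `H(-D)` of them. So the theorem
follows from `Box.card_le_hurwitzH`: the points of a finite set `S` of this kind are at most as many
as the classes.

The obstacle is that `R` and `-R` can have equivalent forms; this happens when `α ∣ 2B`. There are
two ways to make up for the lost forms.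

* Suppose that some point of `S` reduces to a singular point `(-t, 0)` modulo a prime `p ≥ 5`, or
  modulo `9`. Adding to it points with other reduction gives points of the same kind
  (`SingularAt.dvd_alpha_add`), so there are many such points in `S`
  (`two_mul_card_levelBox_low_le`). Their forms have contents divisible by `p`. Dividing by `p` and
  lifting back by `f(X, Y) ↦ f(pX, Y)` along the projective line over `ZMod p` yields about `p`
  times as many primitive forms of discriminant `-4n` (`BinForm.IsSystem.mul_card_le_hurwitzH`),
  more than is needed.
* Otherwise, the form of one of `R`, `-R` is replaced by another ambiguous form, `d X² + (n/d) Y²`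
  or `2d X² + 2d XY + ((d + n/d)/2) Y²`, where `d` depends on `α` (`Replacement`). One has to check
  that these forms do not come from points of `S` (`Box.exists_replacement`). Apart from a few
  special cases with `α' = 2`, a coincidence would lead to two points whose numbers `α`, `α'`
  satisfy `α' = 2α` or `n = 2αα'`; these are excluded by congruences (`Box.not_alpha_double`) and by
  the small heights of their doubles, sums and differences (`Box.not_two_mul_alpha_mul`).

The height estimates rest on the approximate parallelogram law for the Weil height: it makes the
canonical height a quadratic form at bounded distance from half the Weil height
(`canonHeight_spec`), so that `½ h ≤ ĥ + δ` holds with a finite `δ ≥ 0`.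
-/

/-! ### Canonical heights from the approximate parallelogram law -/

section QuasiQuadratic

variable {G : Type*} [AddCommGroup G]

/-- A function satisfying the parallelogram law is homogeneous of degree two. -/
theorem map_nsmul_of_parallelogram {q : G → ℝ}
    (hq : ∀ P Q, q (P + Q) + q (P - Q) = 2 * q P + 2 * q Q) (n : ℕ) (P : G) :
    q (n • P) = (n : ℝ) ^ 2 * q P := by
  have h0 : q 0 = 0 := by have := hq 0 0; simp at this; linarith
  induction n using Nat.strong_induction_on with
  | _ n ih =>
    match n with
    | 0 => simp [h0]
    | 1 => simp
    | k + 2 =>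
      have h := hq ((k + 1) • P) P
      have e1 : (k + 1) • P + P = (k + 2) • P := by rw [← succ_nsmul]
      have e2 : (k + 1) • P - P = k • P := by rw [succ_nsmul]; abel
      rw [e1, e2, ih (k + 1) (by omega), ih k (by omega)] at h
      push_cast at h ⊢
      linarith

/-- Tate's limit argument: a function that satisfies the parallelogram law up to a bounded error is
at bounded distance from one that satisfies it exactly. -/
theorem exists_parallelogram_of_approx {h : G → ℝ} {c : ℝ}
    (hh : ∀ P Q, |h (P + Q) + h (P - Q) - 2 * h P - 2 * h Q| ≤ c) :
    ∃ q : G → ℝ, (∀ P Q, q (P + Q) + q (P - Q) = 2 * q P + 2 * q Q) ∧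
      ∃ B, ∀ P, |h P - q P| ≤ B := by
  obtain ⟨d, hd⟩ : ∃ d, ∀ P, |h (2 • P) - 4 * h P| ≤ d := by
    refine ⟨c + |h 0|, fun P ↦ ?_⟩
    have := hh P P
    rw [sub_self, ← two_nsmul] at this
    have e : h (2 • P) - 4 * h P = (h (2 • P) + h 0 - 2 * h P - 2 * h P) - h 0 := by ring
    rw [e]
    exact (abs_sub _ _).trans (by linarith)
  let u : G → ℕ → ℝ := fun P k ↦ h (2 ^ k • P) / 4 ^ k
  have hu : ∀ P k, dist (u P k) (u P (k + 1)) ≤ d / 4 * (1 / 4) ^ k := by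
    intro P k
    have := hd (2 ^ k • P)
    rw [smul_smul, ← pow_succ'] at this
    rw [dist_comm, Real.dist_eq]
    have e : u P (k + 1) - u P k = (h (2 ^ (k + 1) • P) - 4 * h (2 ^ k • P)) / 4 ^ (k + 1) := by
      simp only [u, pow_succ]; field_simp
    rw [e, abs_div, abs_of_pos (show (0 : ℝ) < 4 ^ (k + 1) by positivity)]
    rw [div_le_iff₀ (by positivity)]
    calc _ ≤ d := this
      _ = _ := by rw [one_div, inv_pow, pow_succ]; field_simp
  have hlim : ∀ P, ∃ a, Tendsto (u P) atTop (𝓝 a) := fun P ↦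
    cauchySeq_tendsto_of_complete (cauchySeq_of_le_geometric _ _ (by norm_num) (hu P))
  choose q hq using hlim
  refine ⟨q, fun P Q ↦ ?_, d / 4 / (1 - 1 / 4), fun P ↦ ?_⟩
  · have h1 : Tendsto (fun k ↦ u (P + Q) k + u (P - Q) k - 2 * u P k - 2 * u Q k) atTop
        (𝓝 (q (P + Q) + q (P - Q) - 2 * q P - 2 * q Q)) :=
      (((hq _).add (hq _)).sub ((hq _).const_mul 2)).sub ((hq _).const_mul 2)
    have h2 : Tendsto (fun k ↦ u (P + Q) k + u (P - Q) k - 2 * u P k - 2 * u Q k) atTop (𝓝 0) := by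
      have h4 : Tendsto (fun k : ℕ ↦ c * (1 / 4 : ℝ) ^ k) atTop (𝓝 0) := by
        simpa using (tendsto_pow_atTop_nhds_zero_of_lt_one (r := (1 / 4 : ℝ))
          (by norm_num) (by norm_num)).const_mul c
      refine squeeze_zero_norm (fun k ↦ ?_) h4
      have := hh (2 ^ k • P) (2 ^ k • Q)
      rw [← smul_add, ← smul_sub] at this
      have e : u (P + Q) k + u (P - Q) k - 2 * u P k - 2 * u Q k = (h (2 ^ k • (P + Q)) +
          h (2 ^ k • (P - Q)) - 2 * h (2 ^ k • P) - 2 * h (2 ^ k • Q)) * (1 / 4) ^ k := by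
        simp only [u, one_div, inv_pow]; field_simp
      rw [e, Real.norm_eq_abs, abs_mul, abs_of_pos (show (0 : ℝ) < (1 / 4) ^ k by positivity)]
      gcongr
    have := tendsto_nhds_unique h1 h2
    linarith
  · have := dist_le_of_le_geometric_of_tendsto₀ _ _ (by norm_num) (hu P) (hq P)
    rw [Real.dist_eq] at this
    simpa [u] using this

end QuasiQuadratic

section Height

open Height MvPolynomial WeierstrassCurve WeierstrassCurve.Affine

variable {a₄ a₆ : ℤ}

theorem weilHeight_eq_logHeight_xRep (P : RatPoint a₄ a₆) :
    weilHeight P = logHeight P.xRep := by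
  cases P with
  | zero =>
    change (0 : ℝ) = logHeight ![1, 0]
    rw [logHeight_swap, ← logHeight₁_div_eq_logHeight]; simp
  | some x y h => rw [weilHeight_some, logHeight₁_eq_logHeight, Point.xRep_some]

theorem shortCurve_eval_addSubMap (s t u : ℚ) :
    (fun i ↦ (addSubMap (shortCurve a₄ a₆) i).eval ![s, t, u]) =
      ![s ^ 2 - 2 * a₄ * s * u - 4 * a₆ * t * u + a₄ ^ 2 * u ^ 2,
        2 * t * s + 2 * a₄ * t * u + 4 * a₆ * u ^ 2, t ^ 2 - 4 * s * u] := by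
  funext i
  fin_cases i <;> simp [addSubMap, WeierstrassCurve.b₂, WeierstrassCurve.b₄, WeierstrassCurve.b₆,
    WeierstrassCurve.b₈, shortCurve]

theorem shortCurve_equation {x y : ℚ} :
    (shortCurve a₄ a₆).toAffine.Equation x y ↔ y ^ 2 = x ^ 3 + a₄ * x + a₆ := by
  rw [Affine.equation_iff]; simp [shortCurve]

/-- On `E(ℚ)` the polynomial map `addSubMap` computes the symmetric functions of `x(P + Q)` and
`x(P - Q)` from those of `x(P)` and `x(Q)`, up to a common factor. -/
theorem exists_smul_sym2x (P Q : RatPoint a₄ a₆) :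
    ∃ c : ℚ, c ≠ 0 ∧ (fun i ↦ (addSubMap (shortCurve a₄ a₆) i).eval (P.sym2x Q)) =
      c • (P + Q).sym2x (P - Q) := by
  have hself : ∀ P : RatPoint a₄ a₆,
      ∃ c : ℚ, c ≠ 0 ∧ (fun i ↦ (addSubMap (shortCurve a₄ a₆) i).eval (P.sym2x P)) =
        c • (P + P).sym2x 0 := by
    rintro (_ | ⟨x, y, h⟩)
    · refine ⟨1, one_ne_zero, ?_⟩
      change (fun i ↦ eval (Point.sym2x (0 : RatPoint a₄ a₆) 0) _) =
        (1 : ℚ) • Point.sym2x ((0 : RatPoint a₄ a₆) + 0) 0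
      rw [add_zero, Point.sym2x_zero_zero, shortCurve_eval_addSubMap]
      ext i; fin_cases i <;> simp
    · have heq := shortCurve_equation.mp h.1
      have hns := ((Affine.nonsingular_iff _ _).mp h).2
      simp only [shortCurve] at hns
      by_cases hy : y = 0
      · subst hy
        have h2 : (Point.some x 0 h : RatPoint a₄ a₆) + Point.some x 0 h = 0 := by
          apply Point.add_of_Y_eq rfl; simp [shortCurve, Affine.negY]
        have hne : 3 * x ^ 2 + a₄ ≠ 0 := by
          intro h0; apply hns.resolve_right (by simp); simp; linarith
        refine ⟨(3 * x ^ 2 + a₄) ^ 2, pow_ne_zero _ hne, ?_⟩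
        rw [h2, Point.sym2x_some_some, Point.sym2x_zero_zero, shortCurve_eval_addSubMap]
        have ha : (a₆ : ℚ) = - (x ^ 3 + a₄ * x) := by linarith
        rw [ha]
        ext i; fin_cases i <;> simp <;> ring
      · have hyn : y ≠ (shortCurve a₄ a₆).toAffine.negY x y := by
          simp only [shortCurve, Affine.negY]
          intro h0; apply hy; linarith
        refine ⟨4 * y ^ 2, by positivity, ?_⟩
        rw [Point.add_self_of_Y_ne hyn, Point.sym2x_some_some, Point.sym2x_some_zero,
          shortCurve_eval_addSubMap, Affine.slope_of_Y_ne rfl hyn]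
        simp only [shortCurve, Affine.negY, Affine.addX]
        have ha : (a₆ : ℚ) = y ^ 2 - (x ^ 3 + a₄ * x) := by linarith
        rw [ha]
        ext i; fin_cases i <;> simp <;> field_simp <;> ring
  by_cases hPQ : P = Q
  · subst hPQ; simpa using hself P
  by_cases hPQ' : P = -Q
  · obtain ⟨c, hc, h⟩ := hself P
    refine ⟨c, hc, ?_⟩
    have : P + Q = 0 := by rw [hPQ']; simp
    rw [this, show P - Q = P + P by rw [sub_eq_add_neg, ← hPQ'], Point.sym2x_comm 0, ← h]
    rw [show Q = -P by rw [hPQ', neg_neg], Point.sym2x_neg_right]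
  rcases P with _ | ⟨x₁, y₁, h₁⟩
  · rcases Q with _ | ⟨x₂, y₂, h₂⟩
    · exact absurd rfl hPQ
    refine ⟨1, one_ne_zero, ?_⟩
    change (fun i ↦ eval (Point.sym2x (0 : RatPoint a₄ a₆) _) _) =
        (1 : ℚ) • Point.sym2x ((0 : RatPoint a₄ a₆) + _) (0 - _)
    rw [zero_add, zero_sub, Point.sym2x_neg_right, Point.sym2x_zero_some, Point.sym2x_some_some,
      shortCurve_eval_addSubMap]
    ext i; fin_cases i <;> simp <;> ring
  rcases Q with _ | ⟨x₂, y₂, h₂⟩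
  · refine ⟨1, one_ne_zero, ?_⟩
    change (fun i ↦ eval (Point.sym2x _ (0 : RatPoint a₄ a₆)) _) =
        (1 : ℚ) • Point.sym2x (_ + (0 : RatPoint a₄ a₆)) (_ - 0)
    rw [add_zero, sub_zero, Point.sym2x_some_zero, Point.sym2x_some_some,
      shortCurve_eval_addSubMap]
    ext i; fin_cases i <;> simp <;> ring
  have hx : x₁ ≠ x₂ := fun h ↦ (Point.X_eq_iff.mp h).elim hPQ hPQ'
  have hx' : x₁ - x₂ ≠ 0 := sub_ne_zero.mpr hx
  refine ⟨(x₁ - x₂) ^ 2, by positivity, ?_⟩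
  have e₁ := shortCurve_equation.mp h₁.1
  have e₂ := shortCurve_equation.mp h₂.1
  rw [sub_eq_add_neg (Point.some x₁ y₁ h₁), Point.neg_some, Point.add_of_X_ne hx,
    Point.add_of_X_ne hx,
    Point.sym2x_some_some, Point.sym2x_some_some, shortCurve_eval_addSubMap,
    Affine.slope_of_X_ne hx, Affine.slope_of_X_ne hx]
  simp only [shortCurve, Affine.negY, Affine.addX]
  have ha : (a₄ : ℚ) = (y₁ ^ 2 - y₂ ^ 2) / (x₁ - x₂) - (x₁ ^ 2 + x₁ * x₂ + x₂ ^ 2) := by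
    field_simp; linear_combination e₂ - e₁
  have hb : (a₆ : ℚ) = y₁ ^ 2 - x₁ ^ 3 - ((y₁ ^ 2 - y₂ ^ 2) / (x₁ - x₂) -
      (x₁ ^ 2 + x₁ * x₂ + x₂ ^ 2)) * x₁ := by rw [← ha]; linear_combination -e₁
  rw [hb, ha]
  ext i; fin_cases i <;> simp <;> field_simp <;> ring

/-- The approximate parallelogram law for the Weil height. -/
theorem exists_abs_weilHeight_parallelogram_le (hE : (shortCurve a₄ a₆).IsElliptic) :
    ∃ c, ∀ P Q : RatPoint a₄ a₆,
      |weilHeight (P + Q) + weilHeight (P - Q) - 2 * weilHeight P - 2 * weilHeight Q| ≤ c := by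
  obtain ⟨c₁, h₁⟩ := abs_logHeight_addSubMap_sub_two_mul_logHeight_le (shortCurve a₄ a₆)
  obtain ⟨c₂, h₂⟩ := abs_logHeight_sym2_sub_le ℚ
  have h₃ : ∀ P Q : RatPoint a₄ a₆,
      |logHeight (P.sym2x Q) - (weilHeight P + weilHeight Q)| ≤ c₂ := by
    intro P Q
    rw [weilHeight_eq_logHeight_xRep, weilHeight_eq_logHeight_xRep]
    have e : ∀ P : RatPoint a₄ a₆, P.xRep = ![P.xRep 0, P.xRep 1] := fun P ↦ by
      ext i; fin_cases i <;> rfl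
    have := h₂ (e P ▸ P.xRep_ne_zero) (e Q ▸ Q.xRep_ne_zero)
    rw [← e P, ← e Q] at this
    exact this
  refine ⟨c₁ + c₂ + 2 * c₂, fun P Q ↦ ?_⟩
  obtain ⟨c, hc, h⟩ := exists_smul_sym2x P Q
  have i₁ := h₁ (P.sym2x Q)
  rw [h, logHeight_smul_eq_logHeight _ hc] at i₁
  have i₂ := h₃ P Q
  have i₃ := h₃ (P + Q) (P - Q)
  rw [abs_le] at *
  constructor <;> linarith

theorem weilHeight_nonneg (P : RatPoint a₄ a₆) : 0 ≤ weilHeight P := by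
  rw [weilHeight_eq_logHeight_xRep]; exact logHeight_nonneg _

/-- The canonical height is a quadratic form at bounded distance from half the Weil height. -/
theorem canonHeight_spec (hE : (shortCurve a₄ a₆).IsElliptic) :
    (∀ P Q : RatPoint a₄ a₆, canonHeight (P + Q) + canonHeight (P - Q) =
      2 * canonHeight P + 2 * canonHeight Q) ∧
    ∃ B, ∀ P : RatPoint a₄ a₆, |1 / 2 * weilHeight P - canonHeight P| ≤ B := by
  obtain ⟨c, hc⟩ := exists_abs_weilHeight_parallelogram_le hE
  obtain ⟨q, hq, B, hB⟩ := exists_parallelogram_of_approx hc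
  have key : ∀ P : RatPoint a₄ a₆, canonHeight P = 1 / 2 * q P := by
    intro P
    rw [canonHeight, Tendsto.limUnder_eq]
    have h1 : Tendsto (fun n : ℕ ↦ B * (1 / (n : ℝ)) ^ 2) atTop (𝓝 0) := by
      simpa using ((tendsto_one_div_atTop_nhds_zero_nat (𝕜 := ℝ)).pow 2).const_mul B
    rw [tendsto_iff_norm_sub_tendsto_zero]
    refine squeeze_zero' (.of_forall fun _ ↦ norm_nonneg _) ?_ h1
    filter_upwards [eventually_gt_atTop 0] with n hn
    have hn' : (0 : ℝ) < n := by exact_mod_cast hn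
    have := hB (n • P)
    rw [map_nsmul_of_parallelogram hq] at this
    have e : weilHeight (n • P) / (n : ℝ) ^ 2 - q P =
        (weilHeight (n • P) - (n : ℝ) ^ 2 * q P) * (1 / n) ^ 2 := by field_simp
    rw [e, Real.norm_eq_abs, abs_mul, abs_of_pos (show (0 : ℝ) < (1 / n) ^ 2 by positivity)]
    gcongr
  refine ⟨fun P Q ↦ ?_, 1 / 2 * B, fun P ↦ ?_⟩
  · simp only [key]; linarith [hq P Q]
  · rw [key, ← mul_sub, abs_mul]
    simpa using hB P

theorem canonHeight_nsmul (hE : (shortCurve a₄ a₆).IsElliptic) (n : ℕ) (P : RatPoint a₄ a₆) :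
    canonHeight (n • P) = (n : ℝ) ^ 2 * canonHeight P :=
  map_nsmul_of_parallelogram (canonHeight_spec hE).1 n P

theorem canonHeight_zero (hE : (shortCurve a₄ a₆).IsElliptic) :
    canonHeight (0 : RatPoint a₄ a₆) = 0 := by
  simpa using canonHeight_nsmul hE 0 (0 : RatPoint a₄ a₆)

theorem canonHeight_neg (hE : (shortCurve a₄ a₆).IsElliptic) (P : RatPoint a₄ a₆) :
    canonHeight (-P) = canonHeight P := by
  have := (canonHeight_spec hE).1 0 P
  rw [zero_add, zero_sub, canonHeight_zero hE] at this
  linarith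

theorem canonHeight_zsmul (hE : (shortCurve a₄ a₆).IsElliptic) (n : ℤ) (P : RatPoint a₄ a₆) :
    canonHeight (n • P) = (n : ℝ) ^ 2 * canonHeight P := by
  obtain ⟨m, rfl | rfl⟩ := n.eq_nat_or_neg
  · simpa using canonHeight_nsmul hE m P
  · rw [neg_smul, canonHeight_neg hE]; simpa using canonHeight_nsmul hE m P

theorem canonHeight_nonneg (hE : (shortCurve a₄ a₆).IsElliptic) (P : RatPoint a₄ a₆) :
    0 ≤ canonHeight P := by
  obtain ⟨B, hB⟩ := (canonHeight_spec hE).2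
  by_contra! h
  obtain ⟨n, hn⟩ := exists_nat_gt (B / -canonHeight P)
  have h1 := abs_le.mp (hB (n • P))
  rw [canonHeight_nsmul hE] at h1
  have h2 := weilHeight_nonneg (n • P)
  have hn0 : (n : ℝ) ≤ (n : ℝ) ^ 2 := by exact_mod_cast Nat.le_self_pow two_ne_zero n
  rw [div_lt_iff₀ (by linarith)] at hn
  nlinarith [h1.2]

theorem canonHeight_add_torsion (hE : (shortCurve a₄ a₆).IsElliptic)
    (P τ : RatPoint a₄ a₆) (hτ : IsOfFinAddOrder τ) :
    canonHeight (P + τ) = canonHeight P := by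
  obtain ⟨n, hn, h⟩ := isOfFinAddOrder_iff_nsmul_eq_zero.mp hτ
  have h1 := canonHeight_nsmul hE n (P + τ)
  rw [nsmul_add, h, add_zero, canonHeight_nsmul hE] at h1
  exact (mul_left_cancel₀ (by positivity) h1).symm

theorem half_weilHeight_le (hE : (shortCurve a₄ a₆).IsElliptic) (P : RatPoint a₄ a₆) :
    1 / 2 * weilHeight P ≤ canonHeight P + heightDelta a₄ a₆ := by
  obtain ⟨B, hB⟩ := (canonHeight_spec hE).2
  have : 1 / 2 * weilHeight P - canonHeight P ≤ heightDelta a₄ a₆ :=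
    le_ciSup (f := fun P : RatPoint a₄ a₆ ↦ 1 / 2 * weilHeight P - canonHeight P)
      ⟨B, by rintro _ ⟨P, rfl⟩; exact (abs_le.mp (hB P)).2⟩ P
  linarith

theorem heightDelta_nonneg (hE : (shortCurve a₄ a₆).IsElliptic) : 0 ≤ heightDelta a₄ a₆ := by
  have := half_weilHeight_le hE (0 : RatPoint a₄ a₆)
  rw [canonHeight_zero hE] at this
  have := weilHeight_nonneg (0 : RatPoint a₄ a₆)
  linarith

end Height

/-! ### Binary quadratic forms and a lower bound for class numbers -/

namespace BinForm

open MulAction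

theorem smul_a (γ : SL(2, ℤ)) (f : BinForm) :
    (γ • f).a = f.a * γ 0 0 ^ 2 + f.b * γ 0 0 * γ 0 1 + f.c * γ 0 1 ^ 2 := rfl

theorem smul_b (γ : SL(2, ℤ)) (f : BinForm) :
    (γ • f).b = 2 * f.a * γ 0 0 * γ 1 0 + f.b * (γ 0 0 * γ 1 1 + γ 1 0 * γ 0 1)
        + 2 * f.c * γ 0 1 * γ 1 1 := rfl

theorem smul_c (γ : SL(2, ℤ)) (f : BinForm) :
    (γ • f).c = f.a * γ 1 0 ^ 2 + f.b * γ 1 0 * γ 1 1 + f.c * γ 1 1 ^ 2 := rfl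

theorem det_eq_one (γ : SL(2, ℤ)) : γ 0 0 * γ 1 1 - γ 0 1 * γ 1 0 = 1 := by
  have := γ.det_coe
  rwa [Matrix.det_fin_two] at this

theorem disc_smul (γ : SL(2, ℤ)) (f : BinForm) : (γ • f).disc = f.disc := by
  have h := det_eq_one γ
  simp only [disc, smul_a, smul_b, smul_c]
  linear_combination (f.b ^ 2 - 4 * f.a * f.c) * (γ 0 0 * γ 1 1 - γ 0 1 * γ 1 0 + 1) * h

theorem PosDef.a_pos {f : BinForm} (h : f.PosDef) : 0 < f.a := by
  simpa [eval] using h 1 0 (by simp)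

theorem PosDef.disc_neg {f : BinForm} (h : f.PosDef) : f.disc < 0 := by
  have ha := h.a_pos
  have h1 := h (-f.b) (2 * f.a) (.inr (by positivity))
  have e : f.eval (-f.b) (2 * f.a) = f.a * (-f.disc) := by simp only [eval, disc]; ring
  rw [e] at h1
  linarith [pos_of_mul_pos_right h1 ha.le]

theorem posDef_of_disc_neg {f : BinForm} (ha : 0 < f.a) (hd : f.disc < 0) : f.PosDef := by
  intro x y hxy
  have e : 4 * f.a * f.eval x y = (2 * f.a * x + f.b * y) ^ 2 + (-f.disc) * y ^ 2 := by
    simp only [eval, disc]; ring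
  have : 0 < 4 * f.a * f.eval x y := by
    rw [e]
    rcases eq_or_ne y 0 with rfl | hy
    · have hx : x ≠ 0 := by simpa using hxy
      have : 0 < (2 * f.a * x) ^ 2 := by positivity
      nlinarith
    · have : 0 < y ^ 2 := by positivity
      nlinarith [sq_nonneg (2 * f.a * x + f.b * y)]
  exact pos_of_mul_pos_right this (by positivity)

theorem PosDef.smul {f : BinForm} (h : f.PosDef) (γ : SL(2, ℤ)) : (γ • f).PosDef := by
  refine posDef_of_disc_neg ?_ (by rw [disc_smul]; exact h.disc_neg)
  have e : (γ • f).a = f.eval (γ 0 0) (γ 0 1) := rfl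
  rw [e]
  apply h
  by_contra! h0
  have := det_eq_one γ
  rw [h0.1, h0.2] at this
  simp at this

/-- Lower triangular unipotent matrices act by translating the middle coefficient. -/
theorem exists_smul_eq_translate (f : BinForm) (k : ℤ) :
    ∃ γ : SL(2, ℤ), (γ • f).a = f.a ∧ (γ • f).b = f.b + 2 * f.a * k := by
  let γ : SL(2, ℤ) := ⟨!![1, 0; k, 1], by simp [Matrix.det_fin_two]⟩
  have h : γ 0 0 = 1 ∧ γ 0 1 = 0 ∧ γ 1 0 = k ∧ γ 1 1 = 1 := ⟨rfl, rfl, rfl, rfl⟩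
  obtain ⟨h1, h2, h3, h4⟩ := h
  refine ⟨γ, ?_, ?_⟩
  · rw [smul_a, h1, h2]; ring
  · rw [smul_b, h1, h2, h3, h4]; ring

theorem exists_smul_a_eq_c (f : BinForm) : ∃ γ : SL(2, ℤ), (γ • f).a = f.c := by
  let γ : SL(2, ℤ) := ⟨!![0, 1; -1, 0], by simp [Matrix.det_fin_two]⟩
  have h1 : γ 0 0 = 0 := rfl
  have h2 : γ 0 1 = 1 := rfl
  exact ⟨γ, by rw [smul_a, h1, h2]; ring⟩

/-- Every positive definite form is equivalent to one with `|b| ≤ a ≤ c`. -/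
theorem PosDef.exists_reduced {f : BinForm} (h : f.PosDef) :
    ∃ γ : SL(2, ℤ), |(γ • f).b| ≤ (γ • f).a ∧ (γ • f).a ≤ (γ • f).c := by
  obtain ⟨γ₀, hγ₀⟩ : ∃ γ₀ : SL(2, ℤ), ∀ γ : SL(2, ℤ), (γ₀ • f).a ≤ (γ • f).a := by
    obtain ⟨γ₀, h0⟩ : ∃ γ₀ : SL(2, ℤ), ∀ γ : SL(2, ℤ), (γ₀ • f).a.toNat ≤ (γ • f).a.toNat :=
      ⟨_, fun γ ↦ Function.argmin_le (fun γ : SL(2, ℤ) ↦ (γ • f).a.toNat) γ⟩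
    refine ⟨γ₀, fun γ ↦ ?_⟩
    have := h0 γ
    have := (h.smul γ₀).a_pos
    have := (h.smul γ).a_pos
    omega
  set g := γ₀ • f with hg
  have hga : 0 < g.a := (h.smul γ₀).a_pos
  obtain ⟨γ₁, h1, h2⟩ := exists_smul_eq_translate g (-((g.b + g.a) / (2 * g.a)))
  refine ⟨γ₁ * γ₀, ?_, ?_⟩
  · rw [mul_smul, ← hg, h1, h2, abs_le]
    have := Int.emod_add_mul_ediv (g.b + g.a) (2 * g.a)
    have := Int.emod_nonneg (g.b + g.a) (show 2 * g.a ≠ 0 by omega)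
    have := Int.emod_lt_of_pos (g.b + g.a) (show 0 < 2 * g.a by omega)
    constructor <;> linarith
  · obtain ⟨γ₂, h3⟩ := exists_smul_a_eq_c ((γ₁ * γ₀) • f)
    have e : ((γ₁ * γ₀) • f).a = g.a := by rw [mul_smul, ← hg, h1]
    rw [e, ← h3, ← mul_smul]
    exact hγ₀ _

/-- A form whose only automorphs are `± 1`, i.e. one that is counted with weight one in the
Hurwitz class number. -/
def Rigid (f : BinForm) : Prop := ∀ γ : SL(2, ℤ), γ • f = f → γ = 1 ∨ γ = -1

theorem neg_smul_form (γ : SL(2, ℤ)) (f : BinForm) : (-γ) • f = γ • f := by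
  ext <;> simp [smul_a, smul_b, smul_c]

theorem Rigid.smul {f : BinForm} (h : f.Rigid) (γ : SL(2, ℤ)) : (γ • f).Rigid := by
  intro δ hδ
  have h1 : (γ⁻¹ * δ * γ) • f = f := by
    rw [mul_smul, mul_smul, hδ, inv_smul_smul]
  rcases h _ h1 with h2 | h2
  · left
    have : δ = γ * (γ⁻¹ * δ * γ) * γ⁻¹ := by group
    rw [this, h2]; simp
  · right
    have : δ = γ * (γ⁻¹ * δ * γ) * γ⁻¹ := by group
    rw [this, h2]; simp

theorem Rigid.card_stabilizer {f : BinForm} (h : f.Rigid) :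
    Nat.card (stabilizer SL(2, ℤ) f) = 2 := by
  have hne : (1 : SL(2, ℤ)) ≠ -1 := by
    intro h
    have := congrArg (fun γ : SL(2, ℤ) ↦ γ 0 0) h
    simp at this
  have : (stabilizer SL(2, ℤ) f : Set SL(2, ℤ)) = {1, -1} := by
    ext γ
    simp only [SetLike.mem_coe, mem_stabilizer_iff, Set.mem_insert_iff, Set.mem_singleton_iff]
    refine ⟨h γ, ?_⟩
    rintro (rfl | rfl)
    · simp
    · rw [neg_smul_form, one_smul]
  change Nat.card (stabilizer SL(2, ℤ) f : Set SL(2, ℤ)) = 2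
  rw [this, Nat.card_coe_set_eq, Set.ncard_pair hne]

/-- A finite set of pairwise inequivalent positive definite forms of discriminant `Δ` without
nontrivial automorphs. -/
structure IsSystem (Δ : ℤ) (s : Finset BinForm) : Prop where
  a_pos : ∀ f ∈ s, 0 < f.a
  disc_eq : ∀ f ∈ s, f.disc = Δ
  rigid : ∀ f ∈ s, f.Rigid
  eq_of_smul : ∀ f ∈ s, ∀ g ∈ s, ∀ γ : SL(2, ℤ), γ • f = g → f = g

theorem finite_quotient (Δ : ℤ) : Finite (Quotient (PosDefForm.setoid Δ)) := by
  let T : Set (ℤ × ℤ) := Set.Icc 0 (-Δ) ×ˢ Set.Icc (-(-Δ)) (-Δ)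
  have hT : T.Finite := (Set.finite_Icc _ _).prod (Set.finite_Icc _ _)
  have := hT.to_subtype
  have hred : ∀ C : Quotient (PosDefForm.setoid Δ), ∃ f : PosDefForm Δ, Quotient.mk _ f = C ∧
      (f.1.a, f.1.b) ∈ T := by
    intro C
    induction C using Quotient.inductionOn with
    | _ f =>
      obtain ⟨γ, h1, h2⟩ := f.2.1.exists_reduced
      have hp := f.2.1.smul γ
      have hd : (γ • f.1).disc = Δ := by rw [disc_smul]; exact f.2.2
      refine ⟨⟨γ • f.1, hp, hd⟩, Quotient.sound ?_, ?_⟩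
      · change MulAction.orbitRel SL(2, ℤ) BinForm (γ • f.1) f.1
        exact ⟨γ, rfl⟩
      · have ha := hp.a_pos
        have hb := abs_le.mp h1
        simp only [disc] at hd
        have : (γ • f.1).a ≤ -Δ := by nlinarith
        refine ⟨⟨ha.le, this⟩, ?_, ?_⟩ <;> simp only <;> linarith
  choose r hr hrT using hred
  refine Finite.of_injective (fun C ↦ (⟨_, hrT C⟩ : T)) fun C C' h ↦ ?_
  rw [← hr C, ← hr C']
  congr 1
  simp only [Subtype.mk.injEq, Prod.mk.injEq] at h
  have h1 := (r C).2.2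
  have h2 := (r C').2.2
  have h3 := (r C).2.1.a_pos
  refine Subtype.ext (BinForm.ext h.1 h.2 ?_)
  simp only [disc] at h1 h2
  rw [← h.1, ← h.2] at h2
  have : 4 * (r C).1.a * ((r C).1.c - (r C').1.c) = 0 := by linarith
  rcases mul_eq_zero.mp this with h0 | h0 <;> linarith

theorem hurwitzH_nonneg (Δ : ℤ) : 0 ≤ hurwitzH Δ :=
  finsum_nonneg fun _ ↦ by positivity

/-- A system of inequivalent forms of discriminant `Δ` without nontrivial automorphs has at most
`H(Δ)` elements. -/
theorem IsSystem.card_le_hurwitzH {Δ : ℤ} {s : Finset BinForm} (hs : IsSystem Δ s)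
    (hΔ : Δ < 0) : (s.card : ℝ) ≤ hurwitzH Δ := by
  classical
  have := finite_quotient Δ
  have := Fintype.ofFinite (Quotient (PosDefForm.setoid Δ))
  let F : s → PosDefForm Δ := fun f ↦
    ⟨f.1, posDef_of_disc_neg (hs.a_pos _ f.2) (by rw [hs.disc_eq _ f.2]; exact hΔ),
      hs.disc_eq _ f.2⟩
  let cl : s → Quotient (PosDefForm.setoid Δ) := fun f ↦ Quotient.mk _ (F f)
  have hrel : ∀ f : s, ∃ γ : SL(2, ℤ), γ • f.1 = (Quotient.out (cl f)).val := fun f ↦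
    Quotient.mk_out (s := PosDefForm.setoid Δ) (F f)
  have hinj : Function.Injective cl := by
    intro f g h
    obtain ⟨γ, hγ⟩ := hrel f
    obtain ⟨δ, hδ⟩ := hrel g
    rw [h, ← hδ] at hγ
    refine Subtype.ext (hs.eq_of_smul _ f.2 _ g.2 (δ⁻¹ * γ) ?_)
    rw [mul_smul, hγ, inv_smul_smul]
  rw [hurwitzH, finsum_eq_sum_of_fintype]
  calc (s.card : ℝ) = ∑ C ∈ Finset.univ.image cl, (1 : ℝ) := by
        rw [Finset.sum_const, nsmul_eq_mul, mul_one, Finset.card_image_of_injective _ hinj]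
        simp
    _ = ∑ C ∈ Finset.univ.image cl,
          2 / (Nat.card (MulAction.stabilizer SL(2, ℤ) (Quotient.out C).val) : ℝ) := by
        refine Finset.sum_congr rfl fun C hC ↦ ?_
        obtain ⟨f, -, rfl⟩ := Finset.mem_image.mp hC
        obtain ⟨γ, hγ⟩ := hrel f
        rw [← hγ, ((hs.rigid _ f.2).smul γ).card_stabilizer]
        norm_num
    _ ≤ _ := Finset.sum_le_sum_of_subset_of_nonneg (Finset.subset_univ _)
        fun _ _ _ ↦ by positivity

/-! ### Forms with a small first coefficient -/

theorem one_le_sq_of_ne_zero {q : ℤ} (h : q ≠ 0) : 1 ≤ q ^ 2 := by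
  have : 0 < q ^ 2 := by positivity
  linarith

/-- Completing the square in the first coefficient of `γ • f`. -/
theorem four_mul_a_mul_smul_a (γ : SL(2, ℤ)) (f : BinForm) :
    4 * f.a * (γ • f).a = (2 * f.a * γ 0 0 + f.b * γ 0 1) ^ 2 - f.disc * γ 0 1 ^ 2 := by
  simp only [smul_a, disc]; ring

theorem eq_of_upper_right_eq_zero {γ : SL(2, ℤ)} {f : BinForm} (h : γ 0 1 = 0) :
    (γ 0 0 = 1 ∧ γ 1 1 = 1 ∨ γ 0 0 = -1 ∧ γ 1 1 = -1) ∧ (γ • f).a = f.a ∧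
      (γ • f).b = f.b + 2 * f.a * (γ 0 0 * γ 1 0) := by
  have hd := det_eq_one γ
  rw [h] at hd
  have h1 : γ 0 0 * γ 1 1 = 1 := by linarith
  have h2 := Int.mul_eq_one_iff_eq_one_or_neg_one.mp h1
  refine ⟨h2, ?_, ?_⟩
  · rw [smul_a, h]; rcases h2 with ⟨h3, h4⟩ | ⟨h3, h4⟩ <;> rw [h3] <;> ring
  · rw [smul_b, h]; rcases h2 with ⟨h3, h4⟩ | ⟨h3, h4⟩ <;> rw [h3, h4] <;> ring

theorem rigid_of_upper_right_eq_zero {f : BinForm} (ha : 0 < f.a)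
    (h : ∀ γ : SL(2, ℤ), γ • f = f → γ 0 1 = 0) : f.Rigid := by
  intro γ hγ
  obtain ⟨h1, -, h3⟩ := eq_of_upper_right_eq_zero (f := f) (h γ hγ)
  have h4 : γ 1 0 = 0 := by
    rw [hγ] at h3
    have : f.a * (γ 0 0 * γ 1 0) = 0 := by linarith
    rcases h1 with ⟨h5, -⟩ | ⟨h5, -⟩ <;> rw [h5] at this <;> simpa [ha.ne'] using this
  rcases h1 with ⟨h5, h6⟩ | ⟨h5, h6⟩
  · left; ext i j; fin_cases i <;> fin_cases j <;> simp [h5, h6, h4, h γ hγ]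
  · right; ext i j; fin_cases i <;> fin_cases j <;> simp [h5, h6, h4, h γ hγ]

/-- A positive form of discriminant `-4n` whose first coefficient is less than `√n`. Such a form is
determined up to equivalence by `a` and by `b` modulo `2a`. -/
structure Small (n : ℤ) (f : BinForm) : Prop where
  a_pos : 0 < f.a
  disc_eq : f.disc = -(4 * n)
  sq_lt : f.a ^ 2 < n

theorem Small.upper_right_eq_zero {n : ℤ} {f g : BinForm} (hf : Small n f) (hg : Small n g)
    {γ : SL(2, ℤ)} (h : γ • f = g) : γ 0 1 = 0 := by
  by_contra h0
  have h1 := four_mul_a_mul_smul_a γ f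
  rw [h, hf.disc_eq] at h1
  have h2 : 1 ≤ γ 0 1 ^ 2 := one_le_sq_of_ne_zero h0
  have := hf.sq_lt
  have := hg.sq_lt
  nlinarith [sq_nonneg (f.a - g.a), sq_nonneg (2 * f.a * γ 0 0 + f.b * γ 0 1), sq_nonneg f.a]

theorem Small.rigid {n : ℤ} {f : BinForm} (hf : Small n f) : f.Rigid :=
  rigid_of_upper_right_eq_zero hf.a_pos fun _ hγ ↦ hf.upper_right_eq_zero hf hγ

theorem Small.eq_of_smul {n : ℤ} {f g : BinForm} (hf : Small n f) (hg : Small n g)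
    {γ : SL(2, ℤ)} (h : γ • f = g) : f.a = g.a ∧ 2 * f.a ∣ g.b - f.b := by
  obtain ⟨-, h2, h3⟩ := eq_of_upper_right_eq_zero (f := f) (hf.upper_right_eq_zero hg h)
  rw [h] at h2 h3
  exact ⟨h2.symm, γ 0 0 * γ 1 0, by linarith⟩

/-- The ambiguous form `d X² + (n/d) Y²`. -/
def diagForm (n d : ℤ) : BinForm := ⟨d, 0, n / d⟩

theorem small_diagForm {n d : ℤ} (hd : 0 < d) (hdn : d ∣ n) (h : d ^ 2 < n) :
    Small n (diagForm n d) := by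
  refine ⟨hd, ?_, h⟩
  obtain ⟨e, rfl⟩ := hdn
  simp only [disc, diagForm, Int.mul_ediv_cancel_left _ hd.ne']
  ring

/-- The ambiguous form `2u X² + 2u XY + ((u + n/u)/2) Y²`. -/
def skewForm (n u : ℤ) : BinForm := ⟨2 * u, 2 * u, (u + n / u) / 2⟩

/-- The conditions under which `skewForm n u` is a form of discriminant `-4n` without nontrivial
automorphs. -/
structure SkewAdmissible (n u : ℤ) : Prop where
  pos : 0 < u
  dvd : u ∣ n
  even : 2 ∣ u + n / u
  sq_lt : u ^ 2 < n
  ne : n ≠ 3 * u ^ 2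

theorem SkewAdmissible.disc_eq {n u : ℤ} (h : SkewAdmissible n u) :
    (skewForm n u).disc = -(4 * n) := by
  obtain ⟨k, hk⟩ := h.even
  obtain ⟨e, he⟩ := h.dvd
  have h1 : n / u = e := by rw [he, Int.mul_ediv_cancel_left _ h.pos.ne']
  simp only [disc, skewForm, hk, Int.mul_ediv_cancel_left _ (two_ne_zero)]
  rw [h1] at hk
  rw [he]
  linear_combination (4 * u) * hk

theorem SkewAdmissible.smul_a {n u : ℤ} (h : SkewAdmissible n u) (γ : SL(2, ℤ)) :
    2 * u * (γ • skewForm n u).a = u ^ 2 * (2 * γ 0 0 + γ 0 1) ^ 2 + n * γ 0 1 ^ 2 := by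
  have := four_mul_a_mul_smul_a γ (skewForm n u)
  rw [h.disc_eq] at this
  simp only [skewForm] at this ⊢
  linarith

theorem SkewAdmissible.rigid {n u : ℤ} (h : SkewAdmissible n u) : (skewForm n u).Rigid := by
  refine rigid_of_upper_right_eq_zero (by simp only [skewForm]; linarith [h.pos]) fun γ hγ ↦ ?_
  by_contra h0
  have h1 := h.smul_a γ
  rw [hγ] at h1
  simp only [skewForm] at h1
  have hu := h.pos
  have hlt := h.sq_lt
  have h2 : γ 0 1 ^ 2 < 4 := by
    by_contra! h3
    nlinarith [mul_nonneg (sq_nonneg u) (sq_nonneg (2 * γ 0 0 + γ 0 1))]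
  have h3 : γ 0 1 = 1 ∨ γ 0 1 = -1 := by
    have : γ 0 1 < 2 := by nlinarith
    have : -2 < γ 0 1 := by nlinarith
    omega
  have h4 : γ 0 1 ^ 2 = 1 := by rcases h3 with h3 | h3 <;> rw [h3] <;> norm_num
  rw [h4] at h1
  have h5 : (2 * γ 0 0 + γ 0 1) ^ 2 < 4 := by
    by_contra! h6
    nlinarith [sq_nonneg u]
  have h6 : (2 * γ 0 0 + γ 0 1) ^ 2 = 1 := by
    have : 2 * γ 0 0 + γ 0 1 < 2 := by nlinarith
    have : -2 < 2 * γ 0 0 + γ 0 1 := by nlinarith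
    have : 2 * γ 0 0 + γ 0 1 = 1 ∨ 2 * γ 0 0 + γ 0 1 = -1 := by omega
    rcases this with h | h <;> rw [h] <;> norm_num
  rw [h6] at h1
  exact h.ne (by linarith)

theorem SkewAdmissible.eq_of_smul_small {n u : ℤ} (h : SkewAdmissible n u) {g : BinForm}
    (hg : Small n g) {γ : SL(2, ℤ)} (hγ : γ • skewForm n u = g) :
    g.a = 2 * u ∧ 4 * u ∣ g.b - 2 * u := by
  have h0 : γ 0 1 = 0 := by
    by_contra h0
    have h1 := h.smul_a γ
    rw [hγ] at h1
    have := hg.sq_lt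
    have h2 := one_le_sq_of_ne_zero h0
    have h3 := h.sq_lt
    by_cases hk : 2 * γ 0 0 + γ 0 1 = 0
    · have : 4 ≤ γ 0 1 ^ 2 := by
        have : γ 0 1 = -2 * γ 0 0 := by linarith
        have h5 : γ 0 0 ≠ 0 := by intro h; rw [h] at this; simp at this; exact h0 this
        rw [this]; nlinarith [one_le_sq_of_ne_zero h5]
      nlinarith [sq_nonneg (u - g.a), mul_nonneg (sq_nonneg u) (sq_nonneg (2 * γ 0 0 + γ 0 1)),
        sq_nonneg u]
    · have := one_le_sq_of_ne_zero hk
      nlinarith [sq_nonneg (u - g.a), sq_nonneg u]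
  obtain ⟨-, h2, h3⟩ := eq_of_upper_right_eq_zero (f := skewForm n u) h0
  rw [hγ] at h2 h3
  refine ⟨h2, γ 0 0 * γ 1 0, ?_⟩
  rw [h3]; simp only [skewForm]; ring

theorem SkewAdmissible.eq_of_smul {n u v : ℤ} (h : SkewAdmissible n u) (h' : SkewAdmissible n v)
    {γ : SL(2, ℤ)} (hγ : γ • skewForm n u = skewForm n v) : u = v := by
  have h1 := h.smul_a γ
  have h2 := h'.smul_a γ⁻¹
  rw [hγ] at h1
  rw [← hγ, inv_smul_smul] at h2
  have e : γ⁻¹ 0 1 = - γ 0 1 := by simp [Matrix.SpecialLinearGroup.SL2_inv_expl]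
  have e' : γ⁻¹ 0 0 = γ 1 1 := by simp [Matrix.SpecialLinearGroup.SL2_inv_expl]
  rw [e, e'] at h2
  simp only [skewForm] at h1 h2
  have hu := h.pos
  have hv := h'.pos
  have hu2 := h.sq_lt
  have hv2 := h'.sq_lt
  by_cases h0 : γ 0 1 = 0
  · obtain ⟨-, h4, -⟩ := eq_of_upper_right_eq_zero (f := skewForm n u) h0
    rw [hγ] at h4
    simp only [skewForm] at h4
    linarith
  have hq : γ 0 1 ^ 2 < 4 := by
    by_contra! h3
    nlinarith [mul_nonneg (sq_nonneg u) (sq_nonneg (2 * γ 0 0 + γ 0 1)), sq_nonneg (u - v)]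
  have hq' : γ 0 1 = 1 ∨ γ 0 1 = -1 := by
    have : γ 0 1 < 2 := by nlinarith
    have : -2 < γ 0 1 := by nlinarith
    omega
  have h4 : γ 0 1 ^ 2 = 1 := by rcases hq' with h3 | h3 <;> rw [h3] <;> norm_num
  rw [neg_sq, h4] at h2
  rw [h4] at h1
  have key : ∀ k u v : ℤ, 0 < u → 0 < v → v ^ 2 < n → Odd k →
      2 * u * (2 * v) = u ^ 2 * k ^ 2 + n * 1 → k ^ 2 = 1 := by
    intro k u v hu hv hlt hk he
    by_contra hne
    have h5 : 9 ≤ k ^ 2 := by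
      have h7 : k ≤ -3 ∨ 3 ≤ k := by
        obtain ⟨m, rfl⟩ := hk
        have : m ≠ 0 := by rintro rfl; exact hne (by norm_num)
        have : m ≠ -1 := by rintro rfl; exact hne (by norm_num)
        omega
      rcases h7 with h | h <;> nlinarith
    nlinarith [sq_nonneg (3 * u - v), sq_nonneg u, mul_pos hu hv]
  have k1 := key _ u v hu hv hv2 (by rw [Int.odd_iff]; omega) h1
  have k2 := key (2 * γ 1 1 + -γ 0 1) v u hv hu hu2 (by rw [Int.odd_iff]; omega) (by rw [← h2])
  rw [k1] at h1
  rw [k2] at h2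
  have : (u - v) * (u + v) = 0 := by linarith
  rcases mul_eq_zero.mp this with h | h <;> linarith

end BinForm

/-! ### Lifting forms to discriminants with an additional square factor -/

namespace BinForm

open MulAction

/-- `m` divides the content of `f`. -/
def ContentDvd (m : ℤ) (f : BinForm) : Prop := m ∣ f.a ∧ m ∣ f.b ∧ m ∣ f.c

theorem ContentDvd.smul {m : ℤ} {f : BinForm} (h : ContentDvd m f) (γ : SL(2, ℤ)) :
    ContentDvd m (γ • f) := by
  obtain ⟨⟨a, ha⟩, ⟨b, hb⟩, ⟨c, hc⟩⟩ := h
  refine ⟨?_, ?_, ?_⟩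
  · rw [smul_a, ha, hb, hc]
    exact ⟨a * γ 0 0 ^ 2 + b * γ 0 0 * γ 0 1 + c * γ 0 1 ^ 2, by ring⟩
  · rw [smul_b, ha, hb, hc]
    exact ⟨2 * a * γ 0 0 * γ 1 0 + b * (γ 0 0 * γ 1 1 + γ 1 0 * γ 0 1) + 2 * c * γ 0 1 * γ 1 1,
      by ring⟩
  · rw [smul_c, ha, hb, hc]
    exact ⟨a * γ 1 0 ^ 2 + b * γ 1 0 * γ 1 1 + c * γ 1 1 ^ 2, by ring⟩

theorem contentDvd_smul_iff {m : ℤ} {f : BinForm} (γ : SL(2, ℤ)) :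
    ContentDvd m (γ • f) ↔ ContentDvd m f :=
  ⟨fun h ↦ by simpa using h.smul γ⁻¹, fun h ↦ h.smul γ⟩

/-- The form `m f`. -/
def scale (m : ℤ) (f : BinForm) : BinForm := ⟨m * f.a, m * f.b, m * f.c⟩

theorem smul_scale (m : ℤ) (f : BinForm) (γ : SL(2, ℤ)) : γ • scale m f = scale m (γ • f) := by
  ext <;> simp only [scale, smul_a, smul_b, smul_c] <;> ring

theorem scale_injective {m : ℤ} (hm : m ≠ 0) : Function.Injective (scale m) := by
  intro f g h
  simp only [scale, BinForm.mk.injEq, mul_right_inj' hm] at h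
  exact BinForm.ext h.1 h.2.1 h.2.2

theorem disc_scale (m : ℤ) (f : BinForm) : (scale m f).disc = m ^ 2 * f.disc := by
  simp only [disc, scale]; ring

theorem contentDvd_scale (m : ℤ) (f : BinForm) : ContentDvd m (scale m f) :=
  ⟨dvd_mul_right _ _, dvd_mul_right _ _, dvd_mul_right _ _⟩

theorem ContentDvd.exists_scale {m : ℤ} {f : BinForm} (h : ContentDvd m f) :
    ∃ g, f = scale m g := by
  obtain ⟨⟨a, ha⟩, ⟨b, hb⟩, ⟨c, hc⟩⟩ := h
  exact ⟨⟨a, b, c⟩, BinForm.ext ha hb hc⟩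

theorem rigid_scale_iff {m : ℤ} (hm : m ≠ 0) {f : BinForm} : (scale m f).Rigid ↔ f.Rigid := by
  have : ∀ γ : SL(2, ℤ), γ • scale m f = scale m f ↔ γ • f = f := fun γ ↦ by
    rw [smul_scale]; exact (scale_injective hm).eq_iff
  simp only [Rigid, this]

open Classical in
theorem IsSystem.scale {Δ m : ℤ} (hm : 0 < m) {s : Finset BinForm} (hs : IsSystem Δ s) :
    IsSystem (m ^ 2 * Δ) (s.image (BinForm.scale m)) := by
  refine ⟨?_, ?_, ?_, ?_⟩
  · intro f hf
    obtain ⟨f', hf', rfl⟩ := Finset.mem_image.mp hf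
    exact mul_pos hm (hs.a_pos f' hf')
  · intro f hf
    obtain ⟨f', hf', rfl⟩ := Finset.mem_image.mp hf
    rw [disc_scale, hs.disc_eq f' hf']
  · intro f hf
    obtain ⟨f', hf', rfl⟩ := Finset.mem_image.mp hf
    exact (rigid_scale_iff hm.ne').mpr (hs.rigid f' hf')
  · intro f hf g hg γ h
    obtain ⟨f', hf', rfl⟩ := Finset.mem_image.mp hf
    obtain ⟨g', hg', rfl⟩ := Finset.mem_image.mp hg
    rw [smul_scale] at h
    rw [hs.eq_of_smul f' hf' g' hg' γ (scale_injective hm.ne' h)]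

open Classical in
/-- A system of forms whose contents are divisible by `m` is `m` times a system. -/
theorem IsSystem.exists_eq_image_scale {Δ m : ℤ} (hm : 0 < m) {s : Finset BinForm}
    (hs : IsSystem (m ^ 2 * Δ) s) (hc : ∀ f ∈ s, ContentDvd m f) :
    ∃ s', IsSystem Δ s' ∧ s = s'.image (BinForm.scale m) := by
  have hsurj : ∀ f ∈ s, ∃ g, BinForm.scale m g = f := fun f hf ↦
    let ⟨g, hg⟩ := (hc f hf).exists_scale; ⟨g, hg.symm⟩
  obtain ⟨s', rfl⟩ : ∃ s' : Finset BinForm, s = s'.image (BinForm.scale m) := by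
    refine ⟨s.preimage (BinForm.scale m) (scale_injective hm.ne').injOn, ?_⟩
    ext f
    simp only [Finset.mem_image, Finset.mem_preimage]
    constructor
    · intro hf
      obtain ⟨g, rfl⟩ := hsurj f hf
      exact ⟨g, hf, rfl⟩
    · rintro ⟨g, hg, rfl⟩; exact hg
  have hmem : ∀ f ∈ s', BinForm.scale m f ∈ s'.image (BinForm.scale m) := fun f hf ↦
    Finset.mem_image_of_mem _ hf
  refine ⟨s', ⟨fun f hf ↦ ?_, fun f hf ↦ ?_, fun f hf ↦ ?_, fun f hf g hg γ h ↦ ?_⟩, rfl⟩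
  · have := hs.a_pos _ (hmem f hf)
    exact pos_of_mul_pos_right this hm.le
  · have := hs.disc_eq _ (hmem f hf)
    rw [disc_scale] at this
    exact mul_left_cancel₀ (by positivity) this
  · exact (rigid_scale_iff hm.ne').mp (hs.rigid _ (hmem f hf))
  · exact scale_injective hm.ne' (hs.eq_of_smul _ (hmem f hf) _ (hmem g hg) γ
      (by rw [smul_scale, h]))

open Classical in
/-- Forms are separated by the divisibility of their contents by `m`. -/
theorem IsSystem.union {Δ m : ℤ} {s s' : Finset BinForm} (hs : IsSystem Δ s)
    (hs' : IsSystem Δ s') (hc : ∀ f ∈ s, ¬ ContentDvd m f) (hc' : ∀ f ∈ s', ContentDvd m f) :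
    IsSystem Δ (s ∪ s') ∧ (s ∪ s').card = s.card + s'.card := by
  refine ⟨⟨?_, ?_, ?_, ?_⟩, ?_⟩
  · intro f hf
    exact (Finset.mem_union.mp hf).elim (hs.a_pos f) (hs'.a_pos f)
  · intro f hf
    exact (Finset.mem_union.mp hf).elim (hs.disc_eq f) (hs'.disc_eq f)
  · intro f hf
    exact (Finset.mem_union.mp hf).elim (hs.rigid f) (hs'.rigid f)
  · intro f hf g hg γ h
    rcases Finset.mem_union.mp hf with hf | hf <;> rcases Finset.mem_union.mp hg with hg | hg
    · exact hs.eq_of_smul f hf g hg γ h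
    · exact absurd ((contentDvd_smul_iff γ).mp (h ▸ hc' g hg)) (hc f hf)
    · exact absurd (h ▸ (hc' f hf).smul γ) (hc g hg)
    · exact hs'.eq_of_smul f hf g hg γ h
  · refine Finset.card_union_of_disjoint (Finset.disjoint_left.mpr fun f h h' ↦ hc f h (hc' f h'))

theorem IsSystem.subset {Δ : ℤ} {s s' : Finset BinForm} (hs : IsSystem Δ s) (h : s' ⊆ s) :
    IsSystem Δ s' :=
  ⟨fun f hf ↦ hs.a_pos f (h hf), fun f hf ↦ hs.disc_eq f (h hf), fun f hf ↦ hs.rigid f (h hf),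
    fun f hf g hg ↦ hs.eq_of_smul f (h hf) g (h hg)⟩

/-- The form `f(pX, Y)`, whose discriminant is `p²` times that of `f`. -/
def lift (p : ℤ) (f : BinForm) : BinForm := ⟨p ^ 2 * f.a, p * f.b, f.c⟩

theorem disc_lift (p : ℤ) (f : BinForm) : (lift p f).disc = p ^ 2 * f.disc := by
  simp only [disc, lift]; ring

/-- An equivalence between `f(pX, Y)` and `g(pX, Y)` comes from one between `f` and `g` that lies in
`Γ₀(p)`, provided that `p` does not divide the last coefficient of `f`. -/
theorem exists_of_smul_lift {p : ℤ} (hp : Prime p) {f g : BinForm} (hf : ¬ p ∣ f.c)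
    {γ : SL(2, ℤ)} (h : γ • lift p f = lift p g) :
    ∃ δ : SL(2, ℤ), δ • f = g ∧ δ 0 0 = γ 0 0 ∧ p * δ 0 1 = γ 0 1 ∧ δ 1 0 = p * γ 1 0 ∧
      δ 1 1 = γ 1 1 := by
  have ha : p ^ 2 * f.a * γ 0 0 ^ 2 + p * f.b * γ 0 0 * γ 0 1 + f.c * γ 0 1 ^ 2 = p ^ 2 * g.a :=
    congrArg BinForm.a h
  have hb : 2 * (p ^ 2 * f.a) * γ 0 0 * γ 1 0 + p * f.b * (γ 0 0 * γ 1 1 + γ 1 0 * γ 0 1) +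
    2 * f.c * γ 0 1 * γ 1 1 = p * g.b := congrArg BinForm.b h
  have hc : p ^ 2 * f.a * γ 1 0 ^ 2 + p * f.b * γ 1 0 * γ 1 1 + f.c * γ 1 1 ^ 2 = g.c :=
    congrArg BinForm.c h
  have hdet := det_eq_one γ
  have hdvd : p ∣ γ 0 1 := by
    have : p ∣ f.c * γ 0 1 ^ 2 :=
      ⟨p * g.a - p * f.a * γ 0 0 ^ 2 - f.b * γ 0 0 * γ 0 1, by linear_combination ha⟩
    exact hp.dvd_of_dvd_pow ((hp.dvd_or_dvd this).resolve_left hf)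
  obtain ⟨y, hy⟩ := hdvd
  rw [hy] at ha hb hdet
  let δ : SL(2, ℤ) := ⟨!![γ 0 0, y; p * γ 1 0, γ 1 1], by
    rw [Matrix.det_fin_two_of]; linear_combination hdet⟩
  have e00 : δ 0 0 = γ 0 0 := rfl
  have e01 : δ 0 1 = y := rfl
  have e10 : δ 1 0 = p * γ 1 0 := rfl
  have e11 : δ 1 1 = γ 1 1 := rfl
  refine ⟨δ, ?_, e00, by rw [e01, hy], e10, e11⟩
  ext
  · apply mul_left_cancel₀ (pow_ne_zero 2 hp.ne_zero)
    rw [smul_a, e00, e01]; linear_combination ha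
  · apply mul_left_cancel₀ hp.ne_zero
    rw [smul_b, e00, e01, e10, e11]; linear_combination hb
  · rw [smul_c, e10, e11]; linear_combination hc

theorem Rigid.lift {p : ℤ} (hp : Prime p) {f : BinForm} (hf : ¬ p ∣ f.c) (h : f.Rigid) :
    (lift p f).Rigid := by
  intro γ hγ
  obtain ⟨δ, h1, h2, h3, h4, h5⟩ := exists_of_smul_lift hp hf hγ
  rcases h δ h1 with rfl | rfl
  · left
    have h6 : γ 1 0 = 0 := by simpa [hp.ne_zero] using h4
    ext i j; fin_cases i <;> fin_cases j <;> simp [← h2, ← h3, ← h5, h6]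
  · right
    have h6 : γ 1 0 = 0 := by simpa [hp.ne_zero] using h4
    ext i j; fin_cases i <;> fin_cases j <;> simp [← h2, ← h3, ← h5, h6]

variable {p : ℕ}

/-- Representatives of `Γ₀(p) \ SL₂(ℤ)`, indexed by the projective line over `ZMod p`. -/
def cosetRep (p : ℕ) : Option (ZMod p) → SL(2, ℤ)
  | none => ⟨!![0, 1; -1, 0], by simp [Matrix.det_fin_two_of]⟩
  | some k => ⟨!![1, 0; (k.val : ℤ), 1], by simp [Matrix.det_fin_two_of]⟩

theorem cosetRep_smul_none_c (f : BinForm) : (cosetRep p none • f).c = f.a := by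
  have h1 : cosetRep p none 1 0 = -1 := rfl
  have h2 : cosetRep p none 1 1 = 0 := rfl
  rw [smul_c, h1, h2]; ring

theorem cosetRep_smul_some_c (f : BinForm) (k : ZMod p) :
    (cosetRep p (some k) • f).c = f.a * (k.val : ℤ) ^ 2 + f.b * (k.val : ℤ) + f.c := by
  have h1 : cosetRep p (some k) 1 0 = (k.val : ℤ) := rfl
  have h2 : cosetRep p (some k) 1 1 = 1 := rfl
  rw [smul_c, h1, h2]; ring

variable [hp : Fact p.Prime]

/-- The matrices `cosetRep p i` represent distinct classes modulo `Γ₀(p)`. -/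
theorem cosetRep_inj {i j : Option (ZMod p)} {δ : SL(2, ℤ)} (h0 : (p : ℤ) ∣ δ 1 0)
    (h : δ * cosetRep p i = cosetRep p j ∨ δ * cosetRep p i = -cosetRep p j) : i = j := by
  obtain ⟨ε, hε, h⟩ : ∃ ε : ℤ, (ε = 1 ∨ ε = -1) ∧ ∀ x y, (δ * cosetRep p i) x y =
      ε * cosetRep p j x y := by
    rcases h with h | h
    · exact ⟨1, .inl rfl, fun x y ↦ by rw [h, one_mul]⟩
    · exact ⟨-1, .inr rfl, fun x y ↦ by rw [h]; simp⟩
  have e : ∀ y, δ 1 0 * cosetRep p i 0 y + δ 1 1 * cosetRep p i 1 y = ε * cosetRep p j 1 y := by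
    intro y
    rw [← h 1 y]
    simp [Matrix.mul_apply, Fin.sum_univ_two]
  have e' : ∀ y, (δ 1 1 : ZMod p) * (cosetRep p i 1 y : ℤ) = ε * (cosetRep p j 1 y : ℤ) := by
    intro y
    have := congrArg (Int.cast : ℤ → ZMod p) (e y)
    push_cast at this
    rw [(ZMod.intCast_zmod_eq_zero_iff_dvd _ _).mpr h0, zero_mul, zero_add] at this
    exact this
  have hε' : (ε : ZMod p) ≠ 0 := by rcases hε with rfl | rfl <;> simp
  have e0 := e' 0
  have e1 := e' 1
  have n0 : cosetRep p none 1 0 = -1 := rfl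
  have n1 : cosetRep p none 1 1 = 0 := rfl
  have s0 : ∀ k, cosetRep p (some k) 1 0 = (k.val : ℤ) := fun _ ↦ rfl
  have s1 : ∀ k, cosetRep p (some k) 1 1 = 1 := fun _ ↦ rfl
  rcases i with _ | k <;> rcases j with _ | l
  · rfl
  · rw [n1, s1] at e1
    simp [hε'.symm] at e1
  · rw [s0, n0] at e0
    rw [s1, n1] at e1
    simp only [Int.cast_one, mul_one, Int.cast_zero, mul_zero] at e1
    rw [e1] at e0
    simp at e0
    exact absurd e0 hε'
  · rw [s0, s0] at e0
    rw [s1, s1] at e1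
    simp only [Int.cast_one, mul_one] at e1
    rw [e1] at e0
    simp only [Int.cast_natCast, ZMod.natCast_zmod_val] at e0
    rw [mul_left_cancel₀ hε' e0]

open Classical in
/-- A form whose content is prime to `p` has at most two zeros on the projective line over
`ZMod p`. -/
theorem card_zeros_le_two {f : BinForm} (hf : ¬ ContentDvd p f) :
    (Finset.univ.filter fun i ↦ (p : ℤ) ∣ (cosetRep p i • f).c).card ≤ 2 := by
  have key : ∀ k : ZMod p, (p : ℤ) ∣ (cosetRep p (some k) • f).c ↔
      (f.a : ZMod p) * k ^ 2 + f.b * k + f.c = 0 := by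
    intro k
    rw [cosetRep_smul_some_c, ← ZMod.intCast_zmod_eq_zero_iff_dvd]
    push_cast; simp
  have hnone : (p : ℤ) ∣ (cosetRep p none • f).c ↔ (f.a : ZMod p) = 0 := by
    rw [cosetRep_smul_none_c, ← ZMod.intCast_zmod_eq_zero_iff_dvd]
  by_cases ha : (f.a : ZMod p) = 0
  · refine (Finset.card_le_card (t := ({none, some (-(f.c : ZMod p) / f.b)} :
      Finset (Option (ZMod p)))) ?_).trans Finset.card_le_two
    intro i hi
    rcases i with _ | k
    · simp
    rw [Finset.mem_filter, key, ha] at hi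
    have h := hi.2
    have hb : (f.b : ZMod p) ≠ 0 := by
      intro hb
      rw [hb] at h
      apply hf
      simp only [ContentDvd, ← ZMod.intCast_zmod_eq_zero_iff_dvd]
      exact ⟨ha, hb, by simpa using h⟩
    have : k = -f.c / f.b := by field_simp; linear_combination h
    simp [this]
  · by_cases h0 : ∃ k : ZMod p, (f.a : ZMod p) * k ^ 2 + f.b * k + f.c = 0
    · obtain ⟨k, hk⟩ := h0
      refine (Finset.card_le_card (t := ({some k, some (-(f.b : ZMod p) / f.a - k)} :
        Finset (Option (ZMod p)))) ?_).trans Finset.card_le_two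
      intro i hi
      rcases i with _ | l
      · rw [Finset.mem_filter, hnone] at hi; exact absurd hi.2 ha
      rw [Finset.mem_filter, key] at hi
      have : (l - k) * (f.a * (l + k) + f.b) = 0 := by linear_combination hi.2 - hk
      rcases mul_eq_zero.mp this with h | h
      · rw [sub_eq_zero.mp h]; simp
      · have : l = -f.b / f.a - k := by field_simp; linear_combination h
        simp [this]
    · rw [Finset.filter_eq_empty_iff.mpr]
      · simp
      · rintro (_ | l) -
        · rwa [hnone]
        · rw [key]; exact fun h ↦ h0 ⟨l, h⟩

open Classical in
/-- A form whose content is prime to `p` and whose discriminant is divisible by the odd prime `p`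
has at most one zero on the projective line over `ZMod p`. -/
theorem card_zeros_le_one (hp2 : p ≠ 2) {f : BinForm} (hf : ¬ ContentDvd p f)
    (hd : (p : ℤ) ∣ f.disc) :
    (Finset.univ.filter fun i ↦ (p : ℤ) ∣ (cosetRep p i • f).c).card ≤ 1 := by
  have key : ∀ k : ZMod p, (p : ℤ) ∣ (cosetRep p (some k) • f).c ↔
      (f.a : ZMod p) * k ^ 2 + f.b * k + f.c = 0 := by
    intro k
    rw [cosetRep_smul_some_c, ← ZMod.intCast_zmod_eq_zero_iff_dvd]
    push_cast; simp
  have hnone : (p : ℤ) ∣ (cosetRep p none • f).c ↔ (f.a : ZMod p) = 0 := by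
    rw [cosetRep_smul_none_c, ← ZMod.intCast_zmod_eq_zero_iff_dvd]
  have hd' : (f.b : ZMod p) ^ 2 - 4 * f.a * f.c = 0 := by
    have := (ZMod.intCast_zmod_eq_zero_iff_dvd _ p).mpr hd
    simpa [disc] using this
  have h2 : (2 : ZMod p) ≠ 0 := by
    intro h
    have : p ∣ 2 := (ZMod.natCast_eq_zero_iff 2 p).mp (by exact_mod_cast h)
    exact hp2 ((Nat.prime_dvd_prime_iff_eq hp.out Nat.prime_two).mp this)
  by_cases ha : (f.a : ZMod p) = 0
  · refine (Finset.card_le_card (t := ({none} : Finset (Option (ZMod p)))) ?_).trans (by simp)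
    intro i hi
    rcases i with _ | k
    · simp
    rw [Finset.mem_filter, key, ha] at hi
    have h := hi.2
    have hb : (f.b : ZMod p) = 0 := by simpa [ha] using hd'
    exfalso
    rw [hb] at h
    apply hf
    simp only [ContentDvd, ← ZMod.intCast_zmod_eq_zero_iff_dvd]
    exact ⟨ha, hb, by simpa using h⟩
  · refine (Finset.card_le_card (t := ({some (-(f.b : ZMod p) / (2 * f.a))} :
      Finset (Option (ZMod p)))) ?_).trans (by simp)
    intro i hi
    rcases i with _ | l
    · rw [Finset.mem_filter, hnone] at hi; exact absurd hi.2 ha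
    rw [Finset.mem_filter, key] at hi
    have : (2 * f.a * l + f.b) ^ 2 = 0 := by linear_combination 4 * f.a * hi.2 + hd'
    have := pow_eq_zero_iff (two_ne_zero) |>.mp this
    have : l = -f.b / (2 * f.a) := by field_simp; linear_combination this
    simp [this]

open Classical in
/-- A system at discriminant `Δ` all of whose members have at least `m` points of `ℙ¹(𝔽_p)` that are
not zeros gives rise to `m` times as many forms at discriminant `p² Δ`. -/
theorem IsSystem.exists_lift {Δ : ℤ} {s : Finset BinForm} (hs : IsSystem Δ s) {m : ℕ}
    (hm : ∀ f ∈ s, m ≤ (Finset.univ.filter fun i ↦ ¬ (p : ℤ) ∣ (cosetRep p i • f).c).card)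
    (hΔ : Δ < 0) :
    ∃ s', IsSystem ((p : ℤ) ^ 2 * Δ) s' ∧ (∀ f ∈ s', ¬ ContentDvd p f) ∧
      m * s.card ≤ s'.card := by
  have hpZ : Prime (p : ℤ) := Nat.prime_iff_prime_int.mp hp.out
  let T := s.sigma fun f ↦ Finset.univ.filter fun i ↦ ¬ (p : ℤ) ∣ (cosetRep p i • f).c
  let F : (Σ _ : BinForm, Option (ZMod p)) → BinForm := fun x ↦ lift p (cosetRep p x.2 • x.1)
  have hT : ∀ x ∈ T, x.1 ∈ s ∧ ¬ (p : ℤ) ∣ (cosetRep p x.2 • x.1).c := by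
    intro x hx
    simpa [T] using hx
  have key : ∀ x ∈ T, ∀ y ∈ T, ∀ γ : SL(2, ℤ), γ • F x = F y → x = y := by
    rintro ⟨f, i⟩ hx ⟨g, j⟩ hy γ h
    obtain ⟨hf, hfc⟩ := hT _ hx
    obtain ⟨hg, hgc⟩ := hT _ hy
    obtain ⟨δ, h1, -, -, h4, -⟩ := exists_of_smul_lift hpZ hfc h
    simp only at h1 hf hg
    have h2 : ((cosetRep p j)⁻¹ * (δ * cosetRep p i)) • f = g := by
      rw [mul_smul, mul_smul, h1, inv_smul_smul]
    obtain rfl := hs.eq_of_smul f hf g hg _ h2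
    have h3 := hs.rigid f hf _ h2
    obtain rfl : i = j := by
      refine cosetRep_inj (δ := δ) (by rw [h4]; exact dvd_mul_right _ _) (h3.imp ?_ ?_)
      · intro h; exact (inv_mul_eq_one.mp h).symm
      · intro h
        rw [inv_mul_eq_iff_eq_mul] at h
        rw [h]; simp
    rfl
  refine ⟨T.image F, ⟨?_, ?_, ?_, ?_⟩, ?_, ?_⟩
  · intro f hf
    obtain ⟨x, hx, rfl⟩ := Finset.mem_image.mp hf
    obtain ⟨h1, h2⟩ := hT x hx
    have hpd := posDef_of_disc_neg (hs.a_pos _ h1) (by rw [hs.disc_eq _ h1]; exact hΔ)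
    exact mul_pos (by have := hp.out.pos; positivity) (hpd.smul _).a_pos
  · intro f hf
    obtain ⟨x, hx, rfl⟩ := Finset.mem_image.mp hf
    rw [disc_lift, disc_smul, hs.disc_eq _ (hT x hx).1]
  · intro f hf
    obtain ⟨x, hx, rfl⟩ := Finset.mem_image.mp hf
    exact ((hs.rigid _ (hT x hx).1).smul _).lift hpZ (hT x hx).2
  · intro f hf g hg γ h
    obtain ⟨x, hx, rfl⟩ := Finset.mem_image.mp hf
    obtain ⟨y, hy, rfl⟩ := Finset.mem_image.mp hg
    rw [key x hx y hy γ h]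
  · intro f hf
    obtain ⟨x, hx, rfl⟩ := Finset.mem_image.mp hf
    exact fun h ↦ (hT x hx).2 h.2.2
  · rw [Finset.card_image_of_injOn fun x hx y hy h ↦ key x hx y hy 1 (by rw [one_smul]; exact h),
      Finset.card_sigma, mul_comm, ← smul_eq_mul]
    exact Finset.card_nsmul_le_sum _ _ _ hm

theorem card_option_zmod : Fintype.card (Option (ZMod p)) = p + 1 := by
  rw [Fintype.card_option, ZMod.card]

theorem IsSystem.exists_lift_of_primitive {Δ : ℤ} {s : Finset BinForm} (hs : IsSystem Δ s)
    (hΔ : Δ < 0) (hc : ∀ f ∈ s, ¬ ContentDvd p f) :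
    ∃ s', IsSystem ((p : ℤ) ^ 2 * Δ) s' ∧ (∀ f ∈ s', ¬ ContentDvd p f) ∧
      (p - 1) * s.card ≤ s'.card := by
  classical
  refine hs.exists_lift (fun f hf ↦ ?_) hΔ
  have h1 := card_zeros_le_two (hc f hf)
  have h2 := Finset.card_filter_add_card_filter_not (s := Finset.univ)
    fun i ↦ (p : ℤ) ∣ (cosetRep p i • f).c
  rw [Finset.card_univ, card_option_zmod] at h2
  omega

theorem IsSystem.exists_lift_of_dvd (hp2 : p ≠ 2) {Δ : ℤ} {s : Finset BinForm}
    (hs : IsSystem Δ s) (hΔ : Δ < 0) (hpΔ : (p : ℤ) ∣ Δ) (hc : ∀ f ∈ s, ¬ ContentDvd p f) :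
    ∃ s', IsSystem ((p : ℤ) ^ 2 * Δ) s' ∧ (∀ f ∈ s', ¬ ContentDvd p f) ∧
      p * s.card ≤ s'.card := by
  classical
  refine hs.exists_lift (fun f hf ↦ ?_) hΔ
  have h1 := card_zeros_le_one hp2 (hc f hf) (by rwa [hs.disc_eq f hf])
  have h2 := Finset.card_filter_add_card_filter_not (s := Finset.univ)
    fun i ↦ (p : ℤ) ∣ (cosetRep p i • f).c
  rw [Finset.card_univ, card_option_zmod] at h2
  omega

/-- A system of `N` forms of discriminant `Δ`, of any content, gives rise to at least `(p - 1) N`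
forms of discriminant `p² Δ` whose contents are prime to `p`. -/
theorem IsSystem.exists_primitive_lift (hp2 : p ≠ 2) {Δ : ℤ} {s : Finset BinForm}
    (hs : IsSystem Δ s) (hΔ : Δ < 0) :
    ∃ s', IsSystem ((p : ℤ) ^ 2 * Δ) s' ∧ (∀ f ∈ s', ¬ ContentDvd p f) ∧
      (p - 1) * s.card ≤ s'.card := by
  classical
  have hpp := hp.out.two_le
  induction hN : Δ.natAbs using Nat.strong_induction_on generalizing Δ s with
  | _ N ih =>
  by_cases hall : ∀ f ∈ s, ¬ ContentDvd p f
  · exact hs.exists_lift_of_primitive hΔ hall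
  push Not at hall
  obtain ⟨f₀, hf₀, hc₀⟩ := hall
  obtain ⟨g₀, rfl⟩ := hc₀.exists_scale
  have hΔ' := hs.disc_eq _ hf₀
  rw [disc_scale] at hΔ'
  set Δ' := g₀.disc
  have hneg : Δ' < 0 := by
    by_contra! h
    have : 0 ≤ (p : ℤ) ^ 2 * Δ' := by positivity
    omega
  have hlt : Δ'.natAbs < N := by
    have : (4 : ℤ) ≤ (p : ℤ) ^ 2 := by exact_mod_cast Nat.pow_le_pow_left hpp 2
    have : Δ < Δ' := by rw [← hΔ']; nlinarith
    omega
  subst hΔ'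
  obtain ⟨u, hu, hu'⟩ := (hs.subset (Finset.filter_subset (ContentDvd p) s)).exists_eq_image_scale
    (by exact_mod_cast hp.out.pos) (fun f hf ↦ (Finset.mem_filter.mp hf).2)
  have hpos : (p : ℤ) ≠ 0 := by exact_mod_cast hp.out.ne_zero
  have hucard : u.card = (s.filter (ContentDvd p)).card := by
    rw [hu', Finset.card_image_of_injective _ (scale_injective hpos)]
  obtain ⟨v, hv, hvc, hvcard⟩ := ih _ hlt hu hneg rfl
  have hsplit := Finset.card_filter_add_card_filter_not (s := s) (ContentDvd p)
  -- Lift whichever of the two primitive systems at discriminant `Δ` is larger.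
  obtain ⟨w, hw, hwc, h1, h2⟩ : ∃ w, IsSystem ((p : ℤ) ^ 2 * Δ') w ∧
      (∀ f ∈ w, ¬ ContentDvd p f) ∧ (s.filter (¬ ContentDvd p ·)).card ≤ w.card ∧
      (p - 1) * u.card ≤ w.card := by
    rcases le_total (s.filter (¬ ContentDvd p ·)).card v.card with h | h
    · exact ⟨v, hv, hvc, h, hvcard⟩
    · exact ⟨_, hs.subset (Finset.filter_subset _ s), fun f hf ↦ (Finset.mem_filter.mp hf).2,
        le_rfl, hvcard.trans h⟩
  obtain ⟨s', h3, h4, h5⟩ := hw.exists_lift_of_dvd hp2 hΔ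
    (Dvd.intro _ (by ring : (p : ℤ) * (p * Δ') = _)) hwc
  refine ⟨s', h3, h4, le_trans ?_ h5⟩
  rw [← hsplit, ← hucard]
  obtain ⟨k, rfl⟩ : ∃ k, p = k + 1 := ⟨p - 1, by omega⟩
  simp only [Nat.add_sub_cancel] at h2 ⊢
  nlinarith

/-- If all forms in a system have content divisible by the odd prime `p`, then the class number is
at least `p` times the size of the system. -/
theorem IsSystem.mul_card_le_hurwitzH (hp2 : p ≠ 2) {Δ : ℤ} {s : Finset BinForm}
    (hs : IsSystem ((p : ℤ) ^ 2 * Δ) s) (hΔ : Δ < 0) (hc : ∀ f ∈ s, ContentDvd p f) :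
    (p * s.card : ℝ) ≤ hurwitzH ((p : ℤ) ^ 2 * Δ) := by
  classical
  have hpos : (0 : ℤ) < p := by exact_mod_cast hp.out.pos
  obtain ⟨u, hu, hu'⟩ := hs.exists_eq_image_scale hpos hc
  have hucard : u.card = s.card := by
    rw [hu', Finset.card_image_of_injective _ (scale_injective hpos.ne')]
  obtain ⟨v, hv, hvc, hvcard⟩ := hu.exists_primitive_lift hp2 hΔ
  obtain ⟨h1, h2⟩ := hv.union hs hvc hc
  refine le_trans ?_ (h1.card_le_hurwitzH (by have : 0 < (p : ℤ) ^ 2 := by positivity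
                                              nlinarith))
  have hpp := hp.out.two_le
  obtain ⟨k, rfl⟩ : ∃ k, p = k + 1 := ⟨p - 1, by omega⟩
  simp only [Nat.add_sub_cancel] at hvcard
  exact_mod_cast (show (k + 1) * s.card ≤ (v ∪ s).card by rw [h2]; nlinarith)

/-- Forms whose contents are exactly divisible by `3`, respectively divisible by `9`, contribute
with multiplicities `2` and `5` to a lower bound for the class number. -/
theorem IsSystem.card_le_hurwitzH_three {Δ : ℤ} {s₁ s₂ : Finset BinForm}
    (hs₁ : IsSystem (81 * Δ) s₁) (hs₂ : IsSystem (81 * Δ) s₂) (hΔ : Δ < 0)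
    (hc₁ : ∀ f ∈ s₁, ContentDvd 3 f ∧ ¬ ContentDvd 9 f) (hc₂ : ∀ f ∈ s₂, ContentDvd 9 f) :
    (2 * s₁.card + 5 * s₂.card : ℝ) ≤ hurwitzH (81 * Δ) := by
  classical
  have : Fact (Nat.Prime 3) := ⟨Nat.prime_three⟩
  have e9 : (81 * Δ : ℤ) = 9 ^ 2 * Δ := by ring
  have e3 : (81 * Δ : ℤ) = 3 ^ 2 * (9 * Δ) := by ring
  have e3' : (9 * Δ : ℤ) = 3 ^ 2 * Δ := by ring
  have hd : ∀ f, ContentDvd 9 f ↔ ∃ g, ContentDvd 3 g ∧ f = BinForm.scale 3 g := by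
    intro f
    constructor
    · intro h
      obtain ⟨g, rfl⟩ := h.exists_scale
      exact ⟨BinForm.scale 3 g, contentDvd_scale _ _, by ext <;> simp only [BinForm.scale] <;> ring⟩
    · rintro ⟨g, h, rfl⟩
      obtain ⟨g, rfl⟩ := h.exists_scale
      exact ⟨⟨g.a, by simp only [BinForm.scale]; ring⟩, ⟨g.b, by simp only [BinForm.scale]; ring⟩,
        ⟨g.c, by simp only [BinForm.scale]; ring⟩⟩
  obtain ⟨t₁, ht₁, rfl⟩ := (e3 ▸ hs₁ : IsSystem (3 ^ 2 * (9 * Δ)) s₁).exists_eq_image_scale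
    (by norm_num) (fun f hf ↦ (hc₁ f hf).1)
  have hc₂' : ∀ f ∈ s₂, ContentDvd 3 f := fun f hf ↦ by
    obtain ⟨g, -, rfl⟩ := (hd f).mp (hc₂ f hf); exact contentDvd_scale _ _
  obtain ⟨u₂, hu₂, rfl⟩ := (e3 ▸ hs₂ : IsSystem (3 ^ 2 * (9 * Δ)) s₂).exists_eq_image_scale
    (by norm_num) hc₂'
  have hsc : Function.Injective (BinForm.scale 3) := scale_injective (by norm_num)
  rw [Finset.card_image_of_injective _ hsc, Finset.card_image_of_injective _ hsc]
  have ht₁c : ∀ f ∈ t₁, ¬ ContentDvd 3 f := fun f hf h ↦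
    (hc₁ _ (Finset.mem_image_of_mem _ hf)).2 ((hd _).mpr ⟨f, h, rfl⟩)
  have hu₂c : ∀ f ∈ u₂, ContentDvd 3 f := fun f hf ↦ by
    obtain ⟨g, h, h'⟩ := (hd _).mp (hc₂ _ (Finset.mem_image_of_mem _ hf))
    rwa [hsc h']
  obtain ⟨t₂, ht₂, ht₂'⟩ := (e3' ▸ hu₂ : IsSystem (3 ^ 2 * Δ) u₂).exists_eq_image_scale
    (by norm_num) hu₂c
  have ht₂card : t₂.card = u₂.card := by
    rw [ht₂', Finset.card_image_of_injective _ hsc]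
  obtain ⟨v, hv, hvc, hvcard⟩ := ht₂.exists_primitive_lift (p := 3) (by norm_num) hΔ
  push_cast at hv hvc
  obtain ⟨w, hw, hwc, h1, h2⟩ : ∃ w, IsSystem (9 * Δ) w ∧
      (∀ f ∈ w, ¬ ContentDvd 3 f) ∧ t₁.card ≤ w.card ∧ 2 * u₂.card ≤ w.card := by
    rcases le_total t₁.card v.card with h | h
    · exact ⟨v, hv, hvc, h, by omega⟩
    · exact ⟨t₁, ht₁, ht₁c, le_rfl, by omega⟩
  obtain ⟨h3, h4⟩ := hw.union hu₂ hwc hu₂c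
  obtain ⟨x, hx, hxc, hxcard⟩ := hw.exists_lift_of_dvd (p := 3) (by norm_num) (by linarith)
    (by rw [e3']; exact ⟨3 * Δ, by push_cast; ring⟩) hwc
  push_cast at hx hxc
  obtain ⟨h5, h6⟩ := hx.union (h3.scale (m := 3) (by norm_num)) hxc (by
    intro f hf
    obtain ⟨g, -, rfl⟩ := Finset.mem_image.mp hf
    exact contentDvd_scale _ _)
  rw [Finset.card_image_of_injective _ hsc, h4] at h6
  rw [e3]
  refine le_trans ?_ (h5.card_le_hurwitzH (by linarith))
  rw [h6]
  exact_mod_cast (show 2 * t₁.card + 5 * u₂.card ≤ x.card + (w.card + u₂.card) by omega)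

end BinForm

/-! ### Integral coordinates of rational points -/

section Coordinates

open WeierstrassCurve WeierstrassCurve.Affine

variable {a₄ a₆ : ℤ}

/-- The numerator `A` of the `x`-coordinate `A / C²`; it is `1` at the point at infinity. -/
def ptA : RatPoint a₄ a₆ → ℤ
  | .zero => 1
  | .some x _ _ => x.num

/-- The numerator `B` of the `y`-coordinate `B / C³`; it is `1` at the point at infinity. -/
def ptB : RatPoint a₄ a₆ → ℤ
  | .zero => 1
  | .some _ y _ => y.num

/-- The common denominator `C ≥ 0` in `(A / C², B / C³)`; it is `0` at the point at infinity. -/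
def ptC : RatPoint a₄ a₆ → ℤ
  | .zero => 0
  | .some x _ _ => (Nat.sqrt x.den : ℤ)

@[simp] theorem ptA_zero : ptA (0 : RatPoint a₄ a₆) = 1 := rfl
@[simp] theorem ptB_zero : ptB (0 : RatPoint a₄ a₆) = 1 := rfl
@[simp] theorem ptC_zero : ptC (0 : RatPoint a₄ a₆) = 0 := rfl

theorem ptC_nonneg (R : RatPoint a₄ a₆) : 0 ≤ ptC R := by
  cases R with
  | zero => exact le_rfl
  | some x y h => exact Int.natCast_nonneg _

theorem Rat.isCoprime_num_den' (x : ℚ) : IsCoprime x.num (x.den : ℤ) := by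
  rw [Int.isCoprime_iff_gcd_eq_one]; exact x.reduced

theorem den_pow_three_eq {x y : ℚ} (h : y ^ 2 = x ^ 3 + a₄ * x + a₆) :
    x.den ^ 3 = y.den ^ 2 := by
  have hx : (x.den : ℚ) ≠ 0 := by exact_mod_cast x.den_ne_zero
  have hy : (y.den : ℚ) ≠ 0 := by exact_mod_cast y.den_ne_zero
  have key : y.num ^ 2 * (x.den : ℤ) ^ 3 =
      (y.den : ℤ) ^ 2 * (x.num ^ 3 + (a₄ * x.num + a₆ * x.den) * x.den ^ 2) := by
    rw [← Rat.num_div_den x, ← Rat.num_div_den y] at h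
    have : (y.num : ℚ) ^ 2 * (x.den : ℚ) ^ 3 =
      (y.den : ℚ) ^ 2 * (x.num ^ 3 + (a₄ * x.num + a₆ * x.den) * x.den ^ 2) := by
      field_simp at h
      linear_combination h
    exact_mod_cast this
  have cx := Rat.isCoprime_num_den' x
  have cy := Rat.isCoprime_num_den' y
  have h1 : (x.den : ℤ) ^ 3 ∣ (y.den : ℤ) ^ 2 := by
    refine IsCoprime.dvd_of_dvd_mul_right ?_ (Dvd.intro_left _ key)
    refine IsCoprime.pow_left ?_
    have : IsCoprime (x.den : ℤ) (x.num ^ 3) := cx.symm.pow_right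
    obtain ⟨u, v, huv⟩ := this
    exact ⟨u - v * ((a₄ * x.num + a₆ * x.den) * x.den), v, by linear_combination huv⟩
  have h2 : (y.den : ℤ) ^ 2 ∣ (x.den : ℤ) ^ 3 :=
    IsCoprime.dvd_of_dvd_mul_left (cy.symm.pow) (Dvd.intro _ key.symm)
  exact Nat.dvd_antisymm (by exact_mod_cast h1) (by exact_mod_cast h2)

theorem den_eq_sqrt_pow {x y : ℚ} (h : y ^ 2 = x ^ 3 + a₄ * x + a₆) :
    x.den = x.den.sqrt ^ 2 ∧ y.den = x.den.sqrt ^ 3 := by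
  have h1 := den_pow_three_eq h
  obtain ⟨c, hc⟩ : x.den ∣ y.den := by
    rw [← Nat.pow_dvd_pow_iff (two_ne_zero), ← h1]
    exact pow_dvd_pow _ (by norm_num)
  have h2 : x.den = c ^ 2 := by
    rw [hc] at h1
    have : x.den ^ 2 * x.den = x.den ^ 2 * c ^ 2 := by rw [← mul_pow, ← h1]; ring
    exact Nat.eq_of_mul_eq_mul_left (by have := x.den_pos; positivity) this
  have h3 : x.den.sqrt = c := by rw [h2, sq, Nat.sqrt_eq]
  rw [h3]
  refine ⟨h2, ?_⟩
  rw [hc, h2]; ring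

theorem ptC_sq_some {x y : ℚ} (h : (shortCurve a₄ a₆).toAffine.Nonsingular x y) :
    ptC (.some x y h : RatPoint a₄ a₆) ^ 2 = x.den := by
  have := (den_eq_sqrt_pow (shortCurve_equation.mp h.1)).1
  change (x.den.sqrt : ℤ) ^ 2 = x.den
  exact_mod_cast this.symm

theorem ptC_pow_three_some {x y : ℚ} (h : (shortCurve a₄ a₆).toAffine.Nonsingular x y) :
    ptC (.some x y h : RatPoint a₄ a₆) ^ 3 = y.den := by
  have := (den_eq_sqrt_pow (shortCurve_equation.mp h.1)).2
  change (x.den.sqrt : ℤ) ^ 3 = y.den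
  exact_mod_cast this.symm

theorem ptC_some_pos {x y : ℚ} (h : (shortCurve a₄ a₆).toAffine.Nonsingular x y) :
    0 < ptC (.some x y h : RatPoint a₄ a₆) := by
  have h1 : 0 < ptC (.some x y h : RatPoint a₄ a₆) ^ 2 := by
    rw [ptC_sq_some]; exact_mod_cast x.den_pos
  have h2 := ptC_nonneg (.some x y h : RatPoint a₄ a₆)
  exact lt_of_le_of_ne h2 fun h0 ↦ by rw [← h0] at h1; simp at h1

theorem x_eq_ptA_div {x y : ℚ} (h : (shortCurve a₄ a₆).toAffine.Nonsingular x y) :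
    x = ptA (.some x y h : RatPoint a₄ a₆) / (ptC (.some x y h : RatPoint a₄ a₆) : ℚ) ^ 2 := by
  have : ((ptC (.some x y h : RatPoint a₄ a₆) : ℚ)) ^ 2 = x.den := by
    exact_mod_cast ptC_sq_some h
  rw [this]; exact (Rat.num_div_den x).symm

theorem y_eq_ptB_div {x y : ℚ} (h : (shortCurve a₄ a₆).toAffine.Nonsingular x y) :
    y = ptB (.some x y h : RatPoint a₄ a₆) / (ptC (.some x y h : RatPoint a₄ a₆) : ℚ) ^ 3 := by
  have : ((ptC (.some x y h : RatPoint a₄ a₆) : ℚ)) ^ 3 = y.den := by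
    exact_mod_cast ptC_pow_three_some h
  rw [this]; exact (Rat.num_div_den y).symm

theorem ptC_eq_zero_iff {R : RatPoint a₄ a₆} : ptC R = 0 ↔ R = 0 := by
  cases R with
  | zero => exact ⟨fun _ ↦ rfl, fun _ ↦ rfl⟩
  | some x y h => exact ⟨fun h0 ↦ absurd h0 (ptC_some_pos h).ne', fun h0 ↦ by cases h0⟩

theorem ptC_pos {R : RatPoint a₄ a₆} (h : R ≠ 0) : 0 < ptC R :=
  lt_of_le_of_ne (ptC_nonneg R) fun h0 ↦ h (ptC_eq_zero_iff.mp h0.symm)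

theorem isCoprime_ptA_ptC (R : RatPoint a₄ a₆) : IsCoprime (ptA R) (ptC R) := by
  cases R with
  | zero => exact isCoprime_one_left
  | some x y h =>
    have := Rat.isCoprime_num_den' x
    rw [← ptC_sq_some h] at this
    exact (IsCoprime.pow_right_iff two_pos).mp this

theorem pt_equation (R : RatPoint a₄ a₆) :
    ptB R ^ 2 = ptA R ^ 3 + a₄ * ptA R * ptC R ^ 4 + a₆ * ptC R ^ 6 := by
  cases R with
  | zero => change (1 : ℤ) ^ 2 = 1 ^ 3 + a₄ * 1 * 0 ^ 4 + a₆ * 0 ^ 6; ring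
  | some x y h =>
    have h1 := shortCurve_equation.mp h.1
    have hC : (ptC (.some x y h : RatPoint a₄ a₆) : ℚ) ≠ 0 := by
      exact_mod_cast (ptC_some_pos h).ne'
    have hx := x_eq_ptA_div h
    have hy := y_eq_ptB_div h
    set R : RatPoint a₄ a₆ := .some x y h
    have : (ptB R : ℚ) ^ 2 = ptA R ^ 3 + a₄ * ptA R * ptC R ^ 4 + a₆ * ptC R ^ 6 := by
      rw [hx, hy] at h1
      field_simp at h1
      linear_combination h1
    exact_mod_cast this

theorem ext_pt {R R' : RatPoint a₄ a₆} (hA : ptA R = ptA R') (hB : ptB R = ptB R')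
    (hC : ptC R = ptC R') : R = R' := by
  cases R with
  | zero => exact (ptC_eq_zero_iff.mp hC.symm).symm
  | some x y h =>
    cases R' with
    | zero => exact absurd hC (ptC_some_pos h).ne'
    | some x' y' h' =>
      have h1 := x_eq_ptA_div h
      have h2 := x_eq_ptA_div h'
      have h3 := y_eq_ptB_div h
      have h4 := y_eq_ptB_div h'
      rw [hA, hC, ← h2] at h1
      rw [hB, hC, ← h4] at h3
      subst h1 h3
      rfl

theorem ptA_neg (R : RatPoint a₄ a₆) : ptA (-R) = ptA R := by
  cases R with
  | zero => rfl
  | some x y h => rw [Point.neg_some]; rfl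

theorem ptC_neg (R : RatPoint a₄ a₆) : ptC (-R) = ptC R := by
  cases R with
  | zero => rfl
  | some x y h => rw [Point.neg_some]; rfl

theorem ptB_neg {R : RatPoint a₄ a₆} (hR : R ≠ 0) : ptB (-R) = -ptB R := by
  cases R with
  | zero => exact absurd rfl hR
  | some x y h =>
    rw [Point.neg_some]
    change ((shortCurve a₄ a₆).toAffine.negY x y).num = -y.num
    simp [shortCurve, Affine.negY]

theorem eq_or_eq_neg_of_pt {R R' : RatPoint a₄ a₆} (hA : ptA R = ptA R') (hC : ptC R = ptC R') :
    R' = R ∨ R' = -R := by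
  rcases eq_or_ne R 0 with rfl | hR
  · left; exact ptC_eq_zero_iff.mp hC.symm
  have h1 := pt_equation R
  have h2 := pt_equation R'
  rw [← hA, ← hC, ← h1] at h2
  rcases sq_eq_sq_iff_eq_or_eq_neg.mp h2 with h | h
  · left; exact ext_pt hA.symm h hC.symm
  · right; exact ext_pt (by rw [ptA_neg, hA]) (by rw [ptB_neg hR, h]) (by rw [ptC_neg, hC])

/-- The multiplicative height `max(|A|, C²)`. -/
def ptHeight (R : RatPoint a₄ a₆) : ℤ := max |ptA R| (ptC R ^ 2)

theorem abs_ptA_le (R : RatPoint a₄ a₆) : |ptA R| ≤ ptHeight R := le_max_left _ _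
theorem ptC_sq_le (R : RatPoint a₄ a₆) : ptC R ^ 2 ≤ ptHeight R := le_max_right _ _

theorem one_le_ptHeight (R : RatPoint a₄ a₆) : 1 ≤ ptHeight R := by
  rcases eq_or_ne R 0 with rfl | hR
  · simp [ptHeight]
  · have := ptC_pos hR
    have := ptC_sq_le R
    nlinarith

theorem ptHeight_zero : ptHeight (0 : RatPoint a₄ a₆) = 1 := by simp [ptHeight]

theorem weilHeight_eq_log (R : RatPoint a₄ a₆) : weilHeight R = Real.log (ptHeight R) := by
  cases R with
  | zero => change (0 : ℝ) = Real.log (ptHeight (0 : RatPoint a₄ a₆)); simp [ptHeight_zero]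
  | some x y h =>
    have h1 : (ptC (.some x y h : RatPoint a₄ a₆) : ℝ) ^ 2 = x.den := by
      exact_mod_cast ptC_sq_some h
    simp only [weilHeight, ptHeight]
    push_cast
    rw [h1]
    rfl

/-- The addition formula for the `x`-coordinate in integral coordinates. -/
theorem ptA_add_mul {P Q : RatPoint a₄ a₆} (hP : P ≠ 0) (hQ : Q ≠ 0)
    (hne : ptA P * ptC Q ^ 2 ≠ ptA Q * ptC P ^ 2) :
    P + Q ≠ 0 ∧ ptA (P + Q) * (ptC P ^ 2 * ptC Q ^ 2 *
        (ptA P * ptC Q ^ 2 - ptA Q * ptC P ^ 2) ^ 2) =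
      ptC (P + Q) ^ 2 * ((ptB P * ptC Q ^ 3 - ptB Q * ptC P ^ 3) ^ 2 -
        (ptA P * ptC Q ^ 2 + ptA Q * ptC P ^ 2) *
          (ptA P * ptC Q ^ 2 - ptA Q * ptC P ^ 2) ^ 2) := by
  rcases P with _ | ⟨x₁, y₁, h₁⟩
  · exact absurd rfl hP
  rcases Q with _ | ⟨x₂, y₂, h₂⟩
  · exact absurd rfl hQ
  have hx₁ := x_eq_ptA_div h₁
  have hx₂ := x_eq_ptA_div h₂
  have hy₁ := y_eq_ptB_div h₁
  have hy₂ := y_eq_ptB_div h₂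
  have hC₁ : (ptC (.some x₁ y₁ h₁ : RatPoint a₄ a₆) : ℚ) ≠ 0 := by
    exact_mod_cast (ptC_some_pos h₁).ne'
  have hC₂ : (ptC (.some x₂ y₂ h₂ : RatPoint a₄ a₆) : ℚ) ≠ 0 := by
    exact_mod_cast (ptC_some_pos h₂).ne'
  set P : RatPoint a₄ a₆ := .some x₁ y₁ h₁ with hPdef
  set Q : RatPoint a₄ a₆ := .some x₂ y₂ h₂ with hQdef
  have hne' : (ptA P * ptC Q ^ 2 - ptA Q * ptC P ^ 2 : ℚ) ≠ 0 := by
    rw [sub_ne_zero]; exact_mod_cast hne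
  have hx : x₁ ≠ x₂ := by
    rw [hx₁, hx₂]
    intro h
    field_simp at h
    apply hne'
    linear_combination h
  have hsum : ∃ y₃ h₃, P + Q = .some (((y₁ - y₂) / (x₁ - x₂)) ^ 2 - x₁ - x₂) y₃ h₃ := by
    have e : (shortCurve a₄ a₆).toAffine.addX x₁ x₂
        ((shortCurve a₄ a₆).toAffine.slope x₁ x₂ y₁ y₂) =
        ((y₁ - y₂) / (x₁ - x₂)) ^ 2 - x₁ - x₂ := by
      rw [Affine.slope_of_X_ne hx]; simp [Affine.addX, shortCurve]
    rw [hPdef, hQdef, Point.add_of_X_ne hx, ← e]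
    exact ⟨_, _, rfl⟩
  obtain ⟨y₃, h₃, h⟩ := hsum
  have hx₃ := x_eq_ptA_div h₃
  have hC₃ : (ptC (.some _ y₃ h₃ : RatPoint a₄ a₆) : ℚ) ≠ 0 := by
    exact_mod_cast (ptC_some_pos h₃).ne'
  rw [h]
  refine ⟨by simp, ?_⟩
  set R : RatPoint a₄ a₆ := .some _ y₃ h₃
  rw [hx₁, hx₂, hy₁, hy₂] at hx₃
  have key : (ptA R * (ptC P ^ 2 * ptC Q ^ 2 *
        (ptA P * ptC Q ^ 2 - ptA Q * ptC P ^ 2) ^ 2) : ℚ) =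
      ptC R ^ 2 * ((ptB P * ptC Q ^ 3 - ptB Q * ptC P ^ 3) ^ 2 -
        (ptA P * ptC Q ^ 2 + ptA Q * ptC P ^ 2) *
          (ptA P * ptC Q ^ 2 - ptA Q * ptC P ^ 2) ^ 2) := by
    have e : (ptA P / (ptC P : ℚ) ^ 2 - ptA Q / (ptC Q : ℚ) ^ 2) =
        (ptA P * ptC Q ^ 2 - ptA Q * ptC P ^ 2) / ((ptC P : ℚ) ^ 2 * ptC Q ^ 2) := by
      field_simp
    rw [e] at hx₃
    generalize (ptA P * ptC Q ^ 2 - ptA Q * ptC P ^ 2 : ℚ) = d at hx₃ hne' ⊢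
    field_simp at hx₃
    linear_combination -hx₃
  exact_mod_cast key

/-- The duplication formula for the `x`-coordinate in integral coordinates. -/
theorem ptA_double_mul {P : RatPoint a₄ a₆} (hP : P ≠ 0) (hB : ptB P ≠ 0) :
    P + P ≠ 0 ∧ ptA (P + P) * (4 * ptB P ^ 2 * ptC P ^ 2) =
      ptC (P + P) ^ 2 * ((3 * ptA P ^ 2 + a₄ * ptC P ^ 4) ^ 2 - 8 * ptA P * ptB P ^ 2) := by
  rcases P with _ | ⟨x₁, y₁, h₁⟩
  · exact absurd rfl hP
  have hx₁ := x_eq_ptA_div h₁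
  have hy₁ := y_eq_ptB_div h₁
  have hC₁ : (ptC (.some x₁ y₁ h₁ : RatPoint a₄ a₆) : ℚ) ≠ 0 := by
    exact_mod_cast (ptC_some_pos h₁).ne'
  set P : RatPoint a₄ a₆ := .some x₁ y₁ h₁ with hPdef
  have hB' : (ptB P : ℚ) ≠ 0 := by exact_mod_cast hB
  have hy : y₁ ≠ 0 := by rw [hy₁]; positivity
  have hyn : y₁ ≠ (shortCurve a₄ a₆).toAffine.negY x₁ y₁ := by
    simp only [shortCurve, Affine.negY]
    intro h0; apply hy; linarith
  have hsum : ∃ y₃ h₃, P + P = .some (((3 * x₁ ^ 2 + a₄) / (2 * y₁)) ^ 2 - x₁ - x₁) y₃ h₃ := by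
    have e : (shortCurve a₄ a₆).toAffine.addX x₁ x₁
        ((shortCurve a₄ a₆).toAffine.slope x₁ x₁ y₁ y₁) =
        ((3 * x₁ ^ 2 + a₄) / (2 * y₁)) ^ 2 - x₁ - x₁ := by
      rw [Affine.slope_of_Y_ne rfl hyn]
      simp only [Affine.addX, shortCurve, Affine.negY]
      ring
    rw [hPdef, Point.add_self_of_Y_ne hyn, ← e]
    exact ⟨_, _, rfl⟩
  obtain ⟨y₃, h₃, h⟩ := hsum
  have hx₃ := x_eq_ptA_div h₃
  have hC₃ : (ptC (.some _ y₃ h₃ : RatPoint a₄ a₆) : ℚ) ≠ 0 := by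
    exact_mod_cast (ptC_some_pos h₃).ne'
  rw [h]
  refine ⟨by simp, ?_⟩
  set R : RatPoint a₄ a₆ := .some _ y₃ h₃
  rw [hx₁, hy₁] at hx₃
  have key : (ptA R * (4 * ptB P ^ 2 * ptC P ^ 2) : ℚ) =
      ptC R ^ 2 * ((3 * ptA P ^ 2 + a₄ * ptC P ^ 4) ^ 2 - 8 * ptA P * ptB P ^ 2) := by
    field_simp at hx₃
    linear_combination -hx₃
  exact_mod_cast key

theorem add_self_eq_zero_of_ptB {T : RatPoint a₄ a₆} (hB : ptB T = 0) : T + T = 0 := by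
  rcases T with _ | ⟨x, y, h⟩
  · exact absurd hB one_ne_zero
  · have hy : y = 0 := Rat.num_eq_zero.mp hB
    subst hy
    apply Point.add_of_Y_eq rfl; simp [shortCurve, Affine.negY]

end Coordinates

/-! ### Points of small height and their quadratic forms -/

section Box

variable {a₄ a₆ t n : ℤ}

/-- The numerator `α = A + t C²` of `x(R) + t`. -/
def alpha (t : ℤ) (R : RatPoint a₄ a₆) : ℤ := ptA R + t * ptC R ^ 2

open Classical in
/-- A finite set of points of small height. Here `n = t³ + a₄ t - a₆`, so that `-n` is the value of
`x³ + a₄ x + a₆` at `-t`. The height conditions say that `ptHeight R < √E` and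
`ptHeight (R + R') * ptHeight (R - R') < E²`, where `E = n / (t + 1)²`. -/
structure Box (a₄ a₆ t n : ℤ) (S : Finset (RatPoint a₄ a₆)) : Prop where
  n_eq : n = t ^ 3 + a₄ * t - a₆
  t_pos : 0 < t
  lt_n : (t + 1) ^ 2 < n
  n_lt : 4 * n < (t + 1) ^ 2 * t ^ 2
  neg_mem : ∀ R ∈ S, -R ∈ S
  add_mem : ∀ R ∈ S, ∀ T : RatPoint a₄ a₆, T + T = 0 → R + T ∈ S
  height_lt : ∀ R ∈ S, ptHeight R ^ 2 * (t + 1) ^ 2 < n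
  pair_lt : ∀ R ∈ S, ∀ R' ∈ S, ptHeight (R + R') * ptHeight (R - R') * (t + 1) ^ 4 < n ^ 2
  /-- If translation by points of `Low` maps the symmetric set `High` to itself,
  then `Low` is not much larger than `High` within `S`. -/
  card_low_le : ∀ High Low : RatPoint a₄ a₆ → Prop, (∀ x, High x → High (-x)) →
    (∀ x y, High x → Low y → High (x + y)) → (∃ x ∈ S, High x) →
    2 * (S.filter Low).card ≤ 3 * (S.filter High).card

theorem alpha_zero : alpha t (0 : RatPoint a₄ a₆) = 1 := by simp [alpha]

theorem alpha_neg (R : RatPoint a₄ a₆) : alpha t (-R) = alpha t R := by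
  simp only [alpha, ptA_neg, ptC_neg]

theorem isCoprime_alpha_ptC (R : RatPoint a₄ a₆) : IsCoprime (alpha t R) (ptC R) := by
  have := isCoprime_ptA_ptC R
  rw [alpha, show ptA R + t * ptC R ^ 2 = ptA R + ptC R * (t * ptC R) by ring]
  exact (IsCoprime.add_mul_left_left_iff).mpr this

/-- The cofactor `G` of `α` in `B² + n C⁶ = α G`. -/
def cofactor (t : ℤ) (R : RatPoint a₄ a₆) : ℤ :=
  ptA R ^ 2 - t * ptA R * ptC R ^ 2 + (t ^ 2 + a₄) * ptC R ^ 4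

theorem alpha_mul_cofactor (hn : n = t ^ 3 + a₄ * t - a₆) (R : RatPoint a₄ a₆) :
    alpha t R * cofactor t R = ptB R ^ 2 + n * ptC R ^ 6 := by
  rw [pt_equation, hn, alpha, cofactor]; ring

/-- The derivative `κ = 3 t² + a₄` of `x³ + a₄ x + a₆` at `-t` governs `G` modulo `α`. -/
theorem kappa_mul (R : RatPoint a₄ a₆) : (3 * t ^ 2 + a₄) * ptC R ^ 4 =
    cofactor t R + 3 * t * ptC R ^ 2 * alpha t R - alpha t R ^ 2 := by
  rw [alpha, cofactor]; ring

/-- The middle coefficient is determined by a root `v` of `v C³ ≡ B (mod α)`. -/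
theorem exists_root (t : ℤ) (R : RatPoint a₄ a₆) : ∃ v, alpha t R ∣ v * ptC R ^ 3 - ptB R := by
  obtain ⟨u, w, h⟩ := (isCoprime_alpha_ptC (t := t) R).pow_right (n := 3)
  exact ⟨w * ptB R, -u * ptB R, by linear_combination ptB R * h⟩

/-- A root of `v C³ ≡ B (mod α)`. -/
noncomputable def root (t : ℤ) (R : RatPoint a₄ a₆) : ℤ := (exists_root t R).choose

theorem dvd_root_mul_sub (t : ℤ) (R : RatPoint a₄ a₆) :
    alpha t R ∣ root t R * ptC R ^ 3 - ptB R := (exists_root t R).choose_spec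

theorem dvd_root_sq_add (hn : n = t ^ 3 + a₄ * t - a₆) (R : RatPoint a₄ a₆) :
    alpha t R ∣ root t R ^ 2 + n := by
  obtain ⟨l, hl⟩ := dvd_root_mul_sub t R
  have h := alpha_mul_cofactor hn R
  have hc : IsCoprime (alpha t R) (ptC R ^ 6) := (isCoprime_alpha_ptC R).pow_right
  refine hc.dvd_of_dvd_mul_right ⟨cofactor t R + l * (root t R * ptC R ^ 3 + ptB R), ?_⟩
  linear_combination (root t R * ptC R ^ 3 + ptB R) * hl - h

/-- The form `α X² + 2v XY + ((v² + n)/α) Y²` of discriminant `-4n` attached to a point. -/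
noncomputable def pointForm (t n : ℤ) (R : RatPoint a₄ a₆) : BinForm :=
  ⟨alpha t R, 2 * root t R, (root t R ^ 2 + n) / alpha t R⟩

/-- If `q` divides `α`, `B` and `κ`, then it divides the content of the form. -/
theorem contentDvd_pointForm (hn : n = t ^ 3 + a₄ * t - a₆) {R : RatPoint a₄ a₆} {q : ℤ}
    (hα0 : alpha t R ≠ 0) (hα : q ∣ alpha t R) (hB : q ∣ ptB R) (hκ : q ∣ 3 * t ^ 2 + a₄) :
    (pointForm t n R).ContentDvd q := by
  have hc : IsCoprime q (ptC R) := (isCoprime_alpha_ptC R).of_isCoprime_of_dvd_left hα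
  obtain ⟨l, hl⟩ := dvd_root_mul_sub t R
  have hG : q ∣ cofactor t R := by
    have h := kappa_mul (t := t) R
    have : cofactor t R = (3 * t ^ 2 + a₄) * ptC R ^ 4 +
      alpha t R * (alpha t R - 3 * t * ptC R ^ 2) := by linear_combination -h
    rw [this]
    exact dvd_add (hκ.mul_right _) (hα.mul_right _)
  refine ⟨hα, ?_, ?_⟩
  · refine Dvd.dvd.mul_left ((hc.pow_right (n := 3)).dvd_of_dvd_mul_right ?_) 2
    have : root t R * ptC R ^ 3 = ptB R + alpha t R * l := by linear_combination hl
    rw [this]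
    exact dvd_add hB (hα.mul_right _)
  · obtain ⟨c, hc'⟩ := dvd_root_sq_add hn R
    simp only [pointForm]
    rw [hc', Int.mul_ediv_cancel_left _ hα0]
    refine (hc.pow_right (n := 6)).dvd_of_dvd_mul_right ?_
    have h := alpha_mul_cofactor hn R
    have : c * ptC R ^ 6 = cofactor t R + 2 * l * ptB R + l ^ 2 * alpha t R := by
      apply mul_left_cancel₀ hα0
      linear_combination -ptC R ^ 6 * hc' - h + (root t R * ptC R ^ 3 + ptB R + alpha t R * l) * hl
    rw [this]
    exact dvd_add (dvd_add hG (hB.mul_left _)) (hα.mul_left _)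

namespace Box

variable {S : Finset (RatPoint a₄ a₆)}

theorem three_le_t (hS : Box a₄ a₆ t n S) : 3 ≤ t := by
  have h1 := hS.lt_n
  have h2 := hS.n_lt
  have := hS.t_pos
  by_contra! h
  have : t = 1 ∨ t = 2 := by omega
  rcases this with rfl | rfl <;> omega

theorem two_mul_height_lt (hS : Box a₄ a₆ t n S) {R : RatPoint a₄ a₆} (hR : R ∈ S) :
    2 * ptHeight R < t := by
  have h1 := hS.height_lt R hR
  have h2 := hS.n_lt
  have h3 := hS.t_pos
  have h4 := one_le_ptHeight R
  have h5 : (2 * ptHeight R) ^ 2 * (t + 1) ^ 2 < t ^ 2 * (t + 1) ^ 2 := by linarith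
  have h6 := lt_of_mul_lt_mul_right h5 (sq_nonneg _)
  exact lt_of_pow_lt_pow_left₀ 2 h3.le h6

theorem alpha_le (hS : Box a₄ a₆ t n S) (R : RatPoint a₄ a₆) :
    alpha t R ≤ (t + 1) * ptHeight R := by
  have h1 := (abs_le.mp (abs_ptA_le R)).2
  have h2 := mul_le_mul_of_nonneg_left (ptC_sq_le R) hS.t_pos.le
  rw [alpha]; linarith

theorem lt_alpha (hS : Box a₄ a₆ t n S) {R : RatPoint a₄ a₆} (hR : R ∈ S) :
    t * (2 * ptC R ^ 2 - 1) < 2 * alpha t R := by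
  have h1 := (abs_le.mp (abs_ptA_le R)).1
  have h2 := hS.two_mul_height_lt hR
  rw [alpha]; linarith

theorem lt_two_mul_alpha (hS : Box a₄ a₆ t n S) {R : RatPoint a₄ a₆} (hR : R ∈ S) (h0 : R ≠ 0) :
    t < 2 * alpha t R := by
  have h1 := hS.lt_alpha hR
  have h2 : 1 ≤ ptC R ^ 2 := BinForm.one_le_sq_of_ne_zero (ptC_pos h0).ne'
  nlinarith [hS.t_pos]

theorem alpha_pos (hS : Box a₄ a₆ t n S) {R : RatPoint a₄ a₆} (hR : R ∈ S) : 0 < alpha t R := by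
  rcases eq_or_ne R 0 with rfl | h0
  · rw [alpha_zero]; exact one_pos
  · have := hS.lt_two_mul_alpha hR h0
    have := hS.t_pos
    linarith

theorem alpha_sq_lt (hS : Box a₄ a₆ t n S) {R : RatPoint a₄ a₆} (hR : R ∈ S) :
    alpha t R ^ 2 < n := by
  have h1 := hS.height_lt R hR
  have h2 := pow_le_pow_left₀ (hS.alpha_pos hR).le (hS.alpha_le R) 2
  rw [mul_pow, mul_comm] at h2
  linarith

theorem n_pos (hS : Box a₄ a₆ t n S) : 0 < n := by
  have := hS.lt_n
  have := sq_nonneg (t + 1)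
  linarith

theorem small_pointForm (hS : Box a₄ a₆ t n S) {R : RatPoint a₄ a₆} (hR : R ∈ S) :
    BinForm.Small n (pointForm t n R) := by
  refine ⟨hS.alpha_pos hR, ?_, hS.alpha_sq_lt hR⟩
  obtain ⟨c, hc⟩ := dvd_root_sq_add hS.n_eq R
  simp only [BinForm.disc, pointForm]
  rw [hc, Int.mul_ediv_cancel_left _ (hS.alpha_pos hR).ne']
  linear_combination 4 * hc

theorem eq_or_eq_neg_of_alpha_eq (hS : Box a₄ a₆ t n S) {R R' : RatPoint a₄ a₆} (hR : R ∈ S)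
    (hR' : R' ∈ S)
    (h : alpha t R = alpha t R') : R' = R ∨ R' = -R := by
  have h1 := abs_le.mp (abs_ptA_le R)
  have h2 := abs_le.mp (abs_ptA_le R')
  have h3 := hS.two_mul_height_lt hR
  have h4 := hS.two_mul_height_lt hR'
  simp only [alpha] at h
  have h5 : ptC R ^ 2 - ptC R' ^ 2 < 1 := by
    have : t * (ptC R ^ 2 - ptC R' ^ 2) < t * 1 := by linarith
    exact lt_of_mul_lt_mul_left this hS.t_pos.le
  have h6 : -1 < ptC R ^ 2 - ptC R' ^ 2 := by
    have : t * -1 < t * (ptC R ^ 2 - ptC R' ^ 2) := by linarith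
    exact lt_of_mul_lt_mul_left this hS.t_pos.le
  have h7 : ptC R ^ 2 = ptC R' ^ 2 := by omega
  refine eq_or_eq_neg_of_pt (by rw [h7] at h; linarith) ?_
  exact (pow_left_inj₀ (ptC_nonneg R) (ptC_nonneg R') two_ne_zero).mp h7

theorem eq_or_of_smul_pointForm (hS : Box a₄ a₆ t n S) {R R' : RatPoint a₄ a₆} (hR : R ∈ S)
    (hR' : R' ∈ S)
    {γ : SL(2, ℤ)} (h : γ • pointForm t n R = pointForm t n R') :
    R' = R ∨ (R' = -R ∧ R ≠ 0 ∧ alpha t R ∣ 2 * ptB R) := by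
  obtain ⟨h1, h2⟩ := (hS.small_pointForm hR).eq_of_smul (hS.small_pointForm hR') h
  simp only [pointForm] at h1 h2
  rcases hS.eq_or_eq_neg_of_alpha_eq hR hR' h1 with h3 | h3
  · exact .inl h3
  rcases eq_or_ne R 0 with h0 | h0
  · left; rw [h3, h0, neg_zero]
  refine .inr ⟨h3, h0, ?_⟩
  have h4 := dvd_root_mul_sub t R
  have h5 := dvd_root_mul_sub t R'
  have e1 : ptC R' = ptC R := by rw [h3, ptC_neg]
  have e2 : ptB R' = -ptB R := by rw [h3, ptB_neg h0]
  rw [← h1, e1, e2] at h5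
  obtain ⟨x, hx⟩ := h2
  obtain ⟨y, hy⟩ := h4
  obtain ⟨z, hz⟩ := h5
  have h6 : root t R' - root t R = alpha t R * x := by linarith
  exact ⟨z - y - x * ptC R ^ 3, by linear_combination hz - hy - ptC R ^ 3 * h6⟩

end Box

end Box

/-! ### Points reducing to a singular point -/

section Singular

variable {a₄ a₆ t n : ℤ}

theorem ptA_mul_ne_of_not_dvd {q : ℤ} {P Q : RatPoint a₄ a₆} (hP : q ∣ alpha t P)
    (hQ : ¬ q ∣ alpha t Q) : ptA P * ptC Q ^ 2 ≠ ptA Q * ptC P ^ 2 := by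
  intro h
  apply hQ
  have hc : IsCoprime q (ptC P ^ 2) :=
    ((isCoprime_alpha_ptC P).of_isCoprime_of_dvd_left hP).pow_right
  refine hc.dvd_of_dvd_mul_right ?_
  have : alpha t Q * ptC P ^ 2 = alpha t P * ptC Q ^ 2 := by
    simp only [alpha]; linear_combination -h
  rw [this]
  exact hP.mul_right _

/-- The addition formula in terms of the numerators `α` of `x + t`. -/
theorem alpha_add_mul (hn : n = t ^ 3 + a₄ * t - a₆) {P Q : RatPoint a₄ a₆} (hP : P ≠ 0)
    (hQ : Q ≠ 0) (hne : ptA P * ptC Q ^ 2 ≠ ptA Q * ptC P ^ 2) :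
    alpha t (P + Q) * (alpha t P * ptC Q ^ 2 - alpha t Q * ptC P ^ 2) ^ 2 =
      ptC (P + Q) ^ 2 * (alpha t P * alpha t Q *
          (alpha t P * ptC Q ^ 2 + alpha t Q * ptC P ^ 2 - 6 * t * ptC P ^ 2 * ptC Q ^ 2) +
        (3 * t ^ 2 + a₄) * ptC P ^ 2 * ptC Q ^ 2 *
          (alpha t P * ptC Q ^ 2 + alpha t Q * ptC P ^ 2) -
        2 * n * ptC P ^ 4 * ptC Q ^ 4 - 2 * ptB P * ptB Q * ptC P * ptC Q) := by
  obtain ⟨-, h⟩ := ptA_add_mul hP hQ hne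
  have hP' := (ptC_pos hP).ne'
  have hQ' := (ptC_pos hQ).ne'
  have e₁ := pt_equation P
  have e₂ := pt_equation Q
  have hc : ptC P ^ 2 * ptC Q ^ 2 ≠ 0 := by positivity
  apply mul_left_cancel₀ hc
  rw [hn]
  simp only [alpha]
  linear_combination h + ptC (P + Q) ^ 2 * (ptC Q ^ 6 * e₁ + ptC P ^ 6 * e₂)

/-- `q = p ^ k` is a prime power such that the points with `q ∣ α` reduce to the singular point
`(-t, 0)` modulo `q` and have `q ∣ B`. -/
structure SingularAt (a₄ a₆ t n p : ℤ) (k : ℕ) : Prop where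
  prime : Prime p
  pos : k ≠ 0
  dvd_kappa : p ^ k ∣ 3 * t ^ 2 + a₄
  dvd_n : p ^ k ∣ n
  dvd_ptB : ∀ R : RatPoint a₄ a₆, p ^ k ∣ alpha t R → p ^ k ∣ ptB R

/-- Adding a point with nonsingular reduction to a point with `p ^ k ∣ α` gives another point with
`p ^ k ∣ α`. -/
theorem SingularAt.dvd_alpha_add {p : ℤ} {k : ℕ} (h : SingularAt a₄ a₆ t n p k)
    (hn : n = t ^ 3 + a₄ * t - a₆) {P Q : RatPoint a₄ a₆}
    (hP : p ^ k ∣ alpha t P) (hQ : ¬ p ∣ alpha t Q) : p ^ k ∣ alpha t (P + Q) := by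
  rcases eq_or_ne Q 0 with rfl | hQ0
  · rwa [add_zero]
  have hpk : p ∣ p ^ k := dvd_pow_self p h.pos
  have hP0 : P ≠ 0 := by
    rintro rfl
    rw [alpha_zero] at hP
    exact h.prime.not_dvd_one (hpk.trans hP)
  have hne := ptA_mul_ne_of_not_dvd (hpk.trans hP) hQ
  have key := alpha_add_mul hn hP0 hQ0 hne
  have hPC : ¬ p ∣ ptC P := by
    intro h'
    have := (isCoprime_alpha_ptC (t := t) P).isUnit_of_dvd' (hpk.trans hP) h'
    exact h.prime.not_isUnit this
  have hcop : IsCoprime (p ^ k) ((alpha t P * ptC Q ^ 2 - alpha t Q * ptC P ^ 2) ^ 2) := by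
    refine IsCoprime.pow ?_
    rw [h.prime.coprime_iff_not_dvd]
    intro h'
    have h2 : p ∣ alpha t Q * ptC P ^ 2 := by
      have := dvd_sub ((hpk.trans hP).mul_right (ptC Q ^ 2)) h'
      simpa using this
    rcases h.prime.dvd_or_dvd h2 with h3 | h3
    · exact hQ h3
    · exact hPC (h.prime.dvd_of_dvd_pow h3)
  refine hcop.dvd_of_dvd_mul_right ?_
  rw [key]
  refine Dvd.dvd.mul_left ?_ _
  refine dvd_sub (dvd_sub (dvd_add ?_ ?_) ?_) ?_
  · exact (hP.mul_right _).mul_right _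
  · exact ((h.dvd_kappa.mul_right _).mul_right _).mul_right _
  · exact ((h.dvd_n.mul_left _).mul_right _).mul_right _
  · exact ((((h.dvd_ptB P hP).mul_left _).mul_right _).mul_right _).mul_right _

theorem singularAt_of_prime (hn : n = t ^ 3 + a₄ * t - a₆) {p : ℤ} (hp : Prime p)
    (hκ : p ∣ 3 * t ^ 2 + a₄) (h : p ∣ n) : SingularAt a₄ a₆ t n p 1 := by
  refine ⟨hp, one_ne_zero, by simpa using hκ, by simpa using h, fun R hR ↦ ?_⟩
  rw [pow_one] at hR ⊢
  have h1 := alpha_mul_cofactor hn R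
  have : ptB R ^ 2 = alpha t R * cofactor t R - n * ptC R ^ 6 := by linear_combination -h1
  exact hp.dvd_of_dvd_pow (this ▸ dvd_sub (hR.mul_right _) (h.mul_right _))

theorem dvd_cofactor {q : ℤ} {R : RatPoint a₄ a₆} (hκ : q ∣ 3 * t ^ 2 + a₄)
    (hα : q ∣ alpha t R) : q ∣ cofactor t R := by
  have h := kappa_mul (t := t) R
  have : cofactor t R = (3 * t ^ 2 + a₄) * ptC R ^ 4 +
    alpha t R * (alpha t R - 3 * t * ptC R ^ 2) := by linear_combination -h
  rw [this]
  exact dvd_add (hκ.mul_right _) (hα.mul_right _)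

theorem singularAt_three (hn : n = t ^ 3 + a₄ * t - a₆)
    (hκ : 9 ∣ 3 * t ^ 2 + a₄) (h : 81 ∣ n) : SingularAt a₄ a₆ t n 3 2 := by
  refine ⟨Int.prime_three, two_ne_zero, by norm_num; exact hκ,
    by norm_num; exact dvd_trans (by norm_num) h, fun R hR ↦ ?_⟩
  norm_num at hR ⊢
  have h1 := alpha_mul_cofactor hn R
  have h2 := mul_dvd_mul hR (dvd_cofactor hκ hR)
  have : ptB R ^ 2 = alpha t R * cofactor t R - n * ptC R ^ 6 := by linear_combination -h1
  have h3 : (9 : ℤ) ^ 2 ∣ ptB R ^ 2 := this ▸ dvd_sub (by norm_num at h2 ⊢; exact h2)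
    ((by norm_num; exact h : (9 : ℤ) ^ 2 ∣ n).mul_right _)
  exact (Int.pow_dvd_pow_iff two_ne_zero).mp h3

/-- If some point reduces to the singular point `(-t, 0)` modulo `p`, then `p² ∣ n`. -/
theorem sq_dvd_n (hn : n = t ^ 3 + a₄ * t - a₆) {p : ℤ} (hp : Prime p)
    (hκ : p ∣ 3 * t ^ 2 + a₄) (h : p ∣ n) {R : RatPoint a₄ a₆} (hR : p ∣ alpha t R) :
    p ^ 2 ∣ n := by
  have hB := (singularAt_of_prime hn hp hκ h).dvd_ptB R (by simpa using hR)
  rw [pow_one] at hB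
  have h1 := alpha_mul_cofactor hn R
  have hc : IsCoprime (p ^ 2) (ptC R ^ 6) :=
    ((isCoprime_alpha_ptC R).of_isCoprime_of_dvd_left hR).pow
  refine hc.dvd_of_dvd_mul_right ?_
  have : n * ptC R ^ 6 = alpha t R * cofactor t R - ptB R ^ 2 := by linear_combination -h1
  rw [this]
  refine dvd_sub ?_ (pow_dvd_pow_of_dvd hB 2)
  rw [sq]
  exact mul_dvd_mul hR (dvd_cofactor hκ hR)

namespace Box

variable {S : Finset (RatPoint a₄ a₆)}

open Classical in
/-- The forms of one point from each pair `± R` among the points of a symmetric set. -/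
noncomputable def halfForms (t n : ℤ) (U : Finset (RatPoint a₄ a₆)) : Finset BinForm :=
  (U.filter fun R ↦ 0 ≤ ptB R).image (pointForm t n)

theorem isSystem_halfForms (hS : Box a₄ a₆ t n S) {U : Finset (RatPoint a₄ a₆)} (hU : U ⊆ S)
    (hneg : ∀ R ∈ U, -R ∈ U) :
    BinForm.IsSystem (-(4 * n)) (halfForms t n U) ∧ U.card ≤ 2 * (halfForms t n U).card := by
  classical
  have key : ∀ R ∈ U.filter fun R ↦ 0 ≤ ptB R, ∀ R' ∈ U.filter fun R ↦ 0 ≤ ptB R,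
      ∀ γ : SL(2, ℤ), γ • pointForm t n R = pointForm t n R' → R = R' := by
    intro R hR R' hR' γ h
    rw [Finset.mem_filter] at hR hR'
    rcases hS.eq_or_of_smul_pointForm (hU hR.1) (hU hR'.1) h with h1 | ⟨h1, h2, -⟩
    · exact h1.symm
    · have hB := ptB_neg h2
      rw [← h1] at hB
      have h3 : ptB R = ptB R' := by linarith [hR.2, hR'.2]
      exact ext_pt (by rw [h1, ptA_neg]) h3 (by rw [h1, ptC_neg])
  refine ⟨⟨?_, ?_, ?_, ?_⟩, ?_⟩
  · intro f hf
    obtain ⟨R, hR, rfl⟩ := Finset.mem_image.mp hf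
    exact (hS.small_pointForm (hU (Finset.mem_filter.mp hR).1)).a_pos
  · intro f hf
    obtain ⟨R, hR, rfl⟩ := Finset.mem_image.mp hf
    exact (hS.small_pointForm (hU (Finset.mem_filter.mp hR).1)).disc_eq
  · intro f hf
    obtain ⟨R, hR, rfl⟩ := Finset.mem_image.mp hf
    exact (hS.small_pointForm (hU (Finset.mem_filter.mp hR).1)).rigid
  · intro f hf g hg γ h
    obtain ⟨R, hR, rfl⟩ := Finset.mem_image.mp hf
    obtain ⟨R', hR', rfl⟩ := Finset.mem_image.mp hg
    rw [key R hR R' hR' γ h]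
  · rw [halfForms, Finset.card_image_of_injOn
      fun R hR R' hR' h ↦ key R hR R' hR' 1 (by rw [one_smul]; exact h)]
    have hsub : U ⊆ (U.filter fun R ↦ 0 ≤ ptB R) ∪
        (U.filter fun R ↦ 0 ≤ ptB R).image (fun R ↦ -R) := by
      intro R hR
      by_cases h : 0 ≤ ptB R
      · exact Finset.mem_union_left _ (Finset.mem_filter.mpr ⟨hR, h⟩)
      · refine Finset.mem_union_right _ (Finset.mem_image.mpr ⟨-R, ?_, neg_neg R⟩)
        have h0 : R ≠ 0 := by rintro rfl; simp at h
        rw [Finset.mem_filter, ptB_neg h0]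
        exact ⟨hneg R hR, by linarith⟩
    calc U.card ≤ _ := Finset.card_le_card hsub
      _ ≤ _ := Finset.card_union_le _ _
      _ ≤ _ := by rw [two_mul]; exact Nat.add_le_add_left Finset.card_image_le _

theorem neg_mem_filter (hS : Box a₄ a₆ t n S) (p : ℤ → Prop) [DecidablePred p] :
    ∀ R ∈ S.filter (fun R ↦ p (alpha t R)), -R ∈ S.filter (fun R ↦ p (alpha t R)) := by
  intro R hR
  rw [Finset.mem_filter] at hR ⊢
  exact ⟨hS.neg_mem R hR.1, by rw [alpha_neg]; exact hR.2⟩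

theorem two_mul_card_low_le (hS : Box a₄ a₆ t n S) {p : ℤ} {k : ℕ}
    (h : SingularAt a₄ a₆ t n p k) {P : RatPoint a₄ a₆} (hP : P ∈ S) (hα : p ^ k ∣ alpha t P) :
    2 * (S.filter fun R ↦ ¬ p ∣ alpha t R).card ≤
      3 * (S.filter fun R ↦ p ^ k ∣ alpha t R).card := by
  classical
  convert hS.card_low_le (fun R ↦ p ^ k ∣ alpha t R) (fun R ↦ ¬ p ∣ alpha t R)
    (fun R hR ↦ by rwa [alpha_neg])
    (fun R R' hR hR' ↦ h.dvd_alpha_add hS.n_eq hR hR') ⟨P, hP, hα⟩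

/-- If a point of the box meets the singular point modulo a prime `p ≥ 5`, then at least two fifths
of the points do. The forms of these have contents divisible by `p`, and lifting them to primitive
forms multiplies their number by `p`, which outweighs the loss from `R` and `-R` having possibly
equivalent forms. -/
theorem card_le_of_prime (hS : Box a₄ a₆ t n S) {p : ℕ} (hp : p.Prime) (hp5 : 5 ≤ p)
    (hκ : (p : ℤ) ∣ 3 * t ^ 2 + a₄) (hpn : (p : ℤ) ∣ n) {P : RatPoint a₄ a₆} (hP : P ∈ S)
    (hα : (p : ℤ) ∣ alpha t P) : (S.card : ℝ) ≤ hurwitzH (-(4 * n)) := by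
  classical
  have := Fact.mk hp
  have hpZ := Nat.prime_iff_prime_int.mp hp
  have hsing := singularAt_of_prime hS.n_eq hpZ hκ hpn
  have h1 := hS.two_mul_card_low_le hsing hP (by simpa using hα)
  rw [pow_one] at h1
  set U := S.filter fun R ↦ (p : ℤ) ∣ alpha t R
  have h2 : U.card + (S.filter fun R ↦ ¬ (p : ℤ) ∣ alpha t R).card = S.card :=
    Finset.card_filter_add_card_filter_not _
  have hUS : U ⊆ S := Finset.filter_subset _ S
  obtain ⟨h3, h4⟩ := hS.isSystem_halfForms hUS (hS.neg_mem_filter ((p : ℤ) ∣ ·))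
  obtain ⟨m, hm⟩ := sq_dvd_n hS.n_eq hpZ hκ hpn hα
  have hmpos : 0 < m := by
    have := hS.n_pos
    rw [hm] at this
    exact pos_of_mul_pos_right this (sq_nonneg _)
  have e : -(4 * n) = (p : ℤ) ^ 2 * (-(4 * m)) := by rw [hm]; ring
  rw [e] at h3 ⊢
  refine le_trans ?_ (h3.mul_card_le_hurwitzH (p := p) (by omega) (by linarith) ?_)
  · have : S.card ≤ p * (halfForms t n U).card := by nlinarith
    exact_mod_cast this
  · intro f hf
    obtain ⟨R, hR, rfl⟩ := Finset.mem_image.mp hf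
    obtain ⟨hRS, hRα⟩ := Finset.mem_filter.mp (Finset.mem_filter.mp hR).1
    exact contentDvd_pointForm hS.n_eq (hS.alpha_pos hRS).ne' hRα
      (by simpa using hsing.dvd_ptB R (by simpa using hRα)) hκ

/-- The analogue of `card_le_of_prime` for the prime `3`, with points meeting the singular point
modulo `9`: modulo `3` alone, the gain from lifting would be too small. -/
theorem card_le_of_nine (hS : Box a₄ a₆ t n S) (hκ : 9 ∣ 3 * t ^ 2 + a₄) (hn : 81 ∣ n)
    {P : RatPoint a₄ a₆} (hP : P ∈ S) (hα : 9 ∣ alpha t P) :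
    (S.card : ℝ) ≤ hurwitzH (-(4 * n)) := by
  classical
  have hsing := singularAt_three hS.n_eq hκ hn
  have hκ3 : (3 : ℤ) ∣ 3 * t ^ 2 + a₄ := dvd_trans (by norm_num) hκ
  have hn3 : (3 : ℤ) ∣ n := dvd_trans (by norm_num) hn
  have hsing' := singularAt_of_prime hS.n_eq Int.prime_three hκ3 hn3
  have h1 := hS.two_mul_card_low_le hsing hP (by norm_num; exact hα)
  norm_num at h1
  set U₂ := S.filter fun R ↦ (9 : ℤ) ∣ alpha t R with hU₂
  set U₁ := S.filter fun R ↦ (3 : ℤ) ∣ alpha t R ∧ ¬ (9 : ℤ) ∣ alpha t R with hU₁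
  set U₀ := S.filter fun R ↦ ¬ (3 : ℤ) ∣ alpha t R
  have h2 : S.card ≤ U₀.card + U₁.card + U₂.card := by
    have : S ⊆ U₀ ∪ U₁ ∪ U₂ := by
      intro R hR
      simp only [U₀, U₁, U₂, Finset.mem_union, Finset.mem_filter, hR, true_and]
      tauto
    refine (Finset.card_le_card this).trans ((Finset.card_union_le _ _).trans ?_)
    exact Nat.add_le_add_right (Finset.card_union_le _ _) _
  obtain ⟨h3, h4⟩ := hS.isSystem_halfForms (Finset.filter_subset _ S)
    (hS.neg_mem_filter (fun a ↦ 3 ∣ a ∧ ¬ 9 ∣ a))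
  obtain ⟨h5, h6⟩ := hS.isSystem_halfForms (Finset.filter_subset _ S)
    (hS.neg_mem_filter (fun a ↦ 9 ∣ a))
  rw [← hU₁] at h3 h4
  rw [← hU₂] at h5 h6
  obtain ⟨m, hm⟩ := hn
  have hmpos : 0 < m := by
    have := hS.n_pos
    rw [hm] at this
    linarith
  have e : -(4 * n) = 81 * (-(4 * m)) := by rw [hm]; ring
  rw [e] at h3 h5 ⊢
  refine le_trans ?_ (BinForm.IsSystem.card_le_hurwitzH_three h3 h5 (by linarith) ?_ ?_)
  · have : S.card ≤ 2 * (halfForms t n U₁).card + 5 * (halfForms t n U₂).card := by omega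
    exact_mod_cast this
  · intro f hf
    obtain ⟨R, hR, rfl⟩ := Finset.mem_image.mp hf
    obtain ⟨hRS, hRα, hR9⟩ := Finset.mem_filter.mp (Finset.mem_filter.mp hR).1
    exact ⟨contentDvd_pointForm hS.n_eq (hS.alpha_pos hRS).ne' hRα
      (by simpa using hsing'.dvd_ptB R (by simpa using hRα)) hκ3, fun h ↦ hR9 h.1⟩
  · intro f hf
    obtain ⟨R, hR, rfl⟩ := Finset.mem_image.mp hf
    obtain ⟨hRS, hRα⟩ := Finset.mem_filter.mp (Finset.mem_filter.mp hR).1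
    have := hsing.dvd_ptB R (by norm_num; exact hRα)
    norm_num at this
    exact contentDvd_pointForm hS.n_eq (hS.alpha_pos hRS).ne' hRα this hκ

end Box

end Singular

/-! ### Exclusion of coincidences between points whose `α` are related -/

section Exclusion

variable {a₄ a₆ t n : ℤ}

/-- No point of `S` meets the singular point modulo a prime `p ≥ 5`, or modulo `9` when
`81 ∣ n`. -/
structure NoSingular (a₄ a₆ t n : ℤ) (S : Finset (RatPoint a₄ a₆)) : Prop where
  prime : ∀ p : ℕ, p.Prime → 5 ≤ p → (p : ℤ) ∣ 3 * t ^ 2 + a₄ → (p : ℤ) ∣ n →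
    ∀ P ∈ S, ¬ (p : ℤ) ∣ alpha t P
  nine : 9 ∣ 3 * t ^ 2 + a₄ → 81 ∣ n → ∀ P ∈ S, ¬ 9 ∣ alpha t P

theorem NoSingular.eq_one_or_three {S : Finset (RatPoint a₄ a₆)} (h : NoSingular a₄ a₆ t n S)
    {e : ℤ} (he : 0 < e) (hodd : Odd e) {P : RatPoint a₄ a₆} (hP : P ∈ S) (hα : e ∣ alpha t P)
    (hκ : e ∣ 3 * t ^ 2 + a₄) (hn : e ^ 2 ∣ n) : e = 1 ∨ e = 3 := by
  lift e to ℕ using he.le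
  have hpr : ∀ {d : ℕ}, d.Prime → d ∣ e → d = 3 := by
    intro d hd hde
    have hdeZ : (d : ℤ) ∣ e := by exact_mod_cast hde
    by_contra hne
    have h2 : d ≠ 2 := by
      rintro rfl
      rw [Int.odd_iff] at hodd
      omega
    have h5 : 5 ≤ d := by
      by_contra! hlt
      have := hd.two_le
      interval_cases d <;> first | omega | (revert hd; norm_num)
    exact h.prime d hd h5 (hdeZ.trans hκ) ((hdeZ.trans (dvd_pow_self _ two_ne_zero)).trans hn) P hP
      (hdeZ.trans hα)
  have hpow := Nat.eq_prime_pow_of_unique_prime_dvd (by omega : e ≠ 0) hpr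
  set k := e.primeFactorsList.length
  rcases Nat.lt_or_ge k 2 with hk | hk
  · interval_cases k <;> simp_all
  · exfalso
    have h9 : (9 : ℤ) ∣ e := by
      have : 3 ^ 2 ∣ e := by rw [hpow]; exact pow_dvd_pow 3 hk
      exact_mod_cast this
    have h81 : (81 : ℤ) ∣ n := by
      have := pow_dvd_pow_of_dvd h9 2
      norm_num at this
      exact this.trans hn
    exact h.nine (h9.trans hκ) h81 P hP (h9.trans hα)

namespace Box

variable {S : Finset (RatPoint a₄ a₆)}

theorem double_lt (hS : Box a₄ a₆ t n S) {P : RatPoint a₄ a₆} (hP : P ∈ S) :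
    ptHeight (P + P) * (t + 1) ^ 4 < n ^ 2 := by
  have := hS.pair_lt P hP P hP
  rwa [sub_self, ptHeight_zero, mul_one] at this

theorem ptC_pow_four_lt (hS : Box a₄ a₆ t n S) {P : RatPoint a₄ a₆} (hP : P ∈ S) :
    ptC P ^ 4 * (t + 1) ^ 2 < n := by
  have h1 := hS.height_lt P hP
  have h2 := pow_le_pow_left₀ (sq_nonneg _) (ptC_sq_le P) 2
  have : ptC P ^ 4 = (ptC P ^ 2) ^ 2 := by ring
  rw [this]
  nlinarith [sq_nonneg (t + 1)]

theorem abs_sq_lt (hS : Box a₄ a₆ t n S) {P : RatPoint a₄ a₆} (hP : P ∈ S) :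
    ptA P ^ 2 * (t + 1) ^ 2 < n := by
  have h1 := hS.height_lt P hP
  have h2 := pow_le_pow_left₀ (abs_nonneg _) (abs_ptA_le P) 2
  rw [sq_abs] at h2
  nlinarith [sq_nonneg (t + 1)]

theorem abs_lt (hS : Box a₄ a₆ t n S) {P : RatPoint a₄ a₆} (hP : P ∈ S) :
    -t < 2 * ptA P ∧ 2 * ptA P < t := by
  have h1 := abs_le.mp (abs_ptA_le P)
  have h2 := hS.two_mul_height_lt hP
  constructor <;> linarith

/-- A point with `α = 2` exists only in the smallest case `t = 3`. -/
theorem of_alpha_eq_two (hS : Box a₄ a₆ t n S) {R : RatPoint a₄ a₆} (hR : R ∈ S)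
    (h2 : alpha t R = 2) : R ≠ 0 ∧ t = 3 ∧ ptA R = -1 ∧ ptC R = 1 := by
  have ht := hS.three_le_t
  have h0 : R ≠ 0 := by rintro rfl; rw [alpha_zero] at h2; norm_num at h2
  have h1 := hS.lt_two_mul_alpha hR h0
  have ht3 : t = 3 := by omega
  subst ht3
  have h3 := hS.lt_alpha hR
  have hC : ptC R = 1 := by
    have := ptC_pos h0
    rw [h2] at h3
    nlinarith
  refine ⟨h0, rfl, ?_, hC⟩
  rw [alpha, hC] at h2
  linarith

theorem ptB_eq_zero_of_alpha_eq_two (hS : Box a₄ a₆ t n S) {R : RatPoint a₄ a₆} (hR : R ∈ S)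
    (h2 : alpha t R = 2) : ptB R = 0 := by
  by_contra hB
  obtain ⟨h0, rfl, hA, hC⟩ := hS.of_alpha_eq_two hR h2
  obtain ⟨h3, h4⟩ := ptA_double_mul h0 hB
  have h5 := hS.double_lt hR
  have h6 := hS.n_lt
  have h7 := hS.lt_n
  have hn := hS.n_eq
  have heq := pt_equation R
  have h8 := ptC_pos h3
  have h9 := ptC_sq_le (R + R)
  have h10 := (abs_le.mp (abs_ptA_le (R + R))).2
  rw [hA, hC] at h4 heq
  norm_num at h5 h6 h7 h4 heq
  set A := ptA (R + R)
  set c := ptC (R + R)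
  set b := ptB R
  set M := ptHeight (R + R)
  have hM : M ≤ 5 := by nlinarith
  have hb : 0 < b ^ 2 := by positivity
  have hA' : A * (4 * b ^ 2) = c ^ 2 * ((3 + a₄) ^ 2 + 8 * b ^ 2) := by linarith
  have h11 : 2 * c ^ 2 ≤ A := by
    have : 2 * c ^ 2 * (4 * b ^ 2) ≤ A * (4 * b ^ 2) := by
      rw [hA']; nlinarith [mul_nonneg (sq_nonneg c) (sq_nonneg (3 + a₄))]
    exact le_of_mul_le_mul_right this (by positivity)
  have hc : c = 1 := by nlinarith
  rw [hc] at hA' h11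
  have hn' : n - 20 + b ^ 2 = 2 * (3 + a₄) := by rw [hn, heq]; ring
  have hsq : (n - 20 + b ^ 2) ^ 2 = 16 * (A - 2) * b ^ 2 := by rw [hn']; linarith
  have hA5 : A ≤ 5 := h10.trans hM
  have hA256 : A * 256 < n ^ 2 := by nlinarith
  have h2A : 2 ≤ A := by linarith
  have hlow : 20 + 4 * (A - 2) < n := by
    interval_cases A <;> nlinarith
  nlinarith [sq_nonneg (n - 20 - b ^ 2), mul_pos (sub_pos.mpr hlow) hb]

/-- A congruence modulo the square of a common divisor of `α` and `B`. -/
theorem sq_dvd_of_dvd (hS : Box a₄ a₆ t n S) {P : RatPoint a₄ a₆} {a : ℤ} (ha : a ∣ alpha t P)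
    (hB : a ∣ ptB P) : a ^ 2 ∣ n * ptC P ^ 2 - alpha t P * (3 * t ^ 2 + a₄) := by
  have hc : IsCoprime (a ^ 2) (ptC P ^ 4) :=
    ((isCoprime_alpha_ptC P).of_isCoprime_of_dvd_left ha).pow
  refine hc.dvd_of_dvd_mul_right ?_
  have h1 := alpha_mul_cofactor hS.n_eq P
  have h2 := kappa_mul (t := t) P
  have e : (n * ptC P ^ 2 - alpha t P * (3 * t ^ 2 + a₄)) * ptC P ^ 4 =
      alpha t P ^ 2 * (alpha t P - 3 * t * ptC P ^ 2) - ptB P ^ 2 := by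
    linear_combination -h1 - alpha t P * h2
  rw [e]
  exact dvd_sub ((pow_dvd_pow_of_dvd ha 2).mul_right _) (pow_dvd_pow_of_dvd hB 2)

/-- The case `t = 5`, `x(P) = -2`, `x(R) = 1` of `not_alpha_double`: the heights of `R + P` and
`R - P` are too large. -/
theorem not_of_five (hS : Box a₄ a₆ 5 n S) {P R : RatPoint a₄ a₆} (hP : P ∈ S) (hR : R ∈ S)
    (hAP : ptA P = -2) (hCP1 : ptC P = 1) (hAR : ptA R = 1) (hCR1 : ptC R = 1)
    (hBP : 3 ∣ ptB P) (hBR : 3 ∣ ptB R) : False := by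
  have hP0 : P ≠ 0 := by rintro rfl; simp at hCP1
  have hR0 : R ≠ 0 := by rintro rfl; simp at hCR1
  obtain ⟨b, hb⟩ := hBP
  obtain ⟨b', hb'⟩ := hBR
  have e1 := pt_equation P
  have e2 := pt_equation R
  have hn := hS.n_eq
  rw [hb, hAP, hCP1] at e1
  rw [hb', hAR, hCR1] at e2
  have hlow := hS.abs_sq_lt hP
  rw [hAP] at hlow
  have hne : ptA R * ptC P ^ 2 ≠ ptA P * ptC R ^ 2 := by rw [hAP, hAR, hCP1, hCR1]; norm_num
  have hne' : ptA R * ptC (-P) ^ 2 ≠ ptA (-P) * ptC R ^ 2 := by rwa [ptA_neg, ptC_neg]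
  obtain ⟨hs0, hs⟩ := ptA_add_mul hR0 hP0 hne
  obtain ⟨hd0, hd⟩ := ptA_add_mul hR0 (neg_ne_zero.mpr hP0) hne'
  rw [← sub_eq_add_neg] at hd hd0
  rw [ptA_neg, ptB_neg hP0, ptC_neg] at hd
  rw [hAP, hAR, hCP1, hCR1, hb, hb'] at hs hd
  have hpair := hS.pair_lt R hR P hP
  have hA5 := (abs_le.mp (abs_ptA_le (R + P))).2
  have hA6 := (abs_le.mp (abs_ptA_le (R - P))).2
  have hC5 := BinForm.one_le_sq_of_ne_zero (ptC_pos hs0).ne'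
  have hC6 := BinForm.one_le_sq_of_ne_zero (ptC_pos hd0).ne'
  have f1 : ptA (R + P) = ptC (R + P) ^ 2 * ((b' - b) ^ 2 + 1) := by linarith
  have f2 : ptA (R - P) = ptC (R - P) ^ 2 * ((b' + b) ^ 2 + 1) := by linarith
  have g1 : (b' - b) ^ 2 + 1 ≤ ptHeight (R + P) := by nlinarith [sq_nonneg (b' - b)]
  have g2 : (b' + b) ^ 2 + 1 ≤ ptHeight (R - P) := by nlinarith [sq_nonneg (b' + b)]
  have g3 : ((b' - b) ^ 2 + 1) * ((b' + b) ^ 2 + 1) ≤ ptHeight (R + P) * ptHeight (R - P) :=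
    mul_le_mul g1 g2 (by positivity) (by linarith [one_le_ptHeight (R + P)])
  have hnk : n = 108 + 9 * (b' ^ 2 - 2 * b ^ 2) := by linarith
  have hk : 5 ≤ b' ^ 2 - 2 * b ^ 2 := by omega
  norm_num at hpair
  have g4 : ((b' - b) ^ 2 + 1) * ((b' + b) ^ 2 + 1) * 1296 < n ^ 2 := by linarith
  obtain ⟨k, hk'⟩ : ∃ k, k = b' ^ 2 - 2 * b ^ 2 := ⟨_, rfl⟩
  rw [← hk'] at hnk hk
  have e3 : ((b' - b) ^ 2 + 1) * ((b' + b) ^ 2 + 1) =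
      (b ^ 2 + k) ^ 2 + 6 * b ^ 2 + 2 * k + 1 := by rw [hk']; ring
  rw [e3, hnk] at g4
  nlinarith [sq_nonneg b, mul_nonneg (sq_nonneg b) (by linarith : (0 : ℤ) ≤ k)]

/-- Points `P` and `R` of the box with `α(R) = 2 α(P)` and `α(P)` odd cannot both have `B` divisible
by `α(P)`, unless `P = 0` and `R` is two-torsion. -/
theorem not_alpha_double (hS : Box a₄ a₆ t n S) (hN : NoSingular a₄ a₆ t n S)
    {P R : RatPoint a₄ a₆} (hP : P ∈ S) (hR : R ∈ S) (hodd : Odd (alpha t P))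
    (h2 : alpha t R = 2 * alpha t P) (hBP : alpha t P ∣ ptB P) (hBR : alpha t P ∣ ptB R)
    (h : P ≠ 0 ∨ ptB R ≠ 0) : False := by
  have ht := hS.three_le_t
  rcases eq_or_ne P 0 with rfl | hP0
  · rw [alpha_zero, mul_one] at h2
    exact (h.resolve_left (by simp)) (hS.ptB_eq_zero_of_alpha_eq_two hR h2)
  have hR0 : R ≠ 0 := by
    rintro rfl
    rw [alpha_zero] at h2
    omega
  have hα := hS.alpha_pos hP
  obtain ⟨hA1, hA2⟩ := hS.abs_lt hP
  obtain ⟨hA3, hA4⟩ := hS.abs_lt hR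
  have hrel : ptA R - 2 * ptA P = t * (2 * ptC P ^ 2 - ptC R ^ 2) := by
    simp only [alpha] at h2; linarith
  have hd1 : 2 * ptC P ^ 2 - ptC R ^ 2 < 2 := by
    have : t * (2 * ptC P ^ 2 - ptC R ^ 2) < t * 2 := by linarith
    exact lt_of_mul_lt_mul_left this hS.t_pos.le
  have hd2 : -2 < 2 * ptC P ^ 2 - ptC R ^ 2 := by
    have : t * -2 < t * (2 * ptC P ^ 2 - ptC R ^ 2) := by linarith
    exact lt_of_mul_lt_mul_left this hS.t_pos.le
  have hCR : Odd (ptC R) := by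
    by_contra hev
    rw [Int.not_odd_iff_even] at hev
    have h1 : IsCoprime (alpha t R) (ptC R) := isCoprime_alpha_ptC R
    have := h1.isUnit_of_dvd' (x := 2) (by rw [h2]; exact dvd_mul_right _ _) hev.two_dvd
    rw [Int.isUnit_iff] at this
    omega
  have hd3 : 2 * ptC P ^ 2 - ptC R ^ 2 = 1 ∨ 2 * ptC P ^ 2 - ptC R ^ 2 = -1 := by
    have : Odd (ptC R ^ 2) := hCR.pow
    rw [Int.odd_iff] at this
    omega
  -- The two congruences force `α² ∣ n` and `α ∣ κ`.
  have c1 := hS.sq_dvd_of_dvd dvd_rfl hBP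
  have c2 := hS.sq_dvd_of_dvd (by rw [h2]; exact dvd_mul_left _ _) hBR
  have hn2 : alpha t P ^ 2 ∣ n := by
    have e : n * (2 * ptC P ^ 2 - ptC R ^ 2) =
        2 * (n * ptC P ^ 2 - alpha t P * (3 * t ^ 2 + a₄)) -
          (n * ptC R ^ 2 - alpha t R * (3 * t ^ 2 + a₄)) := by rw [h2]; ring
    have := e ▸ dvd_sub (c1.mul_left 2) c2
    rcases hd3 with h | h <;> rw [h] at this <;> simpa using this
  have hκ : alpha t P ∣ 3 * t ^ 2 + a₄ := by
    have e : alpha t P * (3 * t ^ 2 + a₄) =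
      n * ptC P ^ 2 - (n * ptC P ^ 2 - alpha t P * (3 * t ^ 2 + a₄)) := by ring
    have := dvd_sub (hn2.mul_right (ptC P ^ 2)) c1
    rw [← e, sq] at this
    exact (mul_dvd_mul_iff_left hα.ne').mp this
  have h3 : alpha t P = 3 := by
    rcases hN.eq_one_or_three hα hodd hP dvd_rfl hκ hn2 with h | h
    · have := hS.lt_two_mul_alpha hP hP0
      omega
    · exact h
  -- Only `t = 5`, `x(P) = -2`, `x(R) = 1` is left.
  have hCP1 : ptC P = 1 := by
    have h4 := hS.lt_alpha hP
    have := ptC_pos hP0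
    rw [h3] at h4
    by_contra hne
    have : 2 ≤ ptC P := by omega
    have : 4 ≤ ptC P ^ 2 := by nlinarith
    nlinarith
  have hCR1 : ptC R = 1 := by
    have := ptC_pos hR0
    rw [hCP1] at hd3
    nlinarith
  have ht5 : t = 5 ∧ ptA P = -2 ∧ ptA R = 1 := by
    rw [hCP1, hCR1] at hrel
    have h4 := h3
    have := hS.lt_two_mul_alpha hP hP0
    rw [alpha, hCP1] at h4
    omega
  obtain ⟨rfl, hAP, hAR⟩ := ht5
  rw [h3] at hBP hBR
  exact hS.not_of_five hP hR hAP hCP1 hAR hCR1 hBP hBR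

/-- If `α = e a` divides `B ≠ 0` and `n = 2 α · e a'` with `a`, `a'` coprime, then `(a C)²` divides
the denominator of `x(2P)`, which bounds `a C`. -/
theorem mul_ptC_lt (hS : Box a₄ a₆ t n S) {P : RatPoint a₄ a₆} (hP : P ∈ S) (hP0 : P ≠ 0)
    (hB0 : ptB P ≠ 0) (hB : alpha t P ∣ ptB P) {e a a' : ℤ} (he : alpha t P = e * a)
    (hn : n = 2 * (e * a) * (e * a')) (hodd : Odd a) (hc : IsCoprime a a') :
    a * ptC P * (t + 1) ^ 2 < n := by
  have hα := hS.alpha_pos hP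
  obtain ⟨b, hb⟩ := hB
  obtain ⟨h0, h1⟩ := ptA_double_mul hP0 hB0
  have hC := ptC_pos hP0
  have hG := alpha_mul_cofactor hS.n_eq P
  have hκ := kappa_mul (t := t) P
  have hcαC : IsCoprime (alpha t P) (ptC P) := isCoprime_alpha_ptC P
  have hb0 : b ≠ 0 := by rintro rfl; rw [mul_zero] at hb; exact hB0 hb
  -- `K` is the numerator of `f'(x) / 2y` corrected by a multiple of the denominator.
  set K := a * (b ^ 2 + 3 * t * ptC P ^ 2 - 2 * alpha t P) - 2 * a' * ptC P ^ 6 with hK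
  have hG' : cofactor t P = alpha t P * b ^ 2 + 2 * (e * a') * ptC P ^ 6 := by
    apply mul_left_cancel₀ hα.ne'
    rw [hG, hb, hn, he]; ring
  have hf' : 3 * ptA P ^ 2 + a₄ * ptC P ^ 4 =
      e * (a * (b ^ 2 - 3 * t * ptC P ^ 2 + 2 * alpha t P) + 2 * a' * ptC P ^ 6) := by
    have e1 : 3 * ptA P ^ 2 + a₄ * ptC P ^ 4 = 3 * alpha t P ^ 2 - 6 * t * alpha t P * ptC P ^ 2 +
        (3 * t ^ 2 + a₄) * ptC P ^ 4 := by simp only [alpha]; ring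
    rw [e1, hκ, hG']
    linear_combination (b ^ 2 - 3 * t * ptC P ^ 2 + 2 * alpha t P) * he
  have hA : ptA P = alpha t P - t * ptC P ^ 2 := by simp only [alpha]; ring
  have hnum : alpha t (P + P) * (4 * (a * ptC P) ^ 2 * b ^ 2) =
      ptC (P + P) ^ 2 * (K ^ 2 + 8 * a * a' * b ^ 2 * ptC P ^ 6) := by
    have he0 : e ≠ 0 := by rintro rfl; rw [zero_mul] at he; exact hα.ne' he
    apply mul_left_cancel₀ (pow_ne_zero 2 he0)
    rw [hf', hb] at h1
    have e2 : alpha t (P + P) = ptA (P + P) + t * ptC (P + P) ^ 2 := rfl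
    rw [e2, hK]
    rw [hA, he] at h1
    rw [he]
    linear_combination h1
  have hac : IsCoprime a (ptC P) := hcαC.of_isCoprime_of_dvd_left ⟨e, by rw [he]; ring⟩
  have hcopK_a : IsCoprime a K := by
    have h2 : IsCoprime a 2 := (Int.isCoprime_iff_gcd_eq_one.mpr
      (Int.isCoprime_iff_gcd_eq_one.mp (Int.isCoprime_two_right.mpr hodd)))
    have h3 : IsCoprime a (2 * a' * ptC P ^ 6) := (h2.mul_right hc).mul_right hac.pow_right
    have h4 := h3.neg_right
    rw [hK, show a * (b ^ 2 + 3 * t * ptC P ^ 2 - 2 * alpha t P) - 2 * a' * ptC P ^ 6 =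
      -(2 * a' * ptC P ^ 6) + a * (b ^ 2 + 3 * t * ptC P ^ 2 - 2 * alpha t P) by ring]
    exact (IsCoprime.add_mul_left_right_iff).mpr h4
  have hcopK_C : IsCoprime (ptC P) K := by
    -- Modulo `C` one has `b² ≡ α`, hence `K ≡ -a α`.
    obtain ⟨m, hm⟩ : ptC P ∣ b ^ 2 - alpha t P := by
      have h5 : IsCoprime (ptC P) (alpha t P ^ 2) := hcαC.symm.pow_right
      refine h5.dvd_of_dvd_mul_left ?_
      have e3 : alpha t P ^ 2 * (b ^ 2 - alpha t P) = ptC P * (alpha t P *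
          ((3 * t ^ 2 + a₄) * ptC P ^ 3 - 3 * t * ptC P * alpha t P) - n * ptC P ^ 5) := by
        rw [hb] at hG
        linear_combination alpha t P * -hκ - hG
      exact ⟨_, e3⟩
    have h6 : IsCoprime (ptC P) (-(a * alpha t P)) := (hac.symm.mul_right hcαC.symm).neg_right
    have e4 : K = -(a * alpha t P) + ptC P * (a * m + 3 * a * t * ptC P - 2 * a' * ptC P ^ 5) := by
      rw [hK]; linear_combination a * hm
    rw [e4]
    exact (IsCoprime.add_mul_left_right_iff).mpr h6
  have hcopN : IsCoprime (a * ptC P) (K ^ 2 + 8 * a * a' * b ^ 2 * ptC P ^ 6) := by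
    have h7 : IsCoprime (a * ptC P) (K ^ 2) := (hcopK_a.mul_left hcopK_C).pow_right
    rw [show K ^ 2 + 8 * a * a' * b ^ 2 * ptC P ^ 6 =
      K ^ 2 + (a * ptC P) * (8 * a' * b ^ 2 * ptC P ^ 5) by ring]
    exact (IsCoprime.add_mul_left_right_iff).mpr h7
  have hdvd : (a * ptC P) ^ 2 ∣ ptC (P + P) ^ 2 := by
    refine (hcopN.pow_left (m := 2)).dvd_of_dvd_mul_right (y := _) ?_
    rw [← hnum]
    exact ⟨alpha t (P + P) * 4 * b ^ 2, by ring⟩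
  have hle : (a * ptC P) ^ 2 ≤ ptHeight (P + P) :=
    (Int.le_of_dvd (by have := ptC_pos h0; positivity) hdvd).trans (ptC_sq_le _)
  have hdbl := hS.double_lt hP
  have h8 : (a * ptC P * (t + 1) ^ 2) ^ 2 < n ^ 2 := by
    have : (a * ptC P) ^ 2 * (t + 1) ^ 4 ≤ ptHeight (P + P) * (t + 1) ^ 4 := by gcongr
    calc _ = (a * ptC P) ^ 2 * (t + 1) ^ 4 := by ring
      _ < n ^ 2 := by linarith
  exact lt_of_pow_lt_pow_left₀ 2 hS.n_pos.le h8

/-- The `x`-coordinate of the translate of `P` by a two-torsion point `T`. -/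
theorem alpha_add_torsion (hn : n = t ^ 3 + a₄ * t - a₆) {P T : RatPoint a₄ a₆} (hP : P ≠ 0)
    (hT : T ≠ 0) (hBT : ptB T = 0) (hCT : ptC T = 1)
    (hprod : n = 2 * alpha t P * alpha t T) (hαT : alpha t T ≠ 0)
    (hne : alpha t P - alpha t T * ptC P ^ 2 ≠ 0) :
    alpha t (P + T) * (alpha t P - alpha t T * ptC P ^ 2) ^ 2 * alpha t P =
      ptC (P + T) ^ 2 * (2 * ptC P ^ 2 * (alpha t P - alpha t T * ptC P ^ 2) ^ 2 * alpha t P +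
        alpha t T * ptB P ^ 2) := by
  have hne' : ptA P * ptC T ^ 2 ≠ ptA T * ptC P ^ 2 := by
    intro h
    apply hne
    rw [hCT] at h
    simp only [alpha, hCT]
    linear_combination h
  have h1 := alpha_add_mul hn hP hT hne'
  have hGT := alpha_mul_cofactor hn T
  have hκT := kappa_mul (t := t) T
  have hG := alpha_mul_cofactor hn P
  have hκ := kappa_mul (t := t) P
  rw [hBT, hCT] at h1 hGT
  rw [hCT] at hκT
  have hGT' : cofactor t T = 2 * alpha t P := by
    apply mul_left_cancel₀ hαT
    rw [hGT, hprod]; ring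
  rw [hGT'] at hκT
  simp only [one_pow, mul_one, mul_zero] at h1 hκT
  rw [h1, hprod]
  have e2 : ptB P ^ 2 = alpha t P * ((3 * t ^ 2 + a₄) * ptC P ^ 4 -
      3 * t * ptC P ^ 2 * alpha t P + alpha t P ^ 2) - 2 * alpha t P * alpha t T * ptC P ^ 6 := by
    rw [hprod] at hG
    linear_combination -hG - alpha t P * hκ
  rw [e2]
  linear_combination (ptC (P + T) ^ 2 * alpha t P ^ 2 * ptC P ^ 2) * hκT

theorem two_mul_alpha_lt (hS : Box a₄ a₆ t n S) {P : RatPoint a₄ a₆} (hP : P ∈ S) :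
    2 * alpha t P < t * (2 * ptC P ^ 2 + 1) := by
  have h1 := (hS.abs_lt hP).2
  simp only [alpha]; linarith

theorem ptC_eq_one_of_ptB_eq_zero {T : RatPoint a₄ a₆} (hB : ptB T = 0) : ptC T = 1 := by
  have h1 := pt_equation T
  have h2 : ptC T ∣ ptA T ^ 3 := by
    refine ⟨-(a₄ * ptA T * ptC T ^ 3 + a₆ * ptC T ^ 5), ?_⟩
    rw [hB] at h1
    linear_combination -h1
  have h3 := (isCoprime_ptA_ptC T).symm.pow_right.isUnit_of_dvd' dvd_rfl h2
  have h4 := ptC_nonneg T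
  rw [Int.isUnit_iff] at h3
  omega

/-- If `3` divides the odd numbers `α ≠ α'` and both denominators are `1`, then the numerators
differ by a multiple of `6`, so that one of them is at least `3` in absolute value. -/
theorem lt_n_of_three_dvd (hS : Box a₄ a₆ t n S) {P R : RatPoint a₄ a₆} (hP : P ∈ S) (hR : R ∈ S)
    (hoP : Odd (alpha t P)) (hoR : Odd (alpha t R)) (hne : alpha t P ≠ alpha t R)
    (h3P : 3 ∣ alpha t P) (h3R : 3 ∣ alpha t R) (hCP : ptC P = 1) (hCR : ptC R = 1) :
    9 * (t + 1) ^ 2 < n ∧ 7 ≤ t := by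
  have h1 := hS.abs_sq_lt hP
  have h2 := hS.abs_sq_lt hR
  have h3 := hS.abs_lt hP
  have h4 := hS.abs_lt hR
  simp only [alpha, hCP, hCR, Int.odd_iff] at hoP hoR hne h3P h3R
  have h5 : (ptA P ≤ -3 ∨ 3 ≤ ptA P) ∨ (ptA R ≤ -3 ∨ 3 ≤ ptA R) := by omega
  have key : ∀ A : ℤ, (A ≤ -3 ∨ 3 ≤ A) → A ^ 2 * (t + 1) ^ 2 < n → 9 * (t + 1) ^ 2 < n := by
    intro A hA h
    have : 9 ≤ A ^ 2 := by rcases hA with hA | hA <;> nlinarith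
    nlinarith [sq_nonneg (t + 1)]
  exact ⟨h5.elim (fun h ↦ key _ h h1) (fun h ↦ key _ h h2), by omega⟩

/-- The heights of the doubles exclude two distinct ambiguous points that are not two-torsion with
`n = 2 α α'`. -/
theorem not_two_mul_alpha_mul_of_ne (hS : Box a₄ a₆ t n S) {P R : RatPoint a₄ a₆} (hP : P ∈ S)
    (hR : R ∈ S) (hP0 : P ≠ 0) (hR0 : R ≠ 0) (hoP : Odd (alpha t P)) (hoR : Odd (alpha t R))
    (hne : alpha t P ≠ alpha t R)
    (hBP : alpha t P ∣ ptB P) (hBR : alpha t R ∣ ptB R) (hBP0 : ptB P ≠ 0) (hBR0 : ptB R ≠ 0)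
    {e a a' : ℤ} (he : e = 1 ∨ e = 3) (ha : alpha t P = e * a) (ha' : alpha t R = e * a')
    (hc : IsCoprime a a') (hn : n = 2 * alpha t P * alpha t R) : False := by
  have hαP := hS.alpha_pos hP
  have hαR := hS.alpha_pos hR
  have he0 : 0 < e := by rcases he with rfl | rfl <;> norm_num
  have ha0 : 0 < a := pos_of_mul_pos_right (ha ▸ hαP) he0.le
  have ha0' : 0 < a' := pos_of_mul_pos_right (ha' ▸ hαR) he0.le
  have h1 := hS.mul_ptC_lt hP hP0 hBP0 hBP ha (by rw [hn, ha, ha'])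
    (Int.Odd.of_mul_right (ha ▸ hoP)) hc
  have h2 := hS.mul_ptC_lt hR hR0 hBR0 hBR ha' (a' := a) (by rw [hn, ha, ha']; ring)
    (Int.Odd.of_mul_right (ha' ▸ hoR)) hc.symm
  have hC := ptC_pos hP0
  have hC' := ptC_pos hR0
  have ht := hS.t_pos
  have hnpos := hS.n_pos
  have hlt := hS.n_lt
  have hC4 := hS.ptC_pow_four_lt hP
  have hC4' := hS.ptC_pow_four_lt hR
  have hα2 := hS.two_mul_alpha_lt hP
  have hα2' := hS.two_mul_alpha_lt hR
  have hfin := hS.lt_n_of_three_dvd hP hR hoP hoR hne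
  set C := ptC P
  set C' := ptC R
  have h3 : C * C' * (t + 1) ^ 4 < 2 * e ^ 2 * n := by
    have h4 : (a * C * (t + 1) ^ 2) * (a' * C' * (t + 1) ^ 2) < n * n :=
      mul_lt_mul'' h1 h2 (by positivity) (by positivity)
    have h5 : n * n = 2 * e ^ 2 * n * (a * a') := by nth_rw 1 [hn]; rw [ha, ha']; ring
    rw [h5] at h4
    refine lt_of_mul_lt_mul_right (a := a * a') ?_ (by positivity)
    linarith
  have hCC : 1 ≤ C * C' := by nlinarith
  rcases he with rfl | rfl
  · have : (t + 1) ^ 4 ≤ C * C' * (t + 1) ^ 4 := le_mul_of_one_le_left (by positivity) hCC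
    nlinarith [mul_pos ht ht, sq_nonneg (t + 1)]
  · have h4 : (2 * (C * C')) * (t + 1) ^ 2 < 9 * (t + 1) ^ 2 := by
      have : (2 * (C * C')) * (t + 1) ^ 2 * (t + 1) ^ 2 < 9 * t ^ 2 * (t + 1) ^ 2 := by linarith
      have := lt_of_mul_lt_mul_right this (sq_nonneg _)
      nlinarith
    have h5 : 2 * (C * C') < 9 := lt_of_mul_lt_mul_right h4 (sq_nonneg _)
    have h6 : 2 * n < t ^ 2 * ((2 * C ^ 2 + 1) * (2 * C' ^ 2 + 1)) := by
      have : (2 * alpha t P) * (2 * alpha t R) < (t * (2 * C ^ 2 + 1)) * (t * (2 * C' ^ 2 + 1)) :=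
        mul_lt_mul'' hα2 hα2' (by positivity) (by positivity)
      rw [hn]; linarith
    have hb : C ≤ 4 := by nlinarith
    have hb' : C' ≤ 4 := by nlinarith
    have h11 := hfin ⟨a, ha⟩ ⟨a', ha'⟩
    clear hfin hα2 hα2' h1 h2
    generalize C = c at *
    generalize C' = c' at *
    have ht2 := sq_nonneg t
    interval_cases c <;> interval_cases c' <;>
      first | omega | nlinarith [(h11 rfl rfl).1] | nlinarith

/-- Translation by a two-torsion point `T` excludes a further ambiguous point `P` with
`n = 2 α(P) α(T)`. -/
theorem not_two_mul_alpha_mul_of_torsion (hS : Box a₄ a₆ t n S) {P T : RatPoint a₄ a₆}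
    (hP : P ∈ S) (hT : T ∈ S) (hP0 : P ≠ 0) (hT0 : T ≠ 0) (hoP : Odd (alpha t P))
    (hoT : Odd (alpha t T)) (hne : alpha t P ≠ alpha t T)
    (hBP : alpha t P ∣ ptB P) (hBP0 : ptB P ≠ 0) (hBT : ptB T = 0)
    {e a a' : ℤ} (he : e = 1 ∨ e = 3) (ha : alpha t P = e * a) (ha' : alpha t T = e * a')
    (hc : IsCoprime a a') (hn : n = 2 * alpha t P * alpha t T) : False := by
  have hαP := hS.alpha_pos hP
  have hαT := hS.alpha_pos hT
  have he0 : 0 < e := by rcases he with rfl | rfl <;> norm_num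
  have ha0 : 0 < a := pos_of_mul_pos_right (ha ▸ hαP) he0.le
  have ha0' : 0 < a' := pos_of_mul_pos_right (ha' ▸ hαT) he0.le
  have hCT := ptC_eq_one_of_ptB_eq_zero hBT
  have hcop : IsCoprime (alpha t P) (ptC P) := isCoprime_alpha_ptC P
  have hC := ptC_pos hP0
  obtain ⟨b, hb⟩ := hBP
  have hb0 : b ≠ 0 := by rintro rfl; rw [mul_zero] at hb; exact hBP0 hb
  have hd : a - a' * ptC P ^ 2 ≠ 0 := by
    intro h
    have h1 : ptC P ^ 2 ∣ alpha t P := ⟨e * a', by rw [ha]; linear_combination e * h⟩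
    have h2 := hcop.isUnit_of_dvd' ((dvd_pow_self _ two_ne_zero).trans h1) dvd_rfl
    rw [Int.isUnit_iff] at h2
    have h3 : ptC P = 1 := by omega
    rw [h3] at h
    exact hne (by rw [ha, ha']; linear_combination e * h)
  have key := alpha_add_torsion hS.n_eq hP0 hT0 hBT hCT hn hαT.ne' (by
    rw [ha, ha', show e * a - e * a' * ptC P ^ 2 = e * (a - a' * ptC P ^ 2) by ring]
    exact mul_ne_zero he0.ne' hd)
  have hmem : P + T ∈ S := hS.add_mem P hP T (add_self_eq_zero_of_ptB hBT)
  have hsq := hS.alpha_sq_lt hmem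
  have hαpos := hS.alpha_pos hmem
  have hcop' : IsCoprime (alpha t (P + T)) (ptC (P + T)) := isCoprime_alpha_ptC _
  set Q := P + T
  set d := a - a' * ptC P ^ 2 with hd'
  have key' : alpha t Q * d ^ 2 = ptC Q ^ 2 * (2 * ptC P ^ 2 * d ^ 2 + a * a' * b ^ 2) := by
    apply mul_left_cancel₀ (mul_ne_zero (pow_ne_zero 2 he0.ne') hαP.ne')
    rw [hb, ha, ha', show e * a - e * a' * ptC P ^ 2 = e * d by rw [hd']; ring] at key
    rw [ha]
    linear_combination key
  obtain ⟨m, hm⟩ : ptC Q ∣ d := by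
    have : ptC Q ^ 2 ∣ d ^ 2 :=
      (hcop'.symm.pow_left (m := 2)).dvd_of_dvd_mul_left (Dvd.intro _ key'.symm)
    exact (Int.pow_dvd_pow_iff two_ne_zero).mp this
  have hCQ0 : ptC Q ≠ 0 := by intro h; rw [h, zero_mul] at hm; exact hd hm
  have hm0 : m ≠ 0 := by rintro rfl; rw [mul_zero] at hm; exact hd hm
  have key2 : alpha t Q * m ^ 2 = 2 * ptC P ^ 2 * ptC Q ^ 2 * m ^ 2 + a * a' * b ^ 2 := by
    apply mul_left_cancel₀ (pow_ne_zero 2 hCQ0)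
    rw [hm] at key'
    linear_combination key'
  have hcad : IsCoprime (a * a') d := by
    have hac : IsCoprime a (ptC P) := hcop.of_isCoprime_of_dvd_left ⟨e, by rw [ha]; ring⟩
    refine IsCoprime.mul_left ?_ ?_
    · have := (hc.mul_right (hac.pow_right (n := 2))).neg_right
      rw [hd', show a - a' * ptC P ^ 2 = -(a' * ptC P ^ 2) + a * 1 by ring]
      exact (IsCoprime.add_mul_left_right_iff).mpr this
    · rw [hd', show a - a' * ptC P ^ 2 = a + a' * (-ptC P ^ 2) by ring]
      exact (IsCoprime.add_mul_left_right_iff).mpr hc.symm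
  have hmb : m ^ 2 ≤ b ^ 2 := by
    have h1 : IsCoprime (m ^ 2) (a * a') :=
      (hcad.symm.of_isCoprime_of_dvd_left ⟨ptC Q, by rw [hm]; ring⟩).pow_left
    have h2 : m ^ 2 ∣ a * a' * b ^ 2 :=
      ⟨alpha t Q - 2 * ptC P ^ 2 * ptC Q ^ 2, by linear_combination -key2⟩
    exact Int.le_of_dvd (by positivity) (h1.dvd_of_dvd_mul_left h2)
  have haa : a * a' ≤ alpha t Q := by
    have hm2 : 0 < m ^ 2 := by positivity
    refine le_of_mul_le_mul_right ?_ hm2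
    rw [key2]
    have h1 : a * a' * m ^ 2 ≤ a * a' * b ^ 2 := by gcongr
    have h2 : 0 ≤ 2 * ptC P ^ 2 * ptC Q ^ 2 * m ^ 2 := by positivity
    linarith
  have hn' : n = 2 * e ^ 2 * (a * a') := by rw [hn, ha, ha']; ring
  have hbound : n < 4 * e ^ 4 := by
    have h1 : (a * a') ^ 2 < n := lt_of_le_of_lt (pow_le_pow_left₀ (by positivity) haa 2) hsq
    have h2 : n * n = 4 * e ^ 4 * (a * a') ^ 2 := by rw [hn']; ring
    have h3 : n * n < 4 * e ^ 4 * n := by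
      rw [h2]; exact mul_lt_mul_of_pos_left h1 (by positivity)
    exact lt_of_mul_lt_mul_right h3 hS.n_pos.le
  have hlt := hS.lt_n
  have ht := hS.three_le_t
  rcases he with rfl | rfl
  · have : 4 ^ 2 ≤ (t + 1) ^ 2 := pow_le_pow_left₀ (by norm_num) (by linarith) 2
    linarith
  · rcases eq_or_lt_of_le (show 1 ≤ ptC P by omega) with h1 | h1
    · obtain ⟨h2, h3⟩ :=
        hS.lt_n_of_three_dvd hP hT hoP hoT hne ⟨a, ha⟩ ⟨a', ha'⟩ h1.symm hCT
      have : 8 ^ 2 ≤ (t + 1) ^ 2 := pow_le_pow_left₀ (by norm_num) (by linarith) 2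
      linarith
    · have h2 := hS.ptC_pow_four_lt hP
      have h3 := ptC_sq_le P
      have h4 := hS.two_mul_height_lt hP
      have h5 : 2 ^ 2 ≤ ptC P ^ 2 := pow_le_pow_left₀ (by norm_num) (by linarith) 2
      have h6 : 2 ^ 4 ≤ ptC P ^ 4 := pow_le_pow_left₀ (by norm_num) (by linarith) 4
      have h7 : 10 ^ 2 ≤ (t + 1) ^ 2 := pow_le_pow_left₀ (by norm_num) (by linarith) 2
      have h8 : 2 ^ 4 * 10 ^ 2 ≤ ptC P ^ 4 * (t + 1) ^ 2 :=
        mul_le_mul h6 h7 (by norm_num) (by positivity)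
      linarith

/-- Two distinct ambiguous points of the box cannot have odd `α`, `α'` with `n = 2 α α'`. -/
theorem not_two_mul_alpha_mul (hS : Box a₄ a₆ t n S) (hN : NoSingular a₄ a₆ t n S)
    {P R : RatPoint a₄ a₆} (hP : P ∈ S) (hR : R ∈ S) (hoP : Odd (alpha t P))
    (hoR : Odd (alpha t R)) (hne : alpha t P ≠ alpha t R) (hn : n = 2 * alpha t P * alpha t R)
    (hBP : alpha t P ∣ ptB P) (hBR : alpha t R ∣ ptB R) (hBP0 : ptB P ≠ 0) : False := by
  have hαP := hS.alpha_pos hP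
  have hαR := hS.alpha_pos hR
  have h1 := hS.alpha_sq_lt hP
  have h2 := hS.alpha_sq_lt hR
  have h3 : alpha t P < 2 * alpha t R := by nlinarith
  have h4 : alpha t R < 2 * alpha t P := by nlinarith
  have hP0 : P ≠ 0 := by rintro rfl; rw [alpha_zero] at *; omega
  have hR0 : R ≠ 0 := by rintro rfl; rw [alpha_zero] at *; omega
  obtain ⟨e, a, a', he0, hg, ha, ha'⟩ := Int.exists_gcd_one' (m := alpha t P) (n := alpha t R)
    (Int.gcd_pos_of_ne_zero_left _ hαP.ne')
  have hc := Int.isCoprime_iff_gcd_eq_one.mpr hg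
  rw [mul_comm] at ha ha'
  have he : (e : ℤ) = 1 ∨ (e : ℤ) = 3 := by
    refine hN.eq_one_or_three (by exact_mod_cast he0) (Int.Odd.of_mul_left (ha ▸ hoP)) hP
      ⟨a, ha⟩ ?_ ⟨2 * (a * a'), by rw [hn, ha, ha']; ring⟩
    obtain ⟨b, hb⟩ := hBP
    have hG := alpha_mul_cofactor hS.n_eq P
    have hκ := kappa_mul (t := t) P
    have hG' : cofactor t P = alpha t P * b ^ 2 + 2 * alpha t R * ptC P ^ 6 := by
      apply mul_left_cancel₀ hαP.ne'
      rw [hG, hb, hn]; ring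
    have hcop : IsCoprime (e : ℤ) (ptC P ^ 4) :=
      ((isCoprime_alpha_ptC P).of_isCoprime_of_dvd_left ⟨a, ha⟩).pow_right
    refine hcop.dvd_of_dvd_mul_right ?_
    refine ⟨a * b ^ 2 + 2 * a' * ptC P ^ 6 + a * (3 * t * ptC P ^ 2 - alpha t P), ?_⟩
    rw [hκ, hG']
    linear_combination (b ^ 2 + 3 * t * ptC P ^ 2 - alpha t P) * ha + 2 * ptC P ^ 6 * ha'
  by_cases hBR0 : ptB R = 0
  · exact hS.not_two_mul_alpha_mul_of_torsion hP hR hP0 hR0 hoP hoR hne hBP hBP0 hBR0 he ha ha'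
      hc hn
  · exact hS.not_two_mul_alpha_mul_of_ne hP hR hP0 hR0 hoP hoR hne hBP hBR hBP0 hBR0 he ha ha' hc
      hn

end Box

end Exclusion

/-! ### Replacing the forms of ambiguous points -/

section Compensation

variable {a₄ a₆ t n : ℤ}

/-- A point `R ≠ -R` for which the forms of `R` and `-R` are equivalent. -/
structure Ambiguous (t : ℤ) (R : RatPoint a₄ a₆) : Prop where
  ne_zero : R ≠ 0
  ptB_ne_zero : ptB R ≠ 0
  dvd : alpha t R ∣ 2 * ptB R

/-- The ambiguous form that replaces the form of one of the points `± R` when `R` is ambiguous with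
`α(R) = α`: it is `diagForm n d` for the value `false` of the index and `skewForm n d` for the value
`true`. The cases are arranged so that the form determines `α`, has no automorphs but `± 1`, and is
not equivalent to the form of a point. -/
inductive Replacement (n α d : ℤ) : Bool → Prop
  | odd_special (hn : n % 2 = 1) (h : n = 3 * α ^ 2) (hd : d = 1) : Replacement n α d true
  | odd_odd (hn : n % 2 = 1) (hd : d = α) : Replacement n α d true
  | odd_even (hn : n % 2 = 1) (hd : α = 2 * d) : Replacement n α d false
  | half_diag (hn : n % 2 = 0) (hd : α = 2 * d) (h : d % 2 = 1) : Replacement n α d false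
  | half_skew (hn : n % 2 = 0) (hd : α = 2 * d) : Replacement n α d true
  | self (hn : n % 2 = 0) (hd : d = α) (h : d % 4 = 0) : Replacement n α d false
  | special (hα : α % 2 = 1) (h : n = 2 * α ^ 2 ∨ n = 4 * α ^ 2 ∨ 3 * n = 4 * α ^ 2)
      (hd : d = 2) : Replacement n α d false
  | double (hn : n % 2 = 0) (hα : α % 2 = 1) (hd : d = 2 * α) : Replacement n α d false
  | quotient_diag (hn : n % 4 = 2) (hd : n = 2 * α * d) (h : d % 2 = 1) : Replacement n α d false
  | quotient_skew (hn : n % 4 = 0) (hd : n = 2 * α * d) : Replacement n α d true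

theorem eq_of_sq_eq {x y : ℤ} (hx : 0 < x) (hy : 0 < y) (h : x ^ 2 = y ^ 2) : x = y :=
  (pow_left_inj₀ hx.le hy.le two_ne_zero).mp h

theorem sq_emod_four {x : ℤ} (h : x % 2 = 1) : x ^ 2 % 4 = 1 := by
  obtain ⟨k, hk⟩ : ∃ k, x = 2 * k + 1 := ⟨x / 2, by omega⟩
  rw [hk, show (2 * k + 1) ^ 2 = 4 * (k ^ 2 + k) + 1 by ring]
  omega

/-- The replacing form determines `α`. -/
theorem Replacement.eq {α α' d : ℤ} {k : Bool} (h : Replacement n α d k)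
    (h' : Replacement n α' d k) (hα : 2 ≤ α) (hα' : 2 ≤ α') (hs : α ^ 2 < n) (hs' : α' ^ 2 < n) :
    α = α' := by
  have hlt : α * α' < n := by nlinarith [sq_nonneg (α - α')]
  have hspecial : ∀ x y : ℤ, x % 2 = 1 → y % 2 = 1 → 2 ≤ x → 2 ≤ y →
      (n = 2 * x ^ 2 ∨ n = 4 * x ^ 2 ∨ 3 * n = 4 * x ^ 2) →
      (n = 2 * y ^ 2 ∨ n = 4 * y ^ 2 ∨ 3 * n = 4 * y ^ 2) → x = y := by
    intro x y hx hy hx2 hy2 h1 h2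
    have h3 := sq_emod_four hx
    have h4 := sq_emod_four hy
    refine eq_of_sq_eq (by omega) (by omega) ?_
    omega
  have hcancel : d ≠ 0 → n = 2 * α * d → n = 2 * α' * d → α = α' := by
    intro h0 h1 h2
    have : α * d = α' * d := by linarith
    exact mul_right_cancel₀ h0 this
  cases h <;> cases h' <;> first
    | omega
    | (exact hspecial _ _ (by assumption) (by assumption) hα hα' (by assumption) (by assumption))
    | (exact eq_of_sq_eq (by omega) (by omega) (by omega))
    | (exact hcancel (by rintro rfl; simp_all; nlinarith) (by assumption) (by assumption))
    | (exfalso; subst_vars; nlinarith)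

variable {S : Finset (RatPoint a₄ a₆)}

/-- The form `diagForm n d` or `skewForm n d` is a form of discriminant `-4n` without nontrivial
automorphs that is not equivalent to the form of a point of `S`. -/
def Unhit (t n : ℤ) (S : Finset (RatPoint a₄ a₆)) (d : ℤ) : Bool → Prop
  | false => (0 < d ∧ d ∣ n ∧ d ^ 2 < n) ∧ ∀ R ∈ S, alpha t R = d → ¬ d ∣ ptB R
  | true => BinForm.SkewAdmissible n d ∧
      ∀ R ∈ S, alpha t R = 2 * d → d ∣ ptB R → 2 * d ∣ ptB R

namespace Box

theorem alpha_dvd_n (hn : n = t ^ 3 + a₄ * t - a₆) {R : RatPoint a₄ a₆} (h : alpha t R ∣ ptB R) :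
    alpha t R ∣ n := by
  have h1 := alpha_mul_cofactor hn R
  refine ((isCoprime_alpha_ptC R).pow_right (n := 6)).dvd_of_dvd_mul_right ?_
  have : n * ptC R ^ 6 = alpha t R * cofactor t R - ptB R ^ 2 := by linear_combination -h1
  rw [this]
  exact dvd_sub (dvd_mul_right _ _) (h.trans (dvd_pow_self _ two_ne_zero))

/-- The ambiguous points with `α ∤ B`. -/
theorem exists_of_not_dvd (hn : n = t ^ 3 + a₄ * t - a₆) {R : RatPoint a₄ a₆}
    (h2 : alpha t R ∣ 2 * ptB R) (h : ¬ alpha t R ∣ ptB R) :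
    ∃ u e, alpha t R = 2 * u ∧ n = u * e ∧ (u + e) % 2 = 0 ∧ u ∣ ptB R := by
  have hev : alpha t R % 2 = 0 := by
    by_contra hodd
    apply h
    have : IsCoprime (alpha t R) 2 := Int.isCoprime_two_right.mpr (Int.odd_iff.mpr (by omega))
    exact this.dvd_of_dvd_mul_left h2
  obtain ⟨u, hu⟩ : ∃ u, alpha t R = 2 * u := ⟨alpha t R / 2, by omega⟩
  have hcop : IsCoprime (alpha t R) (ptC R) := isCoprime_alpha_ptC R
  rw [hu] at h2 h hcop
  obtain ⟨b, hb⟩ := (mul_dvd_mul_iff_left two_ne_zero).mp h2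
  have hu0 : u ≠ 0 := by
    rintro rfl
    apply h; rw [hb]; simp
  have hbodd : Odd b := by
    rw [← Int.not_even_iff_odd]
    rintro ⟨c, hc⟩
    exact h ⟨c, by rw [hb, hc]; ring⟩
  have hCodd : Odd (ptC R) := by
    rw [← Int.isCoprime_two_left]
    exact hcop.of_isCoprime_of_dvd_left (dvd_mul_right _ _)
  have h1 := alpha_mul_cofactor hn R
  rw [hu, hb] at h1
  have hun : u ∣ n := by
    have hc6 := (hcop.of_isCoprime_of_dvd_left (dvd_mul_left u 2)).pow_right (n := 6)
    exact hc6.dvd_of_dvd_mul_right ⟨2 * cofactor t R - u * b ^ 2, by linear_combination -h1⟩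
  obtain ⟨e, he⟩ := hun
  refine ⟨u, e, hu, he, ?_, b, hb⟩
  have h3 : 2 * cofactor t R = u * b ^ 2 + e * ptC R ^ 6 := by
    apply mul_left_cancel₀ hu0
    rw [he] at h1
    linear_combination h1
  have h4 : Even (u * b ^ 2 + e * ptC R ^ 6) := ⟨cofactor t R, by rw [← h3]; ring⟩
  have h5 : ¬ Even (b ^ 2) := by rw [Int.not_even_iff_odd]; exact hbodd.pow
  have h6 : ¬ Even (ptC R ^ 6) := by rw [Int.not_even_iff_odd]; exact hCodd.pow
  rw [Int.even_add, Int.even_mul, Int.even_mul] at h4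
  rw [← Int.even_iff, Int.even_add]
  tauto

/-- The exceptional relations between `n` and `α` are incompatible with a point with `α = 2`. -/
theorem not_special (hS : Box a₄ a₆ t n S) {R R' : RatPoint a₄ a₆} (hR : R ∈ S) (hR' : R' ∈ S)
    (h0 : R ≠ 0) (hodd : alpha t R % 2 = 1)
    (hn : n = 2 * alpha t R ^ 2 ∨ n = 4 * alpha t R ^ 2 ∨ 3 * n = 4 * alpha t R ^ 2)
    (h2 : alpha t R' = 2) : False := by
  have hB := hS.ptB_eq_zero_of_alpha_eq_two hR' h2
  obtain ⟨-, rfl, hA, hC⟩ := hS.of_alpha_eq_two hR' h2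
  have e1 := pt_equation R'
  have hn' := hS.n_eq
  have h3 := hS.n_lt
  have h4 := hS.lt_n
  have h5 := hS.alpha_sq_lt hR
  have h6 := hS.lt_two_mul_alpha hR h0
  rw [hA, hB, hC] at e1
  norm_num at h3 h4 e1
  have h7 : alpha 3 R = 3 := by
    have h8 : alpha 3 R < 6 := by nlinarith
    have h9 : alpha 3 R = 3 ∨ alpha 3 R = 5 := by omega
    rcases h9 with h9 | h9
    · exact h9
    · rw [h9] at hn; omega
  have h8 := hS.lt_alpha hR
  have hC1 : ptC R = 1 := by
    have := ptC_pos h0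
    rw [h7] at h8
    by_contra hne
    have : 2 ≤ ptC R := by omega
    nlinarith
  have hA0 : ptA R = 0 := by rw [alpha, hC1] at h7; linarith
  have e2 := pt_equation R
  rw [hA0, hC1] at e2
  rw [h7] at hn
  have : 0 ≤ ptB R ^ 2 := sq_nonneg _
  omega

theorem two_le_alpha (hS : Box a₄ a₆ t n S) {R : RatPoint a₄ a₆} (hR : R ∈ S) (h0 : R ≠ 0) :
    2 ≤ alpha t R := by
  have := hS.lt_two_mul_alpha hR h0
  have := hS.three_le_t
  omega

theorem dvd_ptB_of_alpha_eq (hS : Box a₄ a₆ t n S) {R R' : RatPoint a₄ a₆} (hR : R ∈ S)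
    (hR' : R' ∈ S) (h0 : R ≠ 0) (h : alpha t R = alpha t R') (d : ℤ) :
    d ∣ ptB R' ↔ d ∣ ptB R := by
  rcases hS.eq_or_eq_neg_of_alpha_eq hR hR' h with rfl | rfl
  · rfl
  · rw [ptB_neg h0, dvd_neg]

/-- Every ambiguous point has a replacing form, which is not hit by the points of the box. -/
theorem exists_replacement (hS : Box a₄ a₆ t n S) (hN : NoSingular a₄ a₆ t n S)
    {R : RatPoint a₄ a₆} (hR : R ∈ S) (h : Ambiguous t R) :
    ∃ k d, Replacement n (alpha t R) d k ∧ Unhit t n S d k := by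
  obtain ⟨h0, hB0, h2⟩ := h
  have hα2 := hS.two_le_alpha hR h0
  have hsq := hS.alpha_sq_lt hR
  have h16 : 16 ≤ (t + 1) ^ 2 := by
    have := hS.three_le_t
    nlinarith
  have hn16 := hS.lt_n
  have hdouble := fun (R' : RatPoint a₄ a₆) (hR' : R' ∈ S) ↦ hS.not_alpha_double hN hR hR'
  have hhalf := fun (R' : RatPoint a₄ a₆) (hR' : R' ∈ S) ↦ hS.not_alpha_double hN hR' hR
  have hquot := fun (R' : RatPoint a₄ a₆) (hR' : R' ∈ S) ↦ hS.not_two_mul_alpha_mul hN hR hR'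
  have hsame := fun (R' : RatPoint a₄ a₆) (hR' : R' ∈ S) ↦ hS.dvd_ptB_of_alpha_eq hR hR' h0
  have hspec := fun (R' : RatPoint a₄ a₆) (hR' : R' ∈ S) ↦ hS.not_special hR hR' h0
  have hltn : ∀ R' ∈ S, alpha t R * alpha t R' < n := fun R' hR' ↦ by
    have := hS.alpha_sq_lt hR'
    nlinarith [sq_nonneg (alpha t R - alpha t R')]
  have hB2 := fun (R' : RatPoint a₄ a₆) (hR' : R' ∈ S) ↦ hS.ptB_eq_zero_of_alpha_eq_two hR'
  by_cases hI : alpha t R ∣ ptB R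
  · obtain ⟨m, hm⟩ := alpha_dvd_n hS.n_eq hI
    generalize alpha t R = α at *
    have hα0 : α ≠ 0 := by omega
    have hmod : n % 4 = ((α % 4) * (m % 4)) % 4 := by rw [hm, Int.mul_emod]
    rcases Int.emod_two_eq_zero_or_one n with hn2 | hn2
    · have hc : α % 4 = 0 ∨ α % 4 = 2 ∨ α % 2 = 1 := by omega
      rcases hc with hα4 | hα4 | hα4
      · -- `4 ∣ α ∣ n`
        obtain ⟨u, hu⟩ : ∃ u, α = 2 * u := ⟨α / 2, by omega⟩
        have hdiv : n / u = 2 * m := by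
          rw [hm, hu, show 2 * u * m = u * (2 * m) by ring]
          exact Int.mul_ediv_cancel_left _ (by omega)
        refine ⟨true, u, .half_skew hn2 hu, ⟨by omega, ⟨2 * m, by rw [hm, hu]; ring⟩,
          by rw [hdiv]; omega, ?_, ?_⟩, ?_⟩
        · rw [hu] at hsq; nlinarith
        · rw [hu] at hsq; nlinarith
        · intro R' hR' hα' _
          rw [← hu] at hα' ⊢
          exact (hsame R' hR' hα'.symm α).mpr hI
      · obtain ⟨u, hu⟩ : ∃ u, α = 2 * u := ⟨α / 2, by omega⟩
        refine ⟨false, u, .half_diag hn2 hu (by omega), ⟨by omega, ⟨2 * m, by rw [hm, hu]; ring⟩,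
          by rw [hu] at hsq; nlinarith⟩, ?_⟩
        intro R' hR' hα' hd
        refine hhalf R' hR' (by rw [hα', Int.odd_iff]; omega) (by rw [hα', hu]) (by rwa [hα'])
          ?_ (.inr hB0)
        rw [hα']
        exact dvd_trans ⟨2, by rw [hu]; ring⟩ hI
      · have hm2 : ∃ k, m = 2 * k := by
          have : Even (α * m) := by rw [← hm]; exact Int.even_iff.mpr hn2
          rw [Int.even_mul] at this
          rcases this with h | h
          · rw [Int.even_iff] at h; omega
          · obtain ⟨k, hk⟩ := h; exact ⟨k, by omega⟩
        obtain ⟨k, rfl⟩ := hm2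
        have hnk : n = 2 * α * k := by rw [hm]; ring
        by_cases hs : n = 2 * α ^ 2 ∨ n = 4 * α ^ 2 ∨ 3 * n = 4 * α ^ 2
        · refine ⟨false, 2, .special hα4 hs rfl, ⟨by norm_num, by omega, by linarith⟩, ?_⟩
          intro R' hR' hα' _
          exact hspec R' hR' hα4 hs hα'
        push Not at hs
        rcases lt_or_gt_of_ne hs.2.1 with hlt | hlt
        · -- `n < 4 α²`
          have hk0 : 0 < k := by
            by_contra! hk
            nlinarith
          have hk2 : k ^ 2 < n := by
            have e1 : n * n = 4 * α ^ 2 * k ^ 2 := by rw [hnk]; ring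
            have : n * k ^ 2 < n * n := by
              rw [e1]; exact mul_lt_mul_of_pos_right hlt (by positivity)
            exact lt_of_mul_lt_mul_left this (by linarith)
          have hαk : (α * k) % 2 = k % 2 := by
            rw [Int.mul_emod, hα4, one_mul, Int.emod_emod_of_dvd]; rfl
          have hnk' : n = 2 * (α * k) := by rw [hnk]; ring
          rcases Int.emod_two_eq_zero_or_one k with hke | hke
          · have hdiv : n / k = 2 * α := by
              rw [hnk]; exact Int.mul_ediv_cancel _ hk0.ne'
            refine ⟨true, k, .quotient_skew (by omega) hnk, ⟨hk0, ⟨2 * α, by rw [hnk]; ring⟩,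
              by rw [hdiv]; omega, hk2, ?_⟩, ?_⟩
            · intro h3
              apply hs.2.2
              have e1 : n * n = 4 * α ^ 2 * k ^ 2 := by rw [hnk]; ring
              have : k ^ 2 * (3 * n) = k ^ 2 * (4 * α ^ 2) := by
                linear_combination e1 - n * h3
              exact mul_left_cancel₀ (by positivity) this
            · intro R' hR' hα' _
              have := hltn R' hR'
              rw [hα'] at this
              linarith
          · refine ⟨false, k, .quotient_diag (by omega) hnk hke, ⟨hk0, ⟨2 * α, by rw [hnk]; ring⟩,
              hk2⟩, ?_⟩
            intro R' hR' hα' hd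
            refine hquot R' hR' (Int.odd_iff.mpr hα4) (by rw [hα', Int.odd_iff]; exact hke) ?_
              (by rw [hα']; exact hnk) hI (by rwa [hα']) hB0
            rw [hα']
            rintro rfl
            exact hs.1 (by rw [hnk]; ring)
        · refine ⟨false, 2 * α, .double hn2 hα4 rfl, ⟨by omega, ⟨k, hnk⟩, by nlinarith⟩, ?_⟩
          intro R' hR' hα' hd
          exact hdouble R' hR' (Int.odd_iff.mpr hα4) hα' hI ((dvd_mul_left _ _).trans hd) (.inl h0)
    · -- `n` is odd
      have hodd : α % 2 = 1 ∧ m % 2 = 1 := by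
        have : Odd (α * m) := by rw [← hm]; exact Int.odd_iff.mpr hn2
        rw [Int.odd_mul, Int.odd_iff, Int.odd_iff] at this
        exact this
      have hdiv : n / α = m := by rw [hm]; exact Int.mul_ediv_cancel_left _ hα0
      by_cases h3 : n = 3 * α ^ 2
      · refine ⟨true, 1, .odd_special hn2 h3 rfl, ⟨one_pos, one_dvd _, by rw [Int.ediv_one]; omega,
          by linarith, by linarith⟩, ?_⟩
        intro R' hR' hα' _
        rw [hB2 R' hR' (by rw [hα']; rfl)]
        exact dvd_zero _
      · refine ⟨true, α, .odd_odd hn2 rfl, ⟨by omega, ⟨m, hm⟩, by rw [hdiv]; omega, hsq, h3⟩, ?_⟩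
        intro R' hR' hα' hd
        exact (hdouble R' hR' (Int.odd_iff.mpr hodd.1) hα' hI hd (.inl h0)).elim
  · obtain ⟨u, e, hu, hn, hue, huB⟩ := exists_of_not_dvd hS.n_eq h2 hI
    generalize alpha t R = α at *
    have hue' : Even u ↔ Even e := by
      rw [← Int.even_iff, Int.even_add] at hue; exact hue
    rcases Int.even_or_odd u with hue2 | huo
    · obtain ⟨v, hv⟩ := hue2
      obtain ⟨e', he'⟩ := hue'.mp ⟨v, hv⟩
      have hn' : n = 4 * (v * e') := by rw [hn, hv, he']; ring
      refine ⟨false, α, .self (by omega) rfl (by omega), ⟨by omega, ⟨e', ?_⟩, hsq⟩, ?_⟩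
      · rw [hn, hu, he']; ring
      · intro R' hR' hα' hd
        exact hI ((hsame R' hR' hα'.symm α).mp hd)
    · have heo : Odd e := by
        rw [← Int.not_even_iff_odd] at huo ⊢
        exact fun h ↦ huo (hue'.mpr h)
      have hno : n % 2 = 1 := by rw [← Int.odd_iff, hn]; exact huo.mul heo
      refine ⟨false, u, .odd_even hno hu, ⟨by omega, ⟨e, hn⟩, by rw [hu] at hsq; nlinarith⟩, ?_⟩
      intro R' hR' hα' hd
      exact hhalf R' hR' (by rwa [hα']) (by rw [hα', hu]) (by rwa [hα']) (by rwa [hα']) (.inr hB0)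

end Box

end Compensation

section Compensation

variable {a₄ a₆ t n : ℤ}

/-- The form `diagForm n d` or `skewForm n d`, depending on the index. -/
def ambiguousForm (n d : ℤ) : Bool → BinForm
  | false => BinForm.diagForm n d
  | true => BinForm.skewForm n d

variable {S : Finset (RatPoint a₄ a₆)}

theorem Unhit.spec {d : ℤ} {k : Bool} (h : Unhit t n S d k) :
    0 < (ambiguousForm n d k).a ∧ (ambiguousForm n d k).disc = -(4 * n) ∧
      (ambiguousForm n d k).Rigid := by
  cases k with
  | false =>
    have hs := BinForm.small_diagForm h.1.1 h.1.2.1 h.1.2.2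
    exact ⟨hs.a_pos, hs.disc_eq, hs.rigid⟩
  | true =>
    exact ⟨mul_pos two_pos h.1.pos, h.1.disc_eq, h.1.rigid⟩

theorem Unhit.eq_of_smul {d d' : ℤ} {k k' : Bool} (h : Unhit t n S d k) (h' : Unhit t n S d' k')
    {γ : SL(2, ℤ)} (hγ : γ • ambiguousForm n d k = ambiguousForm n d' k') : k = k' ∧ d = d' := by
  have mixed : ∀ {d d' : ℤ} {γ : SL(2, ℤ)}, Unhit t n S d true → Unhit t n S d' false →
      γ • BinForm.skewForm n d ≠ BinForm.diagForm n d' := by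
    intro d d' γ h h' hγ
    obtain ⟨-, h2⟩ := h.1.eq_of_smul_small (BinForm.small_diagForm h'.1.1 h'.1.2.1 h'.1.2.2) hγ
    simp only [BinForm.diagForm] at h2
    have := h.1.pos
    obtain ⟨c, hc⟩ := h2
    have : d * (2 * (2 * c + 1)) = 0 := by linarith
    rcases mul_eq_zero.mp this with h3 | h3 <;> omega
  cases k <;> cases k'
  · exact ⟨rfl, ((BinForm.small_diagForm h.1.1 h.1.2.1 h.1.2.2).eq_of_smul
      (BinForm.small_diagForm h'.1.1 h'.1.2.1 h'.1.2.2) hγ).1⟩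
  · exact absurd (inv_smul_eq_iff.mpr hγ.symm) (mixed h' h)
  · exact absurd hγ (mixed h h')
  · exact ⟨rfl, h.1.eq_of_smul h'.1 hγ⟩

namespace Box

/-- The replacing forms are inequivalent to the forms of the points of the box. -/
theorem not_smul_eq_pointForm (hS : Box a₄ a₆ t n S) {d : ℤ} {k : Bool} (h : Unhit t n S d k)
    {R : RatPoint a₄ a₆} (hR : R ∈ S) {γ : SL(2, ℤ)} :
    γ • ambiguousForm n d k ≠ pointForm t n R := by
  intro hγ
  have hs := hS.small_pointForm hR
  obtain ⟨l, hl⟩ := dvd_root_mul_sub t R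
  have hcop : IsCoprime (alpha t R) (ptC R) := isCoprime_alpha_ptC R
  cases k with
  | false =>
    obtain ⟨h1, c, hc⟩ := (BinForm.small_diagForm h.1.1 h.1.2.1 h.1.2.2).eq_of_smul hs hγ
    simp only [BinForm.diagForm, pointForm] at h1 hc
    refine h.2 R hR h1.symm ⟨c * ptC R ^ 3 - l, ?_⟩
    rw [← h1] at hl
    have hv : root t R = d * c := by linarith
    rw [hv] at hl
    linear_combination -hl
  | true =>
    obtain ⟨h1, c, hc⟩ := h.1.eq_of_smul_small hs hγ
    simp only [pointForm] at h1 hc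
    have hv : root t R = d * (1 + 2 * c) := by linarith
    rw [h1, hv] at hl
    have h2 := h.2 R hR h1 ⟨(1 + 2 * c) * ptC R ^ 3 - 2 * l, by linear_combination -hl⟩
    obtain ⟨m, hm⟩ := h2
    rw [h1] at hcop
    have h3 : 2 * d ∣ d * (1 + 2 * c) := by
      refine (hcop.pow_right (n := 3)).dvd_of_dvd_mul_right ⟨m + l, ?_⟩
      rw [hm] at hl
      linear_combination hl
    obtain ⟨m', hm'⟩ := h3
    have := h.1.pos
    have : d * (1 + 2 * c - 2 * m') = 0 := by linarith
    rcases mul_eq_zero.mp this with h4 | h4 <;> omega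

/-- If no point of the box meets a singular point, then the forms of the points of the box, with the
forms of one of each pair of ambiguous points replaced, are inequivalent. -/
theorem card_le_of_noSingular (hS : Box a₄ a₆ t n S) (hN : NoSingular a₄ a₆ t n S) :
    (S.card : ℝ) ≤ hurwitzH (-(4 * n)) := by
  classical
  have hex : ∀ R : RatPoint a₄ a₆, ∃ k d, R ∈ S → Ambiguous t R →
      Replacement n (alpha t R) d k ∧ Unhit t n S d k := by
    intro R
    by_cases h : R ∈ S ∧ Ambiguous t R
    · obtain ⟨k, d, h1⟩ := hS.exists_replacement hN h.1 h.2
      exact ⟨k, d, fun _ _ ↦ h1⟩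
    · exact ⟨true, 0, fun h1 h2 ↦ absurd ⟨h1, h2⟩ h⟩
  choose k d hkd using hex
  let Repl : RatPoint a₄ a₆ → Prop := fun R ↦ Ambiguous t R ∧ ptB R < 0
  let Φ : RatPoint a₄ a₆ → BinForm := fun R ↦
    if Repl R then ambiguousForm n (d R) (k R) else pointForm t n R
  have hΦ : ∀ R, Repl R → Φ R = ambiguousForm n (d R) (k R) := fun R h ↦ if_pos h
  have hΦ' : ∀ R, ¬ Repl R → Φ R = pointForm t n R := fun R h ↦ if_neg h
  have key : ∀ R ∈ S, ∀ R' ∈ S, ∀ γ : SL(2, ℤ), γ • Φ R = Φ R' → R = R' := by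
    intro R hR R' hR' γ hγ
    by_cases h : Repl R <;> by_cases h' : Repl R'
    · rw [hΦ R h, hΦ R' h'] at hγ
      obtain ⟨h1, h2⟩ := hkd R hR h.1
      obtain ⟨h3, h4⟩ := hkd R' hR' h'.1
      obtain ⟨h5, h6⟩ := h2.eq_of_smul h4 hγ
      rw [← h5, ← h6] at h3
      have h7 := h1.eq h3 (hS.two_le_alpha hR h.1.ne_zero) (hS.two_le_alpha hR' h'.1.ne_zero)
        (hS.alpha_sq_lt hR) (hS.alpha_sq_lt hR')
      rcases hS.eq_or_eq_neg_of_alpha_eq hR hR' h7 with h8 | h8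
      · exact h8.symm
      · have h9 := h'.2
        rw [h8, ptB_neg h.1.ne_zero] at h9
        have := h.2
        linarith
    · rw [hΦ R h, hΦ' R' h'] at hγ
      exact absurd hγ (hS.not_smul_eq_pointForm (hkd R hR h.1).2 hR')
    · rw [hΦ' R h, hΦ R' h'] at hγ
      exact absurd (inv_smul_eq_iff.mpr hγ.symm) (hS.not_smul_eq_pointForm (hkd R' hR' h'.1).2 hR)
    · rw [hΦ' R h, hΦ' R' h'] at hγ
      rcases hS.eq_or_of_smul_pointForm hR hR' hγ with h1 | ⟨h1, h2, h3⟩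
      · exact h1.symm
      · by_cases hB : ptB R = 0
        · exact ext_pt (by rw [h1, ptA_neg]) (by rw [h1, ptB_neg h2, hB, neg_zero])
            (by rw [h1, ptC_neg])
        · exfalso
          have hamb : Ambiguous t R := ⟨h2, hB, h3⟩
          have hamb' : Ambiguous t R' := by
            rw [h1]
            exact ⟨neg_ne_zero.mpr h2, by rw [ptB_neg h2]; exact neg_ne_zero.mpr hB,
              by rw [alpha_neg, ptB_neg h2, mul_neg, dvd_neg]; exact h3⟩
          rcases lt_or_gt_of_ne hB with h4 | h4
          · exact h ⟨hamb, h4⟩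
          · exact h' ⟨hamb', by rw [h1, ptB_neg h2]; linarith⟩
  have hspec : ∀ R ∈ S, 0 < (Φ R).a ∧ (Φ R).disc = -(4 * n) ∧ (Φ R).Rigid := by
    intro R hR
    by_cases h : Repl R
    · rw [hΦ R h]
      exact (hkd R hR h.1).2.spec
    · rw [hΦ' R h]
      have := hS.small_pointForm hR
      exact ⟨this.a_pos, this.disc_eq, this.rigid⟩
  have hsys : BinForm.IsSystem (-(4 * n)) (S.image Φ) := by
    refine ⟨?_, ?_, ?_, ?_⟩
    · intro f hf
      obtain ⟨R, hR, rfl⟩ := Finset.mem_image.mp hf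
      exact (hspec R hR).1
    · intro f hf
      obtain ⟨R, hR, rfl⟩ := Finset.mem_image.mp hf
      exact (hspec R hR).2.1
    · intro f hf
      obtain ⟨R, hR, rfl⟩ := Finset.mem_image.mp hf
      exact (hspec R hR).2.2
    · intro f hf g hg γ h
      obtain ⟨R, hR, rfl⟩ := Finset.mem_image.mp hf
      obtain ⟨R', hR', rfl⟩ := Finset.mem_image.mp hg
      rw [key R hR R' hR' γ h]
  have hcard : (S.image Φ).card = S.card := Finset.card_image_of_injOn
    fun R hR R' hR' h ↦ key R hR R' hR' 1 (by rw [one_smul]; exact h)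
  rw [← hcard]
  exact hsys.card_le_hurwitzH (by linarith [hS.n_pos])

/-- The number of points in a box is at most the class number. -/
theorem card_le_hurwitzH (hS : Box a₄ a₆ t n S) : (S.card : ℝ) ≤ hurwitzH (-(4 * n)) := by
  by_cases hp : ∃ p : ℕ, p.Prime ∧ 5 ≤ p ∧ (p : ℤ) ∣ 3 * t ^ 2 + a₄ ∧ (p : ℤ) ∣ n ∧
      ∃ P ∈ S, (p : ℤ) ∣ alpha t P
  · obtain ⟨p, hp, hp5, hκ, hn, P, hP, hα⟩ := hp
    exact hS.card_le_of_prime hp hp5 hκ hn hP hα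
  by_cases h9 : 9 ∣ 3 * t ^ 2 + a₄ ∧ 81 ∣ n ∧ ∃ P ∈ S, 9 ∣ alpha t P
  · obtain ⟨hκ, hn, P, hP, hα⟩ := h9
    exact hS.card_le_of_nine hκ hn hP hα
  exact hS.card_le_of_noSingular
    ⟨fun p h1 h2 h3 h4 P hP h5 ↦ hp ⟨p, h1, h2, h3, h4, P, hP, h5⟩,
      fun h1 h2 P hP h3 ↦ h9 ⟨h1, h2, P, hP, h3⟩⟩

end Box

end Compensation

/-! ### Counting points of small height -/

section Counting

/-- The points of `ℤ × T` whose first coordinate has absolute value at most `m`. -/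
noncomputable def levelBox (T : Type*) [Fintype T] (m : ℕ) : Finset (ℤ × T) :=
  Finset.Icc (-(m : ℤ)) m ×ˢ Finset.univ

variable {T : Type*} [Fintype T] {m : ℕ}

theorem mem_levelBox {x : ℤ × T} : x ∈ levelBox T m ↔ |x.1| ≤ m := by
  simp [levelBox, abs_le]

theorem card_levelBox : (levelBox T m).card = (2 * m + 1) * Fintype.card T := by
  rw [levelBox, Finset.card_product, Int.card_Icc, Finset.card_univ]
  congr 1
  omega

variable [AddCommGroup T] {High Low : ℤ × T → Prop}

open Classical in
/-- Let `ν` be the least absolute value of a first coordinate in `High`. A point of `Low` has first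
coordinate `0` or of absolute value at least `2ν`, so that adding or subtracting a point of level
`ν` moves it into `High` within the box. -/
theorem two_mul_card_levelBox_low_le (hneg : ∀ x, High x → High (-x))
    (hadd : ∀ x y, High x → Low y → High (x + y))
    (hex : ∃ x ∈ levelBox T m, High x) :
    2 * ((levelBox T m).filter Low).card ≤ 3 * ((levelBox T m).filter High).card := by
  obtain ⟨x, hx, hxh, hx0, hmin⟩ : ∃ x ∈ levelBox T m, High x ∧ 0 ≤ x.1 ∧
      ∀ y ∈ levelBox T m, High y → x.1 ≤ |y.1| := by
    obtain ⟨x₀, h₀, hm⟩ := ((levelBox T m).filter High).exists_min_image (fun x ↦ |x.1|)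
      (by obtain ⟨x, hx, h⟩ := hex; exact ⟨x, Finset.mem_filter.mpr ⟨hx, h⟩⟩)
    rw [Finset.mem_filter] at h₀
    rcases le_total 0 x₀.1 with h | h
    · refine ⟨x₀, h₀.1, h₀.2, h, fun y hy hyh ↦ ?_⟩
      rw [← abs_of_nonneg h]
      exact hm y (Finset.mem_filter.mpr ⟨hy, hyh⟩)
    · refine ⟨-x₀, ?_, hneg _ h₀.2, by simpa using h, fun y hy hyh ↦ ?_⟩
      · rw [mem_levelBox] at h₀ ⊢
        simpa using h₀.1
      · rw [Prod.fst_neg, ← abs_of_nonpos h]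
        exact hm y (Finset.mem_filter.mpr ⟨hy, hyh⟩)
  have hsub : ∀ y, Low y → High (y - x) := fun y hy ↦ by
    simpa [sub_eq_neg_add] using hadd _ _ (hneg _ hxh) hy
  have hadd' : ∀ y, Low y → High (y + x) := fun y hy ↦ by
    simpa [add_comm] using hadd _ _ hxh hy
  have hxm : x.1 ≤ m := (le_abs_self _).trans (mem_levelBox.mp hx)
  rcases hx0.eq_or_lt with hx1 | hx1
  · have : ((levelBox T m).filter Low).card ≤ ((levelBox T m).filter High).card := by
      refine Finset.card_le_card_of_injOn (· + x) (fun y hy ↦ ?_) (add_left_injective x).injOn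
      have hy := Finset.mem_filter.mp hy
      refine Finset.mem_filter.mpr ⟨?_, hadd' _ hy.2⟩
      rw [mem_levelBox] at hy ⊢
      simpa [← hx1] using hy.1
    omega
  have hgap : ∀ y ∈ levelBox T m, Low y → y.1 ≠ 0 → 2 * x.1 ≤ |y.1| := by
    intro y hy hyl hy0
    by_contra! hlt
    rw [mem_levelBox, abs_le] at hy
    rw [abs_lt] at hlt
    rcases lt_or_gt_of_ne hy0 with h | h
    · have h1 : |(y + x).1| < x.1 := by rw [Prod.fst_add, abs_lt]; omega
      exact (hmin _ (mem_levelBox.mpr (by omega)) (hadd' y hyl)).not_gt h1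
    · have h1 : |(y - x).1| < x.1 := by rw [Prod.fst_sub, abs_lt]; omega
      exact (hmin _ (mem_levelBox.mpr (by omega)) (hsub y hyl)).not_gt h1
  have hne : (((levelBox T m).filter Low).filter (fun y ↦ y.1 ≠ 0)).card ≤
      ((levelBox T m).filter High).card := by
    refine Finset.card_le_card_of_injOn (fun y ↦ if 0 < y.1 then y - x else y + x) ?_ ?_
    · intro y hy
      simp only [Finset.coe_filter, Finset.mem_filter, Set.mem_ofPred_eq] at hy
      obtain ⟨⟨hyB, hyl⟩, hy0⟩ := hy
      have hg := hgap y hyB hyl hy0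
      have hyB := abs_le.mp (mem_levelBox.mp hyB)
      simp only [Finset.coe_filter, Set.mem_ofPred_eq, mem_levelBox]
      split_ifs with h
      · rw [abs_of_pos h] at hg
        exact ⟨by rw [Prod.fst_sub, abs_le]; omega, hsub y hyl⟩
      · rw [abs_of_nonpos (by omega)] at hg
        exact ⟨by rw [Prod.fst_add, abs_le]; omega, hadd' y hyl⟩
    · intro y hy z hz hyz
      simp only [Finset.coe_filter, Finset.mem_filter, Set.mem_ofPred_eq] at hy hz
      have hgy := hgap y hy.1.1 hy.1.2 hy.2
      have hgz := hgap z hz.1.1 hz.1.2 hz.2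
      have h1 := congrArg Prod.fst hyz
      simp only at hyz h1
      split_ifs at hyz h1 with hy' hz' hz'
      · exact sub_left_injective hyz
      · rw [abs_of_pos hy'] at hgy
        rw [abs_of_nonpos (by omega)] at hgz
        rw [Prod.fst_sub, Prod.fst_add] at h1
        omega
      · rw [abs_of_nonpos (by omega)] at hgy
        rw [abs_of_pos hz'] at hgz
        rw [Prod.fst_sub, Prod.fst_add] at h1
        omega
      · exact add_left_injective x hyz
  have heq : 2 * (((levelBox T m).filter Low).filter (fun y ↦ ¬ y.1 ≠ 0)).card ≤
      ((levelBox T m).filter High).card := by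
    rw [mul_comm, ← Fintype.card_bool, ← Finset.card_univ, ← Finset.card_product]
    refine Finset.card_le_card_of_injOn (fun p ↦ if p.2 then p.1 - x else p.1 + x) ?_ ?_
    · rintro ⟨y, b⟩ hy
      simp only [ne_eq, not_not, Finset.coe_product, Set.mem_prod, Finset.mem_coe,
        Finset.mem_filter] at hy
      obtain ⟨⟨⟨-, hyl⟩, hy0⟩, -⟩ := hy
      simp only [Finset.coe_filter, Set.mem_ofPred_eq, mem_levelBox]
      split_ifs with h
      · exact ⟨by rw [Prod.fst_sub, abs_le]; omega, hsub y hyl⟩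
      · exact ⟨by rw [Prod.fst_add, abs_le]; omega, hadd' y hyl⟩
    · rintro ⟨y, b⟩ hy ⟨z, c⟩ hz hyz
      simp only [ne_eq, not_not, Finset.coe_product, Set.mem_prod, Finset.mem_coe,
        Finset.mem_filter] at hy hz
      have h1 := congrArg Prod.fst hyz
      simp only at hyz h1
      cases b <;> cases c <;> simp only [if_true, Bool.false_eq_true, if_false,
        Prod.fst_sub, Prod.fst_add] at hyz h1
      · rw [add_left_injective x hyz]
      · omega
      · omega
      · rw [sub_left_injective hyz]
  have := Finset.card_filter_add_card_filter_not (s := (levelBox T m).filter Low)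
    (fun y ↦ y.1 ≠ 0)
  omega

variable {G : Type*} [AddCommGroup G]

/-- The map `(k, τ) ↦ k P + τ` from `ℤ` times the torsion subgroup. -/
def levelHom (P : G) : ℤ × AddCommGroup.torsion G →+ G :=
  ((zmultiplesHom G P).coprod (AddCommGroup.torsion G).subtype)

theorem levelHom_apply (P : G) (x : ℤ × AddCommGroup.torsion G) :
    levelHom P x = x.1 • P + x.2 := rfl

theorem levelHom_injective {P : G} (hP : ¬ IsOfFinAddOrder P) :
    Function.Injective (levelHom P) := by
  rw [injective_iff_map_eq_zero]
  rintro ⟨k, τ, hτ⟩ h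
  rw [levelHom_apply] at h
  have hk : k = 0 := by
    by_contra hk
    have h1 : IsOfFinAddOrder (k • P) := by
      rw [eq_neg_of_add_eq_zero_left h]
      exact (show IsOfFinAddOrder τ from hτ).neg
    obtain ⟨l, hl, h2⟩ := isOfFinAddOrder_iff_zsmul_eq_zero.mp h1
    exact hP (isOfFinAddOrder_iff_zsmul_eq_zero.mpr ⟨l * k, mul_ne_zero hl hk, by
      rw [mul_zsmul, h2]⟩)
  subst hk
  ext
  · rfl
  · simpa using h

end Counting

/-! ### Points of small canonical height -/

section SmallPoints

variable {a₄ a₆ : ℤ}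

open Classical in
/-- The points `k P + τ` with `|k| ≤ m` and `τ` torsion. -/
noncomputable def smallPoints (P : RatPoint a₄ a₆) (m : ℕ)
    [Fintype (AddCommGroup.torsion (RatPoint a₄ a₆))] : Finset (RatPoint a₄ a₆) :=
  (levelBox _ m).image (levelHom P)

variable {P : RatPoint a₄ a₆} {m : ℕ} [Fintype (AddCommGroup.torsion (RatPoint a₄ a₆))]

theorem card_smallPoints (hP : ¬ IsOfFinAddOrder P) :
    (smallPoints P m).card = (2 * m + 1) * torsionOrder a₄ a₆ := by
  rw [smallPoints, Finset.card_image_of_injective _ (levelHom_injective hP), card_levelBox,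
    torsionOrder, Nat.card_eq_fintype_card]

theorem canonHeight_lt_of_mem_smallPoints (hE : (shortCurve a₄ a₆).IsElliptic) {c : ℝ}
    (hc : (m : ℝ) ^ 2 * canonHeight P < c) {R : RatPoint a₄ a₆} (hR : R ∈ smallPoints P m) :
    canonHeight R < c := by
  obtain ⟨⟨k, τ, hτ⟩, hx, rfl⟩ := Finset.mem_image.mp hR
  have hk : |(k : ℝ)| ≤ (m : ℝ) := by exact_mod_cast mem_levelBox.mp hx
  rw [levelHom_apply, canonHeight_add_torsion hE _ _ hτ, canonHeight_zsmul hE]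
  refine lt_of_le_of_lt ?_ hc
  have := canonHeight_nonneg hE P
  gcongr ?_ * _
  exact sq_le_sq' (by linarith [(abs_le.mp hk).1]) (abs_le.mp hk).2

/-- Points of canonical height less than `T/4`, where `T = log E - 4δ`, satisfy the height
conditions of a box. -/
theorem box_smallPoints (hE : (shortCurve a₄ a₆).IsElliptic) (hP : ¬ IsOfFinAddOrder P) {t n : ℤ}
    (ht : 0 < t) (hn : n = t ^ 3 + a₄ * t - a₆)
    (hlow : ((t : ℝ) + 1) ^ 2 * Real.exp (4 * heightDelta a₄ a₆) < n)
    (hup : 4 * n < (t + 1) ^ 2 * t ^ 2)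
    (hm : (m : ℝ) ^ 2 * canonHeight P <
      (Real.log (n / ((t : ℝ) + 1) ^ 2) - 4 * heightDelta a₄ a₆) / 4) :
    Box a₄ a₆ t n (smallPoints P m) := by
  have hδ := heightDelta_nonneg hE
  have ht' : (0 : ℝ) < t := by exact_mod_cast ht
  have ht1 : (0 : ℝ) < ((t : ℝ) + 1) ^ 2 := by positivity
  have hexp : 1 ≤ Real.exp (4 * heightDelta a₄ a₆) := Real.one_le_exp (by positivity)
  have hltn : ((t : ℝ) + 1) ^ 2 < n := lt_of_le_of_lt (le_mul_of_one_le_right ht1.le hexp) hlow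
  have hn0 : (0 : ℝ) < n := ht1.trans hltn
  set E : ℝ := n / ((t : ℝ) + 1) ^ 2 with hEdef
  have hE0 : 0 < E := by positivity
  have hEn : E * ((t : ℝ) + 1) ^ 2 = n := div_mul_cancel₀ _ ht1.ne'
  have hpos : ∀ R : RatPoint a₄ a₆, (0 : ℝ) < ptHeight R := fun R ↦ by
    exact_mod_cast one_le_ptHeight R
  have hcan := fun R (hR : R ∈ smallPoints P m) ↦ canonHeight_lt_of_mem_smallPoints hE hm hR
  refine ⟨hn, ht, by exact_mod_cast hltn, hup, ?_, ?_, ?_, ?_, ?_⟩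
  · intro R hR
    obtain ⟨x, hx, rfl⟩ := Finset.mem_image.mp hR
    exact Finset.mem_image.mpr
      ⟨-x, mem_levelBox.mpr (by simpa using mem_levelBox.mp hx), map_neg _ _⟩
  · intro R hR T hT
    obtain ⟨x, hx, rfl⟩ := Finset.mem_image.mp hR
    have hT' : IsOfFinAddOrder T :=
      isOfFinAddOrder_iff_nsmul_eq_zero.mpr ⟨2, two_pos, by rw [two_nsmul]; exact hT⟩
    refine Finset.mem_image.mpr ⟨(x.1, x.2 + ⟨T, hT'⟩), ?_, ?_⟩
    · rw [mem_levelBox] at hx ⊢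
      exact hx
    · rw [levelHom_apply, levelHom_apply, AddSubgroup.coe_add, add_assoc]
  · intro R hR
    have h1 := half_weilHeight_le hE R
    have h2 := hcan R hR
    rw [weilHeight_eq_log] at h1
    have h3 : ((ptHeight R : ℝ)) ^ 2 < E := by
      rw [← Real.log_lt_log_iff (pow_pos (hpos R) 2) hE0, Real.log_pow]
      push_cast
      linarith
    have h4 : (ptHeight R : ℝ) ^ 2 * ((t : ℝ) + 1) ^ 2 < n := by
      rw [← hEn]; gcongr
    exact_mod_cast h4
  · intro R hR R' hR'
    have h1 := half_weilHeight_le hE (R + R')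
    have h1' := half_weilHeight_le hE (R - R')
    have h2 := hcan R hR
    have h2' := hcan R' hR'
    have h5 := (canonHeight_spec hE).1 R R'
    rw [weilHeight_eq_log] at h1 h1'
    have h3 : (ptHeight (R + R') : ℝ) * ptHeight (R - R') < E ^ 2 := by
      rw [← Real.log_lt_log_iff (mul_pos (hpos _) (hpos _)) (pow_pos hE0 2), Real.log_pow,
        Real.log_mul (hpos _).ne' (hpos _).ne']
      push_cast
      linarith
    have h4 : (ptHeight (R + R') : ℝ) * ptHeight (R - R') * ((t : ℝ) + 1) ^ 4 < (n : ℝ) ^ 2 := by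
      rw [← hEn, mul_pow, ← pow_mul]
      gcongr
    exact_mod_cast h4
  · intro High Low hneg hadd ⟨R, hR, hRH⟩
    have hcard : ∀ Q : RatPoint a₄ a₆ → Prop, ∀ [DecidablePred Q],
        ∀ [DecidablePred fun x ↦ Q (levelHom P x)], ((smallPoints P m).filter Q).card =
          ((levelBox _ m).filter fun x ↦ Q (levelHom P x)).card := fun Q _ _ ↦ by
      rw [smallPoints, Finset.filter_image,
        Finset.card_image_of_injective _ (levelHom_injective hP)]
      congr!
    classical
    rw [hcard, hcard]
    obtain ⟨x, hx, rfl⟩ := Finset.mem_image.mp hR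
    convert two_mul_card_levelBox_low_le (High := fun x ↦ High (levelHom P x))
      (Low := fun x ↦ Low (levelHom P x)) (fun y hy ↦ ?_) (fun y z hy hz ↦ ?_) ⟨x, hx, hRH⟩
    · rw [map_neg]; exact hneg _ hy
    · rw [map_add]; exact hadd _ _ hy hz

end SmallPoints

theorem theorem1p1 (a₄ a₆ : ℤ) (hE : (shortCurve a₄ a₆).IsElliptic)
    (hrank : 0 < Module.rank ℤ (RatPoint a₄ a₆))
    (P : RatPoint a₄ a₆) (hP : ¬ IsOfFinAddOrder P)
    (t D : ℤ) (ht : 0 < t) (hD : D = 4 * (t ^ 3 + a₄ * t - a₆))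
    (hlow : 4 * ((t : ℝ) + 1) ^ 2 * Real.exp (4 * heightDelta a₄ a₆) < (D : ℝ))
    (hup : D < (t + 1) ^ 2 * t ^ 2) :
    (torsionOrder a₄ a₆ : ℝ) ^ 2 / (hurwitzH (-D) + (torsionOrder a₄ a₆ : ℝ)) ^ 2
        * heightT a₄ a₆ D t ≤ canonHeight P := by
  obtain hw | hw := finite_or_infinite (AddCommGroup.torsion (RatPoint a₄ a₆))
  swap
  -- For an infinite torsion subgroup the formal value `Nat.card = 0` makes the left side vanish.
  · rw [torsionOrder, Nat.card_eq_zero_of_infinite]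
    simpa using canonHeight_nonneg hE P
  have := Fintype.ofFinite (AddCommGroup.torsion (RatPoint a₄ a₆))
  set n := t ^ 3 + a₄ * t - a₆ with hn
  have ht' : (0 : ℝ) < t := by exact_mod_cast ht
  have ht1 : (0 : ℝ) < ((t : ℝ) + 1) ^ 2 := by positivity
  have hDn : (D : ℝ) = 4 * n := by rw [hD]; push_cast; ring
  have hlow' : ((t : ℝ) + 1) ^ 2 * Real.exp (4 * heightDelta a₄ a₆) < n := by
    rw [hDn] at hlow; linarith
  have hT : heightT a₄ a₆ D t =
      Real.log (n / ((t : ℝ) + 1) ^ 2) - 4 * heightDelta a₄ a₆ := by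
    rw [heightT, hDn, mul_div_mul_left _ _ four_ne_zero]
  have hT0 : 0 < heightT a₄ a₆ D t := by
    rw [hT, sub_pos, Real.lt_log_iff_exp_lt, lt_div_iff₀ ht1, mul_comm]
    · exact hlow'
    · exact div_pos ((mul_pos ht1 (Real.exp_pos _)).trans hlow') ht1
  have hw1 : (0 : ℝ) < torsionOrder a₄ a₆ := by exact_mod_cast Nat.card_pos
  set w := (torsionOrder a₄ a₆ : ℝ)
  have hH := BinForm.hurwitzH_nonneg (-D)
  set H := hurwitzH (-D)
  by_contra! hlt
  rw [← div_pow] at hlt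
  -- The least `m` for which there are more than `H` points `k P + τ` with `|k| ≤ m`.
  set m := ⌊(H + w) / (2 * w)⌋₊ with hm
  have hmle : (m : ℝ) ≤ (H + w) / (2 * w) := Nat.floor_le (by positivity)
  have hmlt : (H + w) / (2 * w) < m + 1 := Nat.lt_floor_add_one _
  have hmany : H < (2 * m + 1) * w := by
    rw [div_lt_iff₀ (by positivity)] at hmlt
    linarith
  have hmh : (m : ℝ) ^ 2 * canonHeight P < heightT a₄ a₆ D t / 4 := by
    calc (m : ℝ) ^ 2 * canonHeight P ≤ ((H + w) / (2 * w)) ^ 2 * canonHeight P := by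
          have := canonHeight_nonneg hE P
          gcongr
      _ < ((H + w) / (2 * w)) ^ 2 * ((w / (H + w)) ^ 2 * heightT a₄ a₆ D t) := by
          gcongr
      _ = heightT a₄ a₆ D t / 4 := by field_simp; norm_num
  rw [hT] at hmh
  have hbox := box_smallPoints hE hP ht hn hlow' (by rw [← hD]; exact hup) hmh
  have hcard := hbox.card_le_hurwitzH
  rw [card_smallPoints hP, ← hD] at hcard
  push_cast at hcard
  linarith
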